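/- Let $(\xi_{i,j})_{i,j\in\mathbb Z}$ be a strictly stationary random field on a probability space, with values in a measurable space $E$ (for instance $E=\mathbb R$). Let $f:E^{\mathbb N\times\mathbb N}\to\mathbb R$ be measurable ($\mathbb N\ni 0$) and put $$X_{n,m}=f\big((\xi_{n-s,\,m-t})_{s,t\ge 0}\big),\qquad \mathcal F_{n,m}=\sigma(\xi_{i,j}: i\le n,\ j\le m),\qquad n,m\in\mathbb Z,$$ so that $X_{n,m}$ is one fixed measurable function of $(\xi_{i,j}: i\le n, j\le m)$. Assume that $X_{0,0}$ is integrable, and write $S_{k,j}=\sum_{u=1}^{k}\sum_{v=1}^{j}X_{u,v}$ and $\|\cdot\|$ for the norm of $L^2$ (with value $+\infty$ outside $L^2$). Assume that: 1. the filtration is commuting: for all integers $a,b,u,v$ with $a\ge u$ and every integrable random variable $Y$, $E(E(Y\mid\mathcal F_{a,b})\mid\mathcal F_{u,v})=E(Y\mid\mathcal F_{u,\min(b,v)})$ almost surely; 2. $\displaystyle\sum_{j,k\ge1}\frac{1}{j^{3/2}k^{3/2}}\,\|E(S_{j,k}\mid\mathcal F_{1,1})\|<\infty$; 3. the vertical shift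 $T$ of $E^{\mathbb Z\times\mathbb Z}$, $(Tx)_{i,j}=x_{i+1,j}$, is ergodic for the law of $(\xi_{i,j})_{i,j\in\mathbb Z}$. Then all the $S_{n_1,n_2}$ $(n_1,n_2\ge 0)$ are square integrable, and there is a real constant $c$ such that $$\frac{1}{n_1n_2}E(S_{n_1,n_2}^2)\to c^2\quad\text{and}\quad \frac{1}{\sqrt{n_1n_2}}\,S_{n_1,n_2}\Rightarrow N(0,c^2)\qquad\text{as }\min(n_1,n_2)\to\infty,$$ where $\Rightarrow$ denotes convergence in distribution and $N(0,0)$ is the point mass at $0$. -/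

import Mathlib

open MeasureTheory ProbabilityTheory Filter Topology
open scoped ENNReal NNReal

noncomputable section

namespace RandomField

variable {Ω E : Type*}

/-- The law, on the path space `ℤ × ℤ → E`, of a random field `ξ` indexed by `ℤ × ℤ`. -/
def pathLaw [MeasurableSpace Ω] [MeasurableSpace E] (μ : Measure Ω) (ξ : ℤ × ℤ → Ω → E) :
    Measure (ℤ × ℤ → E) :=
  μ.map (fun ω p => ξ p ω)

/-- Strict stationarity: all the translates of the field have the same law. -/
def IsStationary [MeasurableSpace Ω] [MeasurableSpace E] (μ : Measure Ω)
    (ξ : ℤ × ℤ → Ω → E) : Prop :=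
  ∀ a : ℤ × ℤ, pathLaw μ (fun p => ξ (p + a)) = pathLaw μ ξ

/-- The vertical shift on the path space: it moves the first index by one. -/
def vshift (x : ℤ × ℤ → E) : ℤ × ℤ → E := fun p => x (p.1 + 1, p.2)

/-- The σ-algebra `ℱ_{n,m} = σ(ξ_{i,j} : i ≤ n, j ≤ m)`. -/
abbrev pastSigma [MeasurableSpace E] (ξ : ℤ × ℤ → Ω → E) (n m : ℤ) : MeasurableSpace Ω :=
  ⨆ (i : ℤ) (_ : i ≤ n) (j : ℤ) (_ : j ≤ m), MeasurableSpace.comap (ξ (i, j)) inferInstance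

/-- The field `X_{n,m} = f(ξ_{i,j} : i ≤ n, j ≤ m)`. The quadrant `{i ≤ n, j ≤ m}` is
parametrized from its corner by `(s, t) ↦ (n - s, m - t)` with `s, t ∈ ℕ`. -/
def field (f : (ℕ × ℕ → E) → ℝ) (ξ : ℤ × ℤ → Ω → E) (n m : ℤ) (ω : Ω) : ℝ :=
  f (fun q => ξ (n - (q.1 : ℤ), m - (q.2 : ℤ)) ω)

/-- The partial sums `S_{k,j} = ∑_{u=1}^{k} ∑_{v=1}^{j} X_{u,v}`. -/
def partialSum (X : ℤ → ℤ → Ω → ℝ) (k j : ℕ) (ω : Ω) : ℝ :=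
  ∑ u ∈ Finset.Icc 1 k, ∑ v ∈ Finset.Icc 1 j, X (u : ℤ) (v : ℤ) ω

/-- The commuting property of a two-parameter family of σ-algebras: for `a ≥ u` and every
integrable `Y`, `E(E(Y | ℱ_{a,b}) | ℱ_{u,v}) = E(Y | ℱ_{u, b ∧ v})` almost surely. -/
def IsCommuting [MeasurableSpace Ω] (μ : Measure Ω) (F : ℤ → ℤ → MeasurableSpace Ω) : Prop :=
  ∀ a b u v : ℤ, u ≤ a → ∀ Y : Ω → ℝ, Integrable Y μ →
    μ[μ[Y | F a b] | F u v] =ᵐ[μ] μ[Y | F u (min b v)]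

/-- The two-parameter Maxwell–Woodroofe condition
`∑_{j,k ≥ 1} (jk)^{-3/2} ‖E(S_{j,k} | ℱ_{1,1})‖ < ∞`, with the norm of `L²`; the summation
indices are written `j + 1` and `k + 1` with `j, k ∈ ℕ`. -/
def MaxwellWoodroofe [MeasurableSpace Ω] (μ : Measure Ω) (F : ℤ → ℤ → MeasurableSpace Ω)
    (X : ℤ → ℤ → Ω → ℝ) : Prop :=
  ∑' (j : ℕ) (k : ℕ),
    ENNReal.ofReal (1 / (((j + 1 : ℕ) : ℝ) ^ (3 / 2 : ℝ) * ((k + 1 : ℕ) : ℝ) ^ (3 / 2 : ℝ))) *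
      eLpNorm (μ[partialSum X (j + 1) (k + 1) | F 1 1]) 2 μ < ∞

end RandomField

end

set_option linter.unusedSectionVars false

/-! The argument approximates the sums in `L²` by orthomartingales and then proves the central limit
theorem for orthomartingales.

Approximation. By the commuting property the conditional expectations are projections `E a b` of
`L²` with `E a b * E u v = E (min a u) (min b v)`, translated by two commuting isometries `U₁`, `U₂`
(a `BiShift`). If `S` is a block of length `a` in one direction, the correlation of `S` with the
next block `U₁ ^ a S` is at most `‖S‖ δ`, where `δ` is the norm of the projection of `S` onto the
past. Hence doubling the block costs a factor `√2` up to an additive `δ / √2`, and iteration bounds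
`‖S‖ / √length` by a dyadic Maxwell–Woodroofe series. Doing this in one direction, with the errors
estimated by the same inequality in the other, gives `norm_rectSum_le`. The compressions `Q₁`, `Q₂`
of the isometries to the past commute, so the inequality applies to long averages of their powers,
whose dyadic series tend to zero. Up to such averages, the adapted vector is a double coboundary `(1
- Q₁) (1 - Q₂) g`, which in turn is an orthomartingale difference `D` plus terms of smaller order
(`exists_isOrthoDiff`).

Limit theorem for `D`. Only the first translation is assumed ergodic, so no law of large numbers is
available in the second direction. The central limit theorem for ergodic martingale differences
shows that the normalized sums `W n` of `D` along `T₁` are asymptotically Gaussian; applied to `D ±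
D ∘ T₂^[k + 1]`, it shows that `W n` and `W n ∘ T₂^[k + 1]` are asymptotically independent. For
fixed `n` the translates of `W n` by `T₂` are martingale differences, and their squares satisfy a
law of large numbers jointly in both lengths, thanks to the asymptotic pairwise independence and
uniform integrability. McLeish's theorem, in the quantitative form
`IsMartingaleDiff.norm_integral_exp_le`, then gives the limit over rectangles.

Conclusion. Characteristic functions are Lipschitz in `L²`, so the limit passes from the
approximations `D` to the original sums; the norms `‖D‖` determine the constant `c`. All this takes
place on the path space, which carries the translations that the original probability space may
lack. -/

namespace RandomField

open scoped InnerProductSpace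
open Finset (range)

/-! ### Growth of subadditive sequences along dyadic blocks -/

/-- A subadditive sequence that is `O(√n)` along powers of two is `O(√n)`. -/
lemma le_sqrt_of_le_dyadic {a : ℕ → ℝ} {A : ℝ} (h0 : a 0 = 0)
    (hsub : ∀ m n, a (m + n) ≤ a m + a n) (hdy : ∀ r, a (2 ^ r) ≤ A * √2 ^ r) (hA : 0 ≤ A)
    (n : ℕ) : a n ≤ 3 * A * √n := by
  induction n using Nat.strong_induction_on with
  | _ n ih =>
    rcases Nat.eq_zero_or_pos n with rfl | hn
    · simp [h0]
    set r := Nat.log 2 n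
    have h1 : 2 ^ r ≤ n := Nat.pow_log_le_self 2 hn.ne'
    have h2 : n < 2 ^ (r + 1) := Nat.lt_pow_succ_log_self (by norm_num) n
    obtain ⟨q, hq⟩ := Nat.exists_eq_add_of_le h1
    have hq' : q < 2 ^ r := by rw [pow_succ] at h2; omega
    have hqn : q < n := lt_of_lt_of_le hq' h1
    have hp : √((2 ^ r : ℕ) : ℝ) = √2 ^ r := by
      rw [Nat.cast_pow, Nat.cast_ofNat, Real.sqrt_eq_iff_mul_self_eq (by positivity) (by positivity),
        ← mul_pow, Real.mul_self_sqrt (by norm_num)]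
    -- Writing `n = P + q` with `q < P`, squaring reduces the claim to `6 √(P q) ≤ 8 P`; this is why
    -- the constant 3 survives the induction.
    have key : √((2 ^ r : ℕ) : ℝ) + 3 * √(q : ℝ) ≤ 3 * √(n : ℝ) := by
      have e1 : (n : ℝ) = ((2 ^ r : ℕ) : ℝ) + q := by exact_mod_cast hq
      set P : ℝ := ((2 ^ r : ℕ) : ℝ)
      have hP : (q : ℝ) ≤ P := Nat.cast_le.2 hq'.le
      have hP0 : 0 ≤ P := by positivity
      have hq0 : (0 : ℝ) ≤ q := by positivity
      have s1 := Real.sqrt_le_sqrt hP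
      have s2 := Real.sq_sqrt hP0
      have s3 := Real.sq_sqrt hq0
      have : (√P + 3 * √(q : ℝ)) / 3 ≤ √(n : ℝ) := by
        apply Real.le_sqrt_of_sq_le
        rw [e1]
        nlinarith [Real.sqrt_nonneg P, Real.sqrt_nonneg (q : ℝ)]
      linarith
    calc a n = a (2 ^ r + q) := by rw [← hq]
      _ ≤ a (2 ^ r) + a q := hsub _ _
      _ ≤ A * √2 ^ r + 3 * A * √q := add_le_add (hdy r) (ih q hqn)
      _ = A * (√((2 ^ r : ℕ) : ℝ) + 3 * √(q : ℝ)) := by rw [hp]; ring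
      _ ≤ A * (3 * √(n : ℝ)) := mul_le_mul_of_nonneg_left key hA
      _ = _ := by ring

/-- The dyadic recursion behind the Maxwell–Woodroofe inequality. -/
lemma le_sqrt_mul_tsum {a δ : ℕ → ℝ} (h0 : a 0 = 0) (hsub : ∀ m n, a (m + n) ≤ a m + a n)
    (hδ : ∀ k, 0 ≤ δ k) (h1 : a 1 ≤ δ 0)
    (hrec : ∀ k, a (2 ^ (k + 1)) ≤ √2 * (a (2 ^ k) + δ k / 2))
    (hsum : Summable fun k => δ k / √2 ^ k) (n : ℕ) :
    a n ≤ 9 / 2 * √n * ∑' k, δ k / √2 ^ k := by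
  have h2 : (0 : ℝ) < √2 := by positivity
  have nn : ∀ k, 0 ≤ δ k / √2 ^ k := fun k => div_nonneg (hδ k) (by positivity)
  -- Dividing the recursion by `√2 ^ (k + 1)` makes it telescope: each step adds half a term of the
  -- series.
  have hr : ∀ r, a (2 ^ r) ≤ √2 ^ r * (δ 0 + 1 / 2 * ∑ k ∈ range r, δ k / √2 ^ k) := by
    intro r
    induction r with
    | zero => simpa using h1
    | succ r ih =>
      refine (hrec r).trans ?_
      rw [Finset.sum_range_succ]
      have : δ r = √2 ^ r * (δ r / √2 ^ r) := by field_simp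
      calc √2 * (a (2 ^ r) + δ r / 2)
          ≤ √2 * (√2 ^ r * (δ 0 + 1 / 2 * ∑ k ∈ range r, δ k / √2 ^ k)
            + √2 ^ r * (δ r / √2 ^ r) / 2) := by
            rw [← this]; gcongr
        _ = _ := by ring
  set B := ∑' k, δ k / √2 ^ k with hB
  have hS0 : 0 ≤ B := tsum_nonneg nn
  have hd0 : δ 0 ≤ B := by simpa using hsum.le_tsum 0 (fun j _ => nn j)
  -- The factor `3 / 2` collects `δ 0 ≤ B` and half of a partial sum; together with the 3 of the
  -- dyadic lemma it gives `9 / 2`.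
  have := le_sqrt_of_le_dyadic (a := a) (A := 3 / 2 * B) h0 hsub (fun r => ?_) (by positivity) n
  · refine this.trans (le_of_eq (by ring))
  · refine (hr r).trans ?_
    have := hsum.sum_le_tsum (range r) (fun j _ => nn j)
    have h3 : 0 < √2 ^ r := by positivity
    rw [mul_comm]
    gcongr
    rw [← hB] at this
    linarith

/-! ### Geometric sums of operators -/

section Operators

variable {H : Type*} [NormedAddCommGroup H] [InnerProductSpace ℝ H]

/-- The partial sum `∑_{i < n} Uⁱ`. -/
noncomputable def geomSum (U : H →L[ℝ] H) (n : ℕ) : H →L[ℝ] H := ∑ i ∈ range n, U ^ i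

@[simp] lemma geomSum_zero (U : H →L[ℝ] H) : geomSum U 0 = 0 := by simp [geomSum]

@[simp] lemma geomSum_one (U : H →L[ℝ] H) : geomSum U 1 = 1 := by simp [geomSum]

lemma geomSum_apply (U : H →L[ℝ] H) (n : ℕ) (x : H) :
    geomSum U n x = ∑ i ∈ range n, (U ^ i) x := by
  simp [geomSum]

lemma geomSum_add (U : H →L[ℝ] H) (m n : ℕ) :
    geomSum U (m + n) = geomSum U m + U ^ m * geomSum U n := by
  simp only [geomSum, Finset.sum_range_add, pow_add, Finset.mul_sum]

lemma one_sub_mul_geomSum (U : H →L[ℝ] H) (n : ℕ) : (1 - U) * geomSum U n = 1 - U ^ n :=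
  mul_neg_geom_sum U n

lemma geomSum_commute {U V : H →L[ℝ] H} (h : Commute U V) (n : ℕ) : Commute (geomSum U n) V :=
  Commute.sum_left _ _ _ fun i _ => h.pow_left i

lemma commute_apply {U V : H →L[ℝ] H} (h : Commute U V) (x : H) : U (V x) = V (U x) :=
  DFunLike.congr_fun h.eq x

lemma norm_pow_apply_le {U : H →L[ℝ] H} (hU : ∀ x, ‖U x‖ ≤ ‖x‖) (n : ℕ) (x : H) :
    ‖(U ^ n) x‖ ≤ ‖x‖ := by
  induction n with
  | zero => simp
  | succ n ih => rw [pow_succ']; exact (hU _).trans ih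

lemma norm_pow_apply {U : H →L[ℝ] H} (hU : ∀ x, ‖U x‖ = ‖x‖) (n : ℕ) (x : H) :
    ‖(U ^ n) x‖ = ‖x‖ := by
  induction n with
  | zero => simp
  | succ n ih => rw [pow_succ']; exact (hU _).trans ih

lemma norm_geomSum_apply_le {U : H →L[ℝ] H} (hU : ∀ x, ‖U x‖ ≤ ‖x‖) (n : ℕ) (x : H) :
    ‖geomSum U n x‖ ≤ n * ‖x‖ := by
  rw [geomSum_apply]
  refine (norm_sum_le _ _).trans ?_
  refine (Finset.sum_le_sum fun i _ => norm_pow_apply_le hU i x).trans ?_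
  simp

lemma norm_geomSum_add_le {U : H →L[ℝ] H} (hU : ∀ x, ‖U x‖ ≤ ‖x‖) (m n : ℕ) (x : H) :
    ‖geomSum U (m + n) x‖ ≤ ‖geomSum U m x‖ + ‖geomSum U n x‖ := by
  rw [geomSum_add]
  exact (norm_add_le _ _).trans (add_le_add le_rfl (norm_pow_apply_le hU _ _))

lemma norm_geomSum_apply_le_add {U : H →L[ℝ] H} (hU : ∀ x, ‖U x‖ ≤ ‖x‖) (m n : ℕ) (x : H) :
    ‖geomSum U m x‖ ≤ ‖geomSum U (m + n) x‖ + ‖geomSum U n x‖ := by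
  have : geomSum U m x = geomSum U (m + n) x - (U ^ m) (geomSum U n x) := by
    rw [geomSum_add]; simp
  rw [this]
  exact (norm_sub_le _ _).trans (add_le_add le_rfl (norm_pow_apply_le hU _ _))

/-- The average `(1/N) ∑_{i < N} Uⁱ`. -/
noncomputable def geomAvg (U : H →L[ℝ] H) (N : ℕ) : H →L[ℝ] H := (N : ℝ)⁻¹ • geomSum U N

lemma norm_geomAvg_apply_le {U : H →L[ℝ] H} (hU : ∀ x, ‖U x‖ ≤ ‖x‖) (n : ℕ) (x : H) :
    ‖geomAvg U n x‖ ≤ ‖x‖ := by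
  simp only [geomAvg, smul_apply, norm_smul, norm_inv, Real.norm_natCast]
  rcases Nat.eq_zero_or_pos n with rfl | hn
  · simp
  · rw [inv_mul_le_iff₀ (by positivity)]
    exact norm_geomSum_apply_le hU n x

lemma geomAvg_commute {U V : H →L[ℝ] H} (h : Commute U V) (n : ℕ) : Commute (geomAvg U n) V :=
  (geomSum_commute h n).smul_left _

/-- `1` minus an average of powers of `U` is a multiple of `1 - U`. -/
lemma one_sub_geomAvg (U : H →L[ℝ] H) {N : ℕ} (hN : N ≠ 0) :
    1 - geomAvg U N = (1 - U) * ((N : ℝ)⁻¹ • ∑ i ∈ range N, geomSum U i) := by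
  have hN' : (N : ℝ) ≠ 0 := by exact_mod_cast hN
  rw [mul_smul_comm, Finset.mul_sum, Finset.sum_congr rfl fun i _ => one_sub_mul_geomSum U i,
    Finset.sum_sub_distrib, Finset.sum_const, Finset.card_range, smul_sub,
    ← Nat.cast_smul_eq_nsmul ℝ, smul_smul, inv_mul_cancel₀ hN', one_smul, geomAvg, geomSum]

/-- The dyadic summands of the two-parameter Maxwell–Woodroofe series. -/
noncomputable def dyadicTerm (P Q : H →L[ℝ] H) (x : H) (p : ℕ × ℕ) : ℝ :=
  ‖geomSum P (2 ^ p.1) (geomSum Q (2 ^ p.2) x)‖ / (√2 ^ p.1 * √2 ^ p.2)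

lemma dyadicTerm_nonneg (P Q : H →L[ℝ] H) (x : H) (p : ℕ × ℕ) : 0 ≤ dyadicTerm P Q x p := by
  unfold dyadicTerm; positivity

lemma dyadicTerm_swap {P Q : H →L[ℝ] H} (h : Commute P Q) (x : H) (p : ℕ × ℕ) :
    dyadicTerm P Q x p.swap = dyadicTerm Q P x p := by
  have h1 : Commute (geomSum P (2 ^ p.2)) (geomSum Q (2 ^ p.1)) :=
    (geomSum_commute (geomSum_commute h _).symm _).symm
  have : geomSum P (2 ^ p.2) (geomSum Q (2 ^ p.1) x)
      = geomSum Q (2 ^ p.1) (geomSum P (2 ^ p.2) x) :=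
    commute_apply h1 x
  simp only [dyadicTerm, Prod.swap, this, mul_comm]

lemma dyadicTerm_apply_le {P Q A : H →L[ℝ] H} (hA : ∀ x, ‖A x‖ ≤ ‖x‖) (hP : Commute A P)
    (hQ : Commute A Q) (x : H) (p : ℕ × ℕ) : dyadicTerm P Q (A x) p ≤ dyadicTerm P Q x p := by
  have : geomSum P (2 ^ p.1) (geomSum Q (2 ^ p.2) (A x))
      = A (geomSum P (2 ^ p.1) (geomSum Q (2 ^ p.2) x)) := by
    rw [commute_apply (geomSum_commute hQ.symm _), commute_apply (geomSum_commute hP.symm _)]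
  unfold dyadicTerm
  rw [this]
  gcongr
  exact hA _

lemma dyadicTerm_add_le (P Q : H →L[ℝ] H) (x y : H) (p : ℕ × ℕ) :
    dyadicTerm P Q (x + y) p ≤ dyadicTerm P Q x p + dyadicTerm P Q y p := by
  unfold dyadicTerm
  rw [← add_div, map_add, map_add]
  gcongr
  exact norm_add_le _ _

lemma dyadicTerm_neg (P Q : H →L[ℝ] H) (x : H) (p : ℕ × ℕ) :
    dyadicTerm P Q (-x) p = dyadicTerm P Q x p := by
  unfold dyadicTerm
  rw [map_neg, map_neg, norm_neg]

/-- The dyadic series of the averages of `x` tends to zero. -/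
lemma tendsto_tsum_dyadicTerm_geomAvg {P Q : H →L[ℝ] H} (hP : ∀ x, ‖P x‖ ≤ ‖x‖)
    (h : Commute P Q) {x : H} (hx : Summable (dyadicTerm P Q x)) :
    Tendsto (fun r : ℕ => ∑' p, dyadicTerm P Q (geomAvg P (2 ^ r) x) p) atTop (𝓝 0) := by
  have key : Tendsto (fun r : ℕ => ∑' p, dyadicTerm P Q (geomAvg P (2 ^ r) x) p) atTop
      (𝓝 (∑' _ : ℕ × ℕ, (0 : ℝ))) := by
    -- The dominating series is that of `x`, since averages of powers of `P` are contractions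
    -- commuting with `P` and `Q`. For each term, summability bounds `‖geomSum P (2 ^ r) (geomSum Q
    -- (2 ^ p.2) x)‖` by a multiple of `√2 ^ r`, while averaging divides by `2 ^ r`, so the term
    -- decays like `√2 ^ (-r)`.
    refine tendsto_tsum_of_dominated_convergence hx (fun p => ?_) (Eventually.of_forall fun r p => ?_)
    · set B := ∑' p, dyadicTerm P Q x p
      have hB : ∀ r, ‖geomSum P (2 ^ r) (geomSum Q (2 ^ p.2) x)‖ ≤ B * (√2 ^ r * √2 ^ p.2) := by
        intro r
        have := hx.le_tsum (r, p.2) (fun j _ => dyadicTerm_nonneg _ _ _ _)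
        unfold dyadicTerm at this
        rwa [div_le_iff₀ (by positivity)] at this
      refine squeeze_zero (g := fun r : ℕ => 2 ^ p.1 * B * (√2)⁻¹ ^ r)
        (fun r => dyadicTerm_nonneg _ _ _ _) (fun r => ?_) ?_
      · have e : geomSum P (2 ^ p.1) (geomSum Q (2 ^ p.2) (geomAvg P (2 ^ r) x))
            = geomSum P (2 ^ p.1) (((2 ^ r : ℕ) : ℝ)⁻¹ •
                geomSum P (2 ^ r) (geomSum Q (2 ^ p.2) x)) := by
          have h1 : Commute (geomSum P (2 ^ r)) (geomSum Q (2 ^ p.2)) :=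
            (geomSum_commute (geomSum_commute h _).symm _).symm
          simp [geomAvg, commute_apply h1 x]
        unfold dyadicTerm
        rw [e, div_le_iff₀ (by positivity)]
        refine (norm_geomSum_apply_le hP _ _).trans ?_
        rw [norm_smul]
        have h4 : ((2 ^ r : ℕ) : ℝ) = √2 ^ r * √2 ^ r := by
          rw [← mul_pow, Real.mul_self_sqrt (by norm_num)]; simp
        have h1 : (1 : ℝ) ≤ √2 ^ p.1 := one_le_pow₀ (Real.one_le_sqrt.2 (by norm_num))
        have hB0 : 0 ≤ B := tsum_nonneg fun p => dyadicTerm_nonneg _ _ _ _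
        rw [norm_inv, Real.norm_natCast]
        calc ((2 ^ p.1 : ℕ) : ℝ) * (((2 ^ r : ℕ) : ℝ)⁻¹ *
              ‖geomSum P (2 ^ r) (geomSum Q (2 ^ p.2) x)‖)
            ≤ ((2 ^ p.1 : ℕ) : ℝ) * (((2 ^ r : ℕ) : ℝ)⁻¹ * (B * (√2 ^ r * √2 ^ p.2))) := by
              gcongr; exact hB r
          _ = 2 ^ p.1 * B * (√2)⁻¹ ^ r * (1 * √2 ^ p.2) := by
              rw [h4, inv_pow]; push_cast; field_simp
          _ ≤ _ := by gcongr
      · have : Tendsto (fun r : ℕ => (√2)⁻¹ ^ r) atTop (𝓝 0) :=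
          tendsto_pow_atTop_nhds_zero_of_lt_one (by positivity)
            (inv_lt_one_of_one_lt₀ (by rw [Real.lt_sqrt] <;> norm_num))
        simpa using this.const_mul (2 ^ p.1 * B)
    · rw [Real.norm_of_nonneg (dyadicTerm_nonneg _ _ _ _)]
      exact dyadicTerm_apply_le (norm_geomAvg_apply_le hP _) (geomAvg_commute (Commute.refl P) _)
        (geomAvg_commute h _) x p
  simpa using key

/-- Expanding, `‖x + y‖² ≤ 2 (‖x‖² + ‖x‖ δ) ≤ 2 (‖x‖ + δ / 2)²`. This is the source of the factor
`√2` per doubling. -/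
lemma norm_add_le_of_inner_le {x y : H} {δ : ℝ} (hxy : ‖y‖ = ‖x‖) (hδ : 0 ≤ δ)
    (h : ⟪x, y⟫_ℝ ≤ ‖x‖ * δ) : ‖x + y‖ ≤ √2 * (‖x‖ + δ / 2) := by
  refine (sq_le_sq₀ (norm_nonneg _) (by positivity)).1 ?_
  rw [mul_pow, Real.sq_sqrt (by norm_num), norm_add_sq_real, hxy]
  nlinarith [sq_nonneg δ]

/-- A sum of `n` orthogonal translates of `p` has norm `√n ‖p‖`. -/
lemma norm_geomSum_of_orthogonal {U : H →L[ℝ] H} (hU : ∀ x, ‖U x‖ = ‖x‖) {p : H}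
    (horth : ∀ i : ℕ, ⟪p, (U ^ (i + 1)) p⟫_ℝ = 0) (n : ℕ) : ‖geomSum U n p‖ = √n * ‖p‖ := by
  have hinner : ∀ x y, ⟪U x, U y⟫_ℝ = ⟪x, y⟫_ℝ := by
    intro x y
    rw [real_inner_eq_norm_add_mul_self_sub_norm_mul_self_sub_norm_mul_self_div_two,
      real_inner_eq_norm_add_mul_self_sub_norm_mul_self_sub_norm_mul_self_div_two,
      ← map_add, hU, hU, hU]
  have hsq : ‖geomSum U n p‖ ^ 2 = n * ‖p‖ ^ 2 := by
    induction n with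
    | zero => simp
    | succ n ih =>
      have e : geomSum U (n + 1) p = p + U (geomSum U n p) := by
        rw [add_comm n 1, geomSum_add]; simp
      have o : ⟪p, U (geomSum U n p)⟫_ℝ = 0 := by
        rw [geomSum_apply, map_sum, inner_sum]
        refine Finset.sum_eq_zero fun i _ => ?_
        simpa [pow_succ'] using horth i
      rw [e, norm_add_sq_real, o, hU, ih]
      push_cast; ring
  rw [← Real.sqrt_sq (norm_nonneg (geomSum U n p)), hsq, Real.sqrt_mul (by positivity),
    Real.sqrt_sq (norm_nonneg _)]

end Operators

/-! ### Two-parameter commuting systems in a Hilbert space -/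

/-- Two commuting isometries of a Hilbert space together with a two-parameter commuting family of
orthogonal projections which they translate. -/
structure BiShift (H : Type*) [NormedAddCommGroup H] [InnerProductSpace ℝ H] where
  U₁ : H →L[ℝ] H
  U₂ : H →L[ℝ] H
  E : ℤ → ℤ → H →L[ℝ] H
  norm_U₁ : ∀ x, ‖U₁ x‖ = ‖x‖
  norm_U₂ : ∀ x, ‖U₂ x‖ = ‖x‖
  U_comm : Commute U₁ U₂
  E_symm : ∀ a b x y, ⟪E a b x, y⟫_ℝ = ⟪x, E a b y⟫_ℝ
  E_E : ∀ a b u v x, E a b (E u v x) = E (min a u) (min b v) x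
  U₁_E : ∀ a b x, U₁ (E a b x) = E (a + 1) b (U₁ x)
  U₂_E : ∀ a b x, U₂ (E a b x) = E a (b + 1) (U₂ x)

namespace BiShift

variable {H : Type*} [NormedAddCommGroup H] [InnerProductSpace ℝ H] (B : BiShift H)

/-- The system in which the two directions are exchanged. -/
def swap : BiShift H where
  U₁ := B.U₂
  U₂ := B.U₁
  E a b := B.E b a
  norm_U₁ := B.norm_U₂
  norm_U₂ := B.norm_U₁
  U_comm := B.U_comm.symm
  E_symm a b := B.E_symm b a
  E_E a b u v := B.E_E b a v u
  U₁_E a b := B.U₂_E b a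
  U₂_E a b := B.U₁_E b a

lemma norm_E_le (a b : ℤ) (x : H) : ‖B.E a b x‖ ≤ ‖x‖ := by
  have h : ‖B.E a b x‖ * ‖B.E a b x‖ ≤ ‖x‖ * ‖B.E a b x‖ := by
    rw [← real_inner_self_eq_norm_mul_norm, B.E_symm, B.E_E, min_self, min_self]
    exact real_inner_le_norm _ _
  by_contra! hlt
  nlinarith [norm_nonneg x]

lemma pow_U₁_E (n : ℕ) (a b : ℤ) (x : H) :
    (B.U₁ ^ n) (B.E a b x) = B.E (a + n) b ((B.U₁ ^ n) x) := by
  induction n with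
  | zero => simp
  | succ n ih =>
    simp only [pow_succ', mul_apply_eq_comp, ih, B.U₁_E]
    push_cast; rw [add_assoc]

lemma pow_U₂_E (n : ℕ) (a b : ℤ) (x : H) :
    (B.U₂ ^ n) (B.E a b x) = B.E a (b + n) ((B.U₂ ^ n) x) := B.swap.pow_U₁_E n b a x

lemma E_of_le {a b u v : ℤ} {x : H} (hx : B.E a b x = x) (hu : a ≤ u) (hv : b ≤ v) :
    B.E u v x = x := by
  rw [← hx, B.E_E, min_eq_right hu, min_eq_right hv]

lemma E_pow_U₁ {a b u v : ℤ} {x : H} {n : ℕ} (hx : B.E a b x = x) (hu : a + n ≤ u) (hv : b ≤ v) :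
    B.E u v ((B.U₁ ^ n) x) = (B.U₁ ^ n) x :=
  B.E_of_le (by rw [← B.pow_U₁_E, hx]) hu hv

lemma E_geomSum_U₁ {a b u v : ℤ} {x : H} {n : ℕ} (hx : B.E a b x = x) (hu : a + n ≤ u)
    (hv : b ≤ v) : B.E u v (geomSum B.U₁ n x) = geomSum B.U₁ n x := by
  rw [geomSum_apply, map_sum]
  refine Finset.sum_congr rfl fun i hi => B.E_pow_U₁ hx ?_ hv
  have := Finset.mem_range.1 hi
  omega

lemma E_geomSum_U₂ {a b u v : ℤ} {x : H} {n : ℕ} (hx : B.E a b x = x) (hu : a ≤ u)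
    (hv : b + n ≤ v) : B.E u v (geomSum B.U₂ n x) = geomSum B.U₂ n x :=
  B.swap.E_geomSum_U₁ hx hv hu

/-- The compression of `U₁` to the past. -/
def Q₁ : H →L[ℝ] H := B.E 0 0 * B.U₁

/-- The compression of `U₂` to the past. -/
def Q₂ : H →L[ℝ] H := B.E 0 0 * B.U₂

lemma Q₁_apply (x : H) : B.Q₁ x = B.E 0 0 (B.U₁ x) := rfl
lemma Q₂_apply (x : H) : B.Q₂ x = B.E 0 0 (B.U₂ x) := rfl

lemma norm_Q₁_le (x : H) : ‖B.Q₁ x‖ ≤ ‖x‖ := (B.norm_E_le _ _ _).trans (B.norm_U₁ x).le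
lemma norm_Q₂_le (x : H) : ‖B.Q₂ x‖ ≤ ‖x‖ := (B.norm_E_le _ _ _).trans (B.norm_U₂ x).le

/-- Moving a translation across `E 0 0` only enlarges the past, and the outer `E 0 0` absorbs the
larger projection: both products equal `E 0 0 * U₁ * U₂`. -/
lemma Q_comm : Commute B.Q₁ B.Q₂ := by
  ext x
  simp only [mul_apply_eq_comp, Q₁_apply, Q₂_apply, B.U₁_E, B.U₂_E, B.E_E,
    commute_apply B.U_comm]
  norm_num

lemma E_Q₁ (x : H) : B.E 0 0 (B.Q₁ x) = B.Q₁ x := by simp [Q₁_apply, B.E_E]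

lemma E_pow_Q₁ {x : H} (hx : B.E 0 0 x = x) (n : ℕ) : B.E 0 0 ((B.Q₁ ^ n) x) = (B.Q₁ ^ n) x := by
  cases n with
  | zero => simpa
  | succ n => rw [pow_succ']; exact B.E_Q₁ _

lemma E_geomSum_Q₁ {x : H} (hx : B.E 0 0 x = x) (n : ℕ) :
    B.E 0 0 (geomSum B.Q₁ n x) = geomSum B.Q₁ n x := by
  rw [geomSum_apply, map_sum]
  exact Finset.sum_congr rfl fun i _ => B.E_pow_Q₁ hx i

lemma E_geomSum_Q₂ {x : H} (hx : B.E 0 0 x = x) (n : ℕ) :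
    B.E 0 0 (geomSum B.Q₂ n x) = geomSum B.Q₂ n x := B.swap.E_geomSum_Q₁ hx n

/-- Inserting projections between successive translations changes nothing, because each of them
becomes a projection onto a larger past and is absorbed by the last `E 0 0`. -/
lemma E_zero_pow_U₁ {x : H} (hx : B.E 0 0 x = x) (n : ℕ) :
    B.E 0 0 ((B.U₁ ^ n) x) = (B.Q₁ ^ n) x := by
  induction n with
  | zero => simpa
  | succ n ih =>
    simp only [pow_succ', mul_apply_eq_comp, ← ih, Q₁_apply, B.U₁_E, B.E_E]
    norm_num

lemma E_zero_geomSum_U₁ {x : H} (hx : B.E 0 0 x = x) (n : ℕ) :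
    B.E 0 0 (geomSum B.U₁ n x) = geomSum B.Q₁ n x := by
  simp only [geomSum_apply, map_sum, B.E_zero_pow_U₁ hx]

lemma E_zero_geomSum_U₂ {x : H} (hx : B.E 0 0 x = x) (n : ℕ) :
    B.E 0 0 (geomSum B.U₂ n x) = geomSum B.Q₂ n x := B.swap.E_zero_geomSum_U₁ hx n

/-- The partial sums over a rectangle. -/
noncomputable def rectSum (n m : ℕ) : H →L[ℝ] H := geomSum B.U₁ n * geomSum B.U₂ m

lemma rectSum_apply (n m : ℕ) (x : H) : B.rectSum n m x = geomSum B.U₁ n (geomSum B.U₂ m x) := rfl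

lemma commute_geomSum_U (n m : ℕ) : Commute (geomSum B.U₁ n) (geomSum B.U₂ m) :=
  (geomSum_commute (geomSum_commute B.U_comm _).symm _).symm

lemma rectSum_apply' (n m : ℕ) (x : H) : B.rectSum n m x = geomSum B.U₂ m (geomSum B.U₁ n x) :=
  commute_apply (B.commute_geomSum_U n m) x

lemma norm_U₁_le (x : H) : ‖B.U₁ x‖ ≤ ‖x‖ := (B.norm_U₁ x).le
lemma norm_U₂_le (x : H) : ‖B.U₂ x‖ ≤ ‖x‖ := (B.norm_U₂ x).le

/-- Projecting in the first direction only. In the second direction the `j`-th summand is already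
adapted: undoing `U₂ ^ j`, the sum of the `U₁`-translates lies in the past of `(n, 0)`, where
projecting onto `(0, m - j)` or onto `(0, 0)` is the same. The result is a sum along `U₂` of an
adapted vector, to which the one-parameter inequality applies. -/
lemma E_zero_rectSum_nonneg {x : H} (hx : B.E 0 0 x = x) (n m : ℕ) :
    B.E 0 m (B.rectSum n m x) = geomSum B.U₂ m (geomSum B.Q₁ n x) := by
  rw [rectSum_apply', geomSum_apply B.U₂, geomSum_apply B.U₂, map_sum]
  refine Finset.sum_congr rfl fun j hj => ?_
  have hj' := Finset.mem_range.1 hj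
  have h1 : ((m : ℤ) - j) + (j : ℕ) = m := by ring
  have h2 := B.pow_U₂_E j 0 ((m : ℤ) - j) (geomSum B.U₁ n x)
  rw [h1] at h2
  rw [← h2, ← B.E_zero_geomSum_U₁ hx, ← B.E_geomSum_U₁ (u := n) (v := 0) hx (by simp) le_rfl,
    B.E_E, B.E_E]
  rw [min_eq_right (by omega : (0 : ℤ) ≤ m - j), min_self]

lemma E_zero_rectSum {x : H} (hx : B.E 0 0 x = x) (n m : ℕ) :
    B.E 0 0 (B.rectSum n m x) = geomSum B.Q₁ n (geomSum B.Q₂ m x) := by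
  have : B.E 0 0 (B.rectSum n m x) = B.E 0 0 (B.E 0 m (B.rectSum n m x)) := by
    rw [B.E_E]; congr 1
  rw [this, B.E_zero_rectSum_nonneg hx, B.E_zero_geomSum_U₂ (B.E_geomSum_Q₁ hx n)]
  exact (commute_apply (geomSum_commute (geomSum_commute B.Q_comm _).symm _).symm x).symm

/-- Since `S` is in the past of `(a, b)`, the second factor may be projected there, and `E a b * U₁
^ a = U₁ ^ a * E 0 b`. -/
lemma inner_pow_U₁_le {S : H} {a : ℕ} {b : ℤ} (hS : B.E a b S = S) :
    ⟪S, (B.U₁ ^ a) S⟫_ℝ ≤ ‖S‖ * ‖B.E 0 b S‖ := by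
  have h := B.pow_U₁_E a 0 b S
  rw [zero_add] at h
  calc ⟪S, (B.U₁ ^ a) S⟫_ℝ = ⟪B.E a b S, (B.U₁ ^ a) S⟫_ℝ := by rw [hS]
    _ = ⟪S, (B.U₁ ^ a) (B.E 0 b S)⟫_ℝ := by rw [B.E_symm, h]
    _ ≤ ‖S‖ * ‖(B.U₁ ^ a) (B.E 0 b S)‖ := real_inner_le_norm _ _
    _ = _ := by rw [norm_pow_apply B.norm_U₁]

/-- The doubled block is `S + U₁ ^ a S`, with correlation at most `‖S‖ ‖E 0 b S‖`. The error keeps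
the uncompressed sum along `U₂`, so that it can be estimated in its turn. -/
lemma norm_geomSum_U₁_two_mul_le {x : H} (hx : B.E 0 0 x = x) (a b : ℕ) :
    ‖geomSum B.U₁ (a + a) (geomSum B.U₂ b x)‖ ≤
      √2 * (‖geomSum B.U₁ a (geomSum B.U₂ b x)‖ + ‖geomSum B.U₂ b (geomSum B.Q₁ a x)‖ / 2) := by
  rw [geomSum_add, ← B.E_zero_rectSum_nonneg hx]
  simp only [add_apply, mul_apply_eq_comp]
  rw [← rectSum_apply]
  refine norm_add_le_of_inner_le (norm_pow_apply B.norm_U₁ _ _) (norm_nonneg _)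
    (B.inner_pow_U₁_le ?_)
  rw [rectSum_apply]
  exact B.E_geomSum_U₁ (B.E_geomSum_U₂ (u := 0) (v := b) hx le_rfl (by simp)) (by simp) le_rfl

lemma norm_geomSum_U₂_two_mul_le {x : H} (hx : B.E 0 0 x = x) (b : ℕ) :
    ‖geomSum B.U₂ (b + b) x‖ ≤ √2 * (‖geomSum B.U₂ b x‖ + ‖geomSum B.Q₂ b x‖ / 2) := by
  simpa [swap, Q₁, Q₂] using B.swap.norm_geomSum_U₁_two_mul_le hx b 1

/-- One-parameter Maxwell–Woodroofe inequality. -/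
lemma norm_geomSum_U₂_le {x : H} (hx : B.E 0 0 x = x)
    (hs : Summable fun k : ℕ => ‖geomSum B.Q₂ (2 ^ k) x‖ / √2 ^ k) (b : ℕ) :
    ‖geomSum B.U₂ b x‖ ≤ 9 / 2 * √b * ∑' k : ℕ, ‖geomSum B.Q₂ (2 ^ k) x‖ / √2 ^ k := by
  refine le_sqrt_mul_tsum (a := fun b => ‖geomSum B.U₂ b x‖)
    (δ := fun k => ‖geomSum B.Q₂ (2 ^ k) x‖) (by simp)
    (fun m n => norm_geomSum_add_le B.norm_U₂_le m n x) (fun _ => norm_nonneg _) (by simp)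
    (fun k => ?_) hs b
  rw [pow_succ, mul_two]
  exact B.norm_geomSum_U₂_two_mul_le hx _

/-- Two-parameter Maxwell–Woodroofe inequality. -/
lemma norm_rectSum_le {x : H} (hx : B.E 0 0 x = x) (hs : Summable (dyadicTerm B.Q₁ B.Q₂ x))
    (n m : ℕ) :
    ‖B.rectSum n m x‖ ≤ 81 / 4 * (√n * √m) * ∑' p, dyadicTerm B.Q₁ B.Q₂ x p := by
  have hterm : ∀ k l : ℕ, ‖geomSum B.Q₂ (2 ^ l) (geomSum B.Q₁ (2 ^ k) x)‖ / √2 ^ l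
      = √2 ^ k * dyadicTerm B.Q₁ B.Q₂ x (k, l) := by
    intro k l
    rw [dyadicTerm, commute_apply (geomSum_commute (geomSum_commute B.Q_comm _).symm _).symm x]
    field_simp
  have hs2 : ∀ k : ℕ, Summable fun l : ℕ =>
      ‖geomSum B.Q₂ (2 ^ l) (geomSum B.Q₁ (2 ^ k) x)‖ / √2 ^ l := by
    intro k
    simp only [hterm]
    exact (hs.prod_factor k).mul_left _
  set M : ℕ → ℝ := fun k => ∑' l : ℕ, dyadicTerm B.Q₁ B.Q₂ x (k, l) with hM
  have hM0 : ∀ k, 0 ≤ M k := fun k => tsum_nonneg fun l => dyadicTerm_nonneg _ _ _ _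
  have hMs : Summable M := hs.prod
  -- The one-parameter inequality in the second direction, applied to the compressed block of length
  -- `2 ^ k`, estimates the error terms of the recursion in the first direction. The two uses of the
  -- constant `9 / 2` produce `81 / 4`.
  have hb : ∀ k b : ℕ, ‖geomSum B.U₂ b (geomSum B.Q₁ (2 ^ k) x)‖ ≤ 9 / 2 * √b * (√2 ^ k * M k) := by
    intro k b
    refine (B.norm_geomSum_U₂_le (B.E_geomSum_Q₁ hx _) (hs2 k) b).trans (le_of_eq ?_)
    simp only [hterm, tsum_mul_left, hM]
  have e : ∀ k, 9 / 2 * √m * (√2 ^ k * M k) / √2 ^ k = 9 / 2 * √m * M k := by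
    intro k; field_simp
  have := le_sqrt_mul_tsum (a := fun n => ‖geomSum B.U₁ n (geomSum B.U₂ m x)‖)
    (δ := fun k => 9 / 2 * √m * (√2 ^ k * M k)) (by simp)
    (fun i j => norm_geomSum_add_le B.norm_U₁_le i j _)
    (fun k => by have := hM0 k; positivity) (by simpa using hb 0 m) (fun k => ?_)
    (by simpa only [e] using hMs.mul_left _) n
  · refine this.trans (le_of_eq ?_)
    rw [tsum_congr e, tsum_mul_left, hs.tsum_prod]
    ring
  · rw [pow_succ, mul_two]
    refine (B.norm_geomSum_U₁_two_mul_le hx _ m).trans ?_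
    gcongr
    exact hb k m

/-- Approximation by double coboundaries. -/
lemma exists_norm_rectSum_sub_le {x : H} (hx : B.E 0 0 x = x)
    (hs : Summable (dyadicTerm B.Q₁ B.Q₂ x)) {ε : ℝ} (hε : 0 < ε) :
    ∃ g, B.E 0 0 g = g ∧
      ∀ n m : ℕ, ‖B.rectSum n m (x - (1 - B.Q₁) ((1 - B.Q₂) g))‖ ≤ ε * (√n * √m) := by
  have t1 := tendsto_tsum_dyadicTerm_geomAvg B.norm_Q₁_le B.Q_comm hs
  have hs' : Summable (dyadicTerm B.Q₂ B.Q₁ x) := by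
    have := (Equiv.prodComm ℕ ℕ).summable_iff.2 hs
    refine this.congr fun p => ?_
    exact dyadicTerm_swap B.Q_comm x p
  have t2 := tendsto_tsum_dyadicTerm_geomAvg B.norm_Q₂_le B.Q_comm.symm hs'
  -- Three dyadic series will be added below, and `81 / 4 * (3 * (4 ε / 243)) = ε`.
  obtain ⟨r, hr1, hr2⟩ := ((t1.eventually_lt_const (u := 4 * ε / 243) (by positivity)).and
    (t2.eventually_lt_const (u := 4 * ε / 243) (by positivity))).exists
  set N := 2 ^ r
  have hN : N ≠ 0 := by positivity
  set g₁ : H →L[ℝ] H := (N : ℝ)⁻¹ • ∑ i ∈ range N, geomSum B.Q₁ i with hg₁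
  set g₂ : H →L[ℝ] H := (N : ℝ)⁻¹ • ∑ i ∈ range N, geomSum B.Q₂ i with hg₂
  have c1 : 1 - geomAvg B.Q₁ N = (1 - B.Q₁) * g₁ := one_sub_geomAvg _ hN
  have c2 : 1 - geomAvg B.Q₂ N = (1 - B.Q₂) * g₂ := one_sub_geomAvg _ hN
  have hE2 : B.E 0 0 (g₂ x) = g₂ x := by
    simp only [hg₂, smul_apply, sum_apply, map_smul, map_sum, B.E_geomSum_Q₂ hx]
  have hE1 : B.E 0 0 (g₁ (g₂ x)) = g₁ (g₂ x) := by
    simp only [hg₁, smul_apply, sum_apply, map_smul, map_sum, B.E_geomSum_Q₁ hE2]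
  have comm12 : Commute g₁ (1 - B.Q₂) := by
    refine Commute.smul_left (Commute.sum_left _ _ _ fun i _ => ?_) _
    exact geomSum_commute ((Commute.one_right _).sub_right B.Q_comm) i
  refine ⟨g₁ (g₂ x), hE1, fun n m => ?_⟩
  have e1 : (1 - B.Q₁) ((1 - B.Q₂) (g₁ (g₂ x)))
      = (1 - geomAvg B.Q₁ N) ((1 - geomAvg B.Q₂ N) x) := by
    rw [c1, c2]
    simp only [mul_apply_eq_comp]
    rw [commute_apply comm12]
  set A₁ := geomAvg B.Q₁ N
  set A₂ := geomAvg B.Q₂ N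
  -- What the double coboundary misses is a combination of averages of `x`, each with a small dyadic
  -- series; the product `A₂ A₁ x` is dominated by `A₁ x`.
  have e2 : x - (1 - A₁) ((1 - A₂) x) = (A₁ x + A₂ x) + -(A₂ (A₁ x)) := by
    have : Commute A₁ A₂ := (geomAvg_commute (geomAvg_commute B.Q_comm _).symm _).symm
    simp only [sub_apply, one_apply_eq_self, map_sub, commute_apply this]
    abel
  rw [e1, e2]
  have EA1 : B.E 0 0 (A₁ x) = A₁ x := by
    simp only [A₁, geomAvg, smul_apply, map_smul, B.E_geomSum_Q₁ hx]
  have EA2 : ∀ y, B.E 0 0 y = y → B.E 0 0 (A₂ y) = A₂ y := by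
    intro y hy
    simp only [A₂, geomAvg, smul_apply, map_smul, B.E_geomSum_Q₂ hy]
  have k1 : Commute A₁ B.Q₁ := geomAvg_commute (Commute.refl _) _
  have k2 : Commute A₁ B.Q₂ := geomAvg_commute B.Q_comm _
  have k3 : Commute A₂ B.Q₁ := geomAvg_commute B.Q_comm.symm _
  have k4 : Commute A₂ B.Q₂ := geomAvg_commute (Commute.refl _) _
  have n1 := norm_geomAvg_apply_le B.norm_Q₁_le N
  have n2 := norm_geomAvg_apply_le B.norm_Q₂_le N
  have s1 : Summable (dyadicTerm B.Q₁ B.Q₂ (A₁ x)) := Summable.of_nonneg_of_le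
    (fun _ => dyadicTerm_nonneg _ _ _ _) (dyadicTerm_apply_le n1 k1 k2 x) hs
  have s2 : Summable (dyadicTerm B.Q₁ B.Q₂ (A₂ x)) := Summable.of_nonneg_of_le
    (fun _ => dyadicTerm_nonneg _ _ _ _) (dyadicTerm_apply_le n2 k3 k4 x) hs
  have b3 : ∀ p, dyadicTerm B.Q₁ B.Q₂ (A₁ x + A₂ x + -(A₂ (A₁ x))) p ≤
      dyadicTerm B.Q₁ B.Q₂ (A₁ x) p + dyadicTerm B.Q₁ B.Q₂ (A₂ x) p
        + dyadicTerm B.Q₁ B.Q₂ (A₁ x) p := by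
    intro p
    refine (dyadicTerm_add_le _ _ _ _ _).trans (add_le_add (dyadicTerm_add_le _ _ _ _ _) ?_)
    rw [dyadicTerm_neg]
    exact dyadicTerm_apply_le n2 k3 k4 _ p
  have s3 := Summable.of_nonneg_of_le (fun _ => dyadicTerm_nonneg _ _ _ _) b3 ((s1.add s2).add s1)
  refine (B.norm_rectSum_le (by simp only [map_add, map_neg, EA1, EA2 x hx, EA2 _ EA1]) s3
    n m).trans ?_
  have hle := s3.tsum_le_tsum b3 ((s1.add s2).add s1)
  rw [(s1.add s2).tsum_add s1, s1.tsum_add s2] at hle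
  have h2' : ∑' p, dyadicTerm B.Q₁ B.Q₂ (A₂ x) p < 4 * ε / 243 := by
    rw [← (Equiv.prodComm ℕ ℕ).tsum_eq]
    refine lt_of_le_of_lt (le_of_eq (tsum_congr fun p => ?_)) hr2
    exact dyadicTerm_swap B.Q_comm _ p
  have h3 : ∑' p, dyadicTerm B.Q₁ B.Q₂ (A₁ x + A₂ x + -(A₂ (A₁ x))) p ≤ 4 * ε / 81 := by
    linarith
  calc 81 / 4 * (√n * √m) * ∑' p, dyadicTerm B.Q₁ B.Q₂ (A₁ x + A₂ x + -(A₂ (A₁ x))) p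
      ≤ 81 / 4 * (√n * √m) * (4 * ε / 81) := by gcongr
    _ = _ := by ring

/-- Orthomartingale differences: vectors of the past that are orthogonal to the past of each
of the two preceding steps. -/
structure IsOrthoDiff (D : H) : Prop where
  adapted : B.E 1 1 D = D
  left : B.E 0 1 D = 0
  right : B.E 1 0 D = 0

lemma norm_geomSum_U₂_of_diff {p : H} {a : ℤ} (h1 : B.E a 1 p = p) (h0 : B.E a 0 p = 0) (m : ℕ) :
    ‖geomSum B.U₂ m p‖ = √m * ‖p‖ := by
  refine norm_geomSum_of_orthogonal B.norm_U₂ (fun i => ?_) m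
  have h : B.E a (i + 1 : ℕ) ((B.U₂ ^ (i + 1)) p) = 0 := by
    have := B.pow_U₂_E (i + 1) a 0 p
    rw [h0, map_zero, zero_add] at this
    exact this.symm
  have h2 := B.E_of_le (u := a) (v := (i + 1 : ℕ)) h1 le_rfl (by push_cast; omega)
  rw [← h2, B.E_symm, h2, h, inner_zero_right]

lemma norm_geomSum_U₁_of_diff {p : H} {b : ℤ} (h1 : B.E 1 b p = p) (h0 : B.E 0 b p = 0) (n : ℕ) :
    ‖geomSum B.U₁ n p‖ = √n * ‖p‖ := B.swap.norm_geomSum_U₂_of_diff h1 h0 n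

variable {B} in
-- As `D` is in the past of `(1, 1)`, the projection onto `(0, b)` factors through `(0, 1)` for
-- every `b`. Thus `D` is orthogonal to the past of one direction whatever is known in the other.
lemma IsOrthoDiff.E_zero_left {D : H} (hD : B.IsOrthoDiff D) (b : ℤ) : B.E 0 b D = 0 := by
  have h : B.E 0 b D = B.E 0 b (B.E 0 1 D) := by
    conv_lhs => rw [← hD.adapted, B.E_E]
    rw [B.E_E]; rfl
  rw [h, hD.left, map_zero]

variable {B} in
lemma IsOrthoDiff.E_zero_right {D : H} (hD : B.IsOrthoDiff D) (a : ℤ) : B.E a 0 D = 0 := by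
  have h : B.E a 0 D = B.E a 0 (B.E 1 0 D) := by
    conv_lhs => rw [← hD.adapted, B.E_E]
    rw [B.E_E]; rfl
  rw [h, hD.right, map_zero]

variable {B} in
lemma IsOrthoDiff.norm_rectSum {D : H} (hD : B.IsOrthoDiff D) (n m : ℕ) :
    ‖B.rectSum n m D‖ = √n * √m * ‖D‖ := by
  have h1 : B.E 1 (m + 1) (geomSum B.U₂ m D) = geomSum B.U₂ m D :=
    B.E_geomSum_U₂ hD.adapted le_rfl (by omega)
  have h0 : B.E 0 (m + 1) (geomSum B.U₂ m D) = 0 := by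
    rw [geomSum_apply, map_sum]
    refine Finset.sum_eq_zero fun j _ => ?_
    have := B.pow_U₂_E j 0 (m + 1 - j) D
    rw [hD.E_zero_left, map_zero, sub_add_cancel] at this
    exact this.symm
  rw [rectSum_apply, B.norm_geomSum_U₁_of_diff h1 h0, B.norm_geomSum_U₂_of_diff hD.adapted hD.right,
    mul_assoc]

/-- A double coboundary is an orthomartingale difference up to genuine coboundaries. -/
lemma exists_isOrthoDiff_of_coboundary {g : H} (hg : B.E 0 0 g = g) :
    ∃ D, B.IsOrthoDiff D ∧ ∃ C : ℝ, ∀ n m : ℕ,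
      ‖B.rectSum n m ((1 - B.Q₁) ((1 - B.Q₂) g) - D)‖ ≤ C * (1 + √n + √m) := by
  set w := B.U₁ (B.U₂ g) with hw
  have hw' : B.U₂ (B.U₁ g) = w := (commute_apply B.U_comm g).symm
  -- The double increment of `w` over the unit square of the filtration; `p` and `q` are increments
  -- in a single direction.
  set D := B.E 1 1 w - B.E 0 1 w - B.E 1 0 w + B.E 0 0 w with hDdef
  set p := B.U₂ g - B.E 0 0 (B.U₂ g) with hp
  set q := B.U₁ g - B.E 0 0 (B.U₁ g) with hq
  have hg2 : B.E 0 1 (B.U₂ g) = B.U₂ g := by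
    rw [← hg, B.U₂_E, B.E_E]; simp
  have hg1 : B.E 1 0 (B.U₁ g) = B.U₁ g := by
    rw [← hg, B.U₁_E, B.E_E]; simp
  have hw1 : B.E 1 1 w = w := by
    rw [hw, ← hg2, B.U₁_E, B.E_E]; simp
  have hD : B.IsOrthoDiff D := by
    constructor <;> simp [hDdef, B.E_E]
  have hp1 : B.E 0 1 p = p := by simp [hp, hg2, B.E_E]
  have hp0 : B.E 0 0 p = 0 := by simp [hp, B.E_E]
  have hq1 : B.E 1 0 q = q := by simp [hq, hg1, B.E_E]
  have hq0 : B.E 0 0 q = 0 := by simp [hq, B.E_E]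
  -- The first error telescopes in both directions and stays bounded. Each of the others telescopes
  -- in one direction and is a martingale difference in the other, so its rectangular sums grow only
  -- like `√m` or `√n`.
  have key : (1 - B.Q₁) ((1 - B.Q₂) g) - D
      = (1 - B.U₁) ((1 - B.U₂) g) + (1 - B.U₁) p + (1 - B.U₂) q := by
    simp only [sub_apply, map_sub, Q₁_apply, Q₂_apply, hp, hq, hDdef, B.U₁_E, B.U₂_E,
      hw', B.E_E, ← hw, hw1]
    norm_num
    abel
  refine ⟨D, hD, 4 * ‖g‖ + 2 * ‖p‖ + 2 * ‖q‖, fun n m => ?_⟩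
  have tele : ∀ {U : H →L[ℝ] H}, (∀ x, ‖U x‖ = ‖x‖) → ∀ (k : ℕ) (y : H),
      ‖geomSum U k ((1 - U) y)‖ ≤ 2 * ‖y‖ := by
    intro U hU k y
    have : geomSum U k ((1 - U) y) = y - (U ^ k) y := by
      rw [commute_apply (geomSum_commute ((Commute.one_right U).sub_right (Commute.refl U)) k)]
      exact DFunLike.congr_fun (one_sub_mul_geomSum U k) y
    rw [this]
    refine (norm_sub_le _ _).trans ?_
    rw [norm_pow_apply hU]; linarith
  have c21 : ∀ k, Commute (geomSum B.U₂ k) (1 - B.U₁) := fun k =>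
    geomSum_commute ((Commute.one_right _).sub_right B.U_comm.symm) k
  have b1 : ‖B.rectSum n m ((1 - B.U₁) ((1 - B.U₂) g))‖ ≤ 4 * ‖g‖ := by
    rw [rectSum_apply, commute_apply (c21 m)]
    refine (tele B.norm_U₁ n _).trans ?_
    linarith [tele B.norm_U₂ m g]
  have b2 : ‖B.rectSum n m ((1 - B.U₁) p)‖ ≤ 2 * ‖p‖ * √m := by
    rw [rectSum_apply, commute_apply (c21 m)]
    refine (tele B.norm_U₁ n _).trans ?_
    rw [B.norm_geomSum_U₂_of_diff hp1 hp0]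
    linarith
  have b3 : ‖B.rectSum n m ((1 - B.U₂) q)‖ ≤ 2 * ‖q‖ * √n := by
    rw [rectSum_apply', commute_apply (geomSum_commute
      ((Commute.one_right _).sub_right B.U_comm) n)]
    refine (tele B.norm_U₂ m _).trans ?_
    rw [B.norm_geomSum_U₁_of_diff hq1 hq0]
    linarith
  rw [key, map_add, map_add]
  refine (norm_add₃_le).trans ((add_le_add (add_le_add b1 b2) b3).trans ?_)
  have := Real.sqrt_nonneg (n : ℝ)
  have := Real.sqrt_nonneg (m : ℝ)
  have := norm_nonneg g
  have := norm_nonneg p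
  have := norm_nonneg q
  have : 0 ≤ ‖g‖ * √(n : ℝ) := by positivity
  have : 0 ≤ ‖g‖ * √(m : ℝ) := by positivity
  have : 0 ≤ ‖p‖ * √(n : ℝ) := by positivity
  have : 0 ≤ ‖q‖ * √(m : ℝ) := by positivity
  nlinarith

/-- **Orthomartingale approximation** under the two-parameter Maxwell–Woodroofe condition. -/
theorem exists_isOrthoDiff {x : H} (hx : B.E 0 0 x = x)
    (hs : Summable (dyadicTerm B.Q₁ B.Q₂ x)) {ε : ℝ} (hε : 0 < ε) :
    ∃ D, B.IsOrthoDiff D ∧ ∃ C : ℝ, ∀ n m : ℕ,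
      ‖B.rectSum n m (x - D)‖ ≤ ε * (√n * √m) + C * (1 + √n + √m) := by
  obtain ⟨g, hg, h1⟩ := B.exists_norm_rectSum_sub_le hx hs hε
  obtain ⟨D, hD, C, h2⟩ := B.exists_isOrthoDiff_of_coboundary hg
  refine ⟨D, hD, C, fun n m => ?_⟩
  rw [← sub_add_sub_cancel x ((1 - B.Q₁) ((1 - B.Q₂) g)) D, map_add]
  exact (norm_add_le _ _).trans (add_le_add (h1 n m) (h2 n m))

end BiShift

/-! ### The martingale central limit theorem, in quantitative form -/

/-- The function `x ↦ exp (i x + min (x², 1) / 2)`, which is `1 + i x` up to third order. -/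
noncomputable def compExp (x : ℝ) : ℂ := Complex.exp (x * Complex.I + (min (x ^ 2) 1 / 2 : ℝ))

lemma continuous_compExp : Continuous compExp := by
  unfold compExp; fun_prop

lemma norm_compExp (x : ℝ) : ‖compExp x‖ = Real.exp (min (x ^ 2) 1 / 2) := by
  rw [compExp, Complex.norm_exp]
  simp

/-- The real part `x² / 2` of the exponent cancels the quadratic term of `exp (i x)`. The constant
20 is a crude bound for `(3 / 2)³ * 4.5 + 1`. -/
lemma norm_compExp_sub_cubic {x : ℝ} (hx : |x| ≤ 1) :
    ‖compExp x - 1 - x * Complex.I‖ ≤ 20 * |x| ^ 3 := by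
  have hx2 : x ^ 2 ≤ 1 := by rw [← sq_abs]; exact pow_le_one₀ (abs_nonneg _) hx
  set w : ℂ := x * Complex.I + ((x ^ 2 / 2 : ℝ) : ℂ) with hw
  have e1 : compExp x = Complex.exp w := by rw [compExp, min_eq_left hx2]
  have hwn : ‖w‖ ≤ 3 / 2 * |x| := by
    refine (norm_add_le _ _).trans ?_
    rw [norm_mul, Complex.norm_I, mul_one, Complex.norm_real, Complex.norm_real, Real.norm_eq_abs,
      Real.norm_eq_abs, abs_of_nonneg (by positivity : 0 ≤ x ^ 2 / 2), ← sq_abs]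
    nlinarith [abs_nonneg x]
  have h3 := Complex.norm_exp_sub_sum_le_norm_mul_exp w 3
  simp only [Finset.sum_range_succ, Finset.sum_range_zero, pow_zero, pow_one,
    Nat.factorial] at h3
  have hexp : Real.exp ‖w‖ ≤ 4.5 := by
    have h2 : Real.exp ‖w‖ ≤ Real.exp (3 / 2) := Real.exp_le_exp.2 (by linarith)
    have h4 : Real.exp (3 / 2) ^ 2 = Real.exp 1 ^ 3 := by
      rw [← Real.exp_nat_mul, ← Real.exp_nat_mul]; norm_num
    have h5 := Real.exp_one_lt_d9
    have h6 : Real.exp 1 ^ 3 ≤ 2.7182818286 ^ 3 := pow_le_pow_left₀ (Real.exp_pos _).le h5.le 3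
    have h7 : Real.exp (3 / 2) ^ 2 ≤ 4.5 ^ 2 := by rw [h4]; refine h6.trans (by norm_num)
    exact h2.trans ((sq_le_sq₀ (Real.exp_pos _).le (by norm_num)).1 h7)
  -- The second-order Taylor polynomial of `exp w` differs from `1 + i x` by `x⁴ / 8 + i x³ / 2`,
  -- again of third order.
  have e2 : compExp x - 1 - x * Complex.I = (Complex.exp w - (0 + 1 / ((1 : ℕ) : ℂ)
      + w / ((1 : ℕ) : ℂ) + w ^ 2 / ((2 : ℕ) : ℂ))) +
      ((x ^ 4 / 8 : ℝ) + (x ^ 3 / 2 : ℝ) * Complex.I) := by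
    rw [e1, hw]
    push_cast
    ring_nf
    simp only [Complex.I_sq]
    ring
  rw [e2]
  refine (norm_add_le _ _).trans ?_
  have b1 : ‖Complex.exp w - (0 + 1 / ((1 : ℕ) : ℂ)
      + w / ((1 : ℕ) : ℂ) + w ^ 2 / ((2 : ℕ) : ℂ))‖ ≤ (3 / 2 * |x|) ^ 3 * 4.5 := by
    refine le_trans (by simpa using h3) ?_
    gcongr
  have b2 : ‖((x ^ 4 / 8 : ℝ) : ℂ) + (x ^ 3 / 2 : ℝ) * Complex.I‖ ≤ |x| ^ 3 := by
    refine (norm_add_le _ _).trans ?_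
    rw [norm_mul, Complex.norm_I, mul_one, Complex.norm_real, Complex.norm_real, Real.norm_eq_abs,
      Real.norm_eq_abs, abs_div, abs_div, abs_pow, abs_pow, abs_of_pos (by norm_num : (0 : ℝ) < 8),
      abs_of_pos (by norm_num : (0 : ℝ) < 2)]
    have : |x| ^ 4 ≤ |x| ^ 3 := pow_le_pow_of_le_one (abs_nonneg _) hx (by norm_num)
    have := pow_nonneg (abs_nonneg x) 3
    linarith
  have := pow_nonneg (abs_nonneg x) 3
  nlinarith

/-- Lindeberg's splitting: below `ε` the cubic bound gives `ε x²`; above it, a quadratic bound holds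
because the truncation of `x²` at 1 keeps `compExp` bounded. -/
lemma norm_compExp_sub_le {ε : ℝ} (hε0 : 0 ≤ ε) (hε : ε ≤ 1) (x : ℝ) :
    ‖compExp x - 1 - x * Complex.I‖ ≤ 20 * (ε * x ^ 2 + if ε < |x| then x ^ 2 else 0) := by
  have a0 := abs_nonneg x
  split_ifs with h
  · have hx2 : 0 ≤ x ^ 2 := sq_nonneg x
    have main : ‖compExp x - 1 - x * Complex.I‖ ≤ 20 * x ^ 2 := by
      rcases le_or_gt |x| 1 with h1 | h1
      · refine (norm_compExp_sub_cubic h1).trans ?_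
        rw [← sq_abs]
        have : |x| ^ 3 ≤ |x| ^ 2 := pow_le_pow_of_le_one a0 h1 (by norm_num)
        linarith
      · have h2 : ‖compExp x‖ ≤ 3 := by
          rw [norm_compExp]
          have := min_le_right (x ^ 2) 1
          have h3 : min (x ^ 2) 1 / 2 ≤ 1 := by linarith
          exact (Real.exp_le_exp.2 h3).trans Real.exp_one_lt_three.le
        have h3 : ‖compExp x - 1 - x * Complex.I‖ ≤ ‖compExp x‖ + 1 + |x| := by
          refine (norm_sub_le _ _).trans (add_le_add ((norm_sub_le _ _).trans (by simp)) ?_)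
          simp
        rw [← sq_abs]
        nlinarith
    exact main.trans (by have := mul_nonneg hε0 hx2; linarith)
  · push Not at h
    refine (norm_compExp_sub_cubic (h.trans hε)).trans ?_
    rw [← sq_abs]
    nlinarith [mul_le_mul_of_nonneg_right h (sq_nonneg |x|)]

lemma abs_exp_sub_exp_le {a b c : ℝ} (ha : a ≤ c) (hb : b ≤ c) :
    |Real.exp a - Real.exp b| ≤ Real.exp c * |a - b| := by
  wlog hab : b ≤ a generalizing a b
  · rw [abs_sub_comm, abs_sub_comm a b]
    exact this hb ha (le_of_not_ge hab)
  rw [abs_of_nonneg (sub_nonneg.2 (Real.exp_le_exp.2 hab)), abs_of_nonneg (sub_nonneg.2 hab)]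
  have h1 : Real.exp b = Real.exp a * Real.exp (b - a) := by rw [← Real.exp_add]; ring_nf
  have h2 := Real.add_one_le_exp (b - a)
  calc Real.exp a - Real.exp b = Real.exp a * (1 - Real.exp (b - a)) := by rw [h1]; ring
    _ ≤ Real.exp a * (a - b) := mul_le_mul_of_nonneg_left (by linarith) (Real.exp_pos _).le
    _ ≤ _ := by gcongr

/-- A square integrable sequence of martingale differences: `X k` is measurable for `ℱ (k + 1)`
and orthogonal to the bounded `ℱ k`-measurable functions. -/
structure IsMartingaleDiff {Ω : Type*} [m0 : MeasurableSpace Ω] (μ : Measure Ω)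
    (ℱ : ℕ → MeasurableSpace Ω) (X : ℕ → Ω → ℝ) : Prop where
  le : ∀ k, ℱ k ≤ m0
  mono : Monotone ℱ
  meas : ∀ k, Measurable[ℱ (k + 1)] (X k)
  memLp : ∀ k, MemLp (X k) 2 μ
  orth : ∀ k (φ : Ω → ℝ), Measurable[ℱ k] φ → (∃ C, ∀ ω, |φ ω| ≤ C) → ∫ ω, φ ω * X k ω ∂μ = 0

section Row

variable {Ω : Type*} [m0 : MeasurableSpace Ω] {μ : Measure Ω} [IsProbabilityMeasure μ]
  {ℱ : ℕ → MeasurableSpace Ω} {X : ℕ → Ω → ℝ}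

/-- The sum of the squares. -/
def sqSum (X : ℕ → Ω → ℝ) (k : ℕ) (ω : Ω) : ℝ := ∑ j ∈ range k, X j ω ^ 2

/-- The sequence stopped when the sum of the squares exceeds `c`. -/
noncomputable def stopped (X : ℕ → Ω → ℝ) (c : ℝ) (k : ℕ) (ω : Ω) : ℝ :=
  if sqSum X k ω ≤ c then X k ω else 0

lemma sqSum_succ (X : ℕ → Ω → ℝ) (k : ℕ) (ω : Ω) :
    sqSum X (k + 1) ω = sqSum X k ω + X k ω ^ 2 := Finset.sum_range_succ _ _

lemma sqSum_mono (X : ℕ → Ω → ℝ) (ω : Ω) : Monotone fun k => sqSum X k ω :=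
  monotone_nat_of_le_succ fun k => by
    rw [sqSum_succ]; linarith [sq_nonneg (X k ω)]

/-- The terms kept before the last one have squares summing to at most `c`, and the last adds at
most 1 after truncation. Hence the deterministic bound on `expProd`. -/
lemma sum_min_stopped_le (X : ℕ → Ω → ℝ) {c : ℝ} (hc : 0 ≤ c) (k : ℕ) (ω : Ω) :
    ∑ j ∈ range k, min (stopped X c j ω ^ 2) 1 ≤ min (sqSum X k ω) (c + 1) := by
  induction k with
  | zero => simp [sqSum]; linarith
  | succ k ih =>
    rw [Finset.sum_range_succ, sqSum_succ]
    unfold stopped at *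
    have h1 := min_le_left (X k ω ^ 2) 1
    have h2 := min_le_right (X k ω ^ 2) 1
    have h3 := ih.trans (min_le_left _ _)
    have h4 := ih.trans (min_le_right _ _)
    have h5 := sq_nonneg (X k ω)
    split_ifs with h
    · refine le_min ?_ ?_ <;> linarith
    · rw [zero_pow two_ne_zero, min_eq_left zero_le_one, add_zero]
      refine le_min ?_ ?_ <;> linarith

/-- The exponential product attached to the stopped sequence. -/
noncomputable def expProd (X : ℕ → Ω → ℝ) (c : ℝ) (k : ℕ) (ω : Ω) : ℂ :=
  ∏ j ∈ range k, compExp (stopped X c j ω)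

lemma expProd_succ (X : ℕ → Ω → ℝ) (c : ℝ) (k : ℕ) (ω : Ω) :
    expProd X c (k + 1) ω = expProd X c k ω * compExp (stopped X c k ω) :=
  Finset.prod_range_succ _ _

lemma norm_expProd_le (X : ℕ → Ω → ℝ) {c : ℝ} (hc : 0 ≤ c) (k : ℕ) (ω : Ω) :
    ‖expProd X c k ω‖ ≤ Real.exp ((c + 1) / 2) := by
  rw [expProd, norm_prod]
  simp only [norm_compExp]
  rw [← Real.exp_sum, ← Finset.sum_div]
  gcongr
  exact (sum_min_stopped_le X hc k ω).trans (min_le_right _ _)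

namespace IsMartingaleDiff

lemma meas_of_lt (h : IsMartingaleDiff μ ℱ X) {j k : ℕ} (hjk : j < k) : Measurable[ℱ k] (X j) :=
  (h.meas j).mono (h.mono hjk) le_rfl

lemma measurable (h : IsMartingaleDiff μ ℱ X) (k : ℕ) : Measurable (X k) :=
  (h.meas k).mono (h.le _) le_rfl

lemma measurable_sqSum (h : IsMartingaleDiff μ ℱ X) (k : ℕ) : Measurable[ℱ k] (sqSum X k) := by
  unfold sqSum
  exact Finset.measurable_fun_sum _ fun j hj => (h.meas_of_lt (Finset.mem_range.1 hj)).pow_const 2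

lemma measurable_stopped (h : IsMartingaleDiff μ ℱ X) (c : ℝ) {j k : ℕ} (hjk : j < k) :
    Measurable[ℱ k] (stopped X c j) := by
  unfold stopped
  refine Measurable.ite ?_ (h.meas_of_lt hjk) measurable_const
  exact measurableSet_le ((h.measurable_sqSum j).mono (h.mono hjk.le) le_rfl) measurable_const

lemma measurable_expProd (h : IsMartingaleDiff μ ℱ X) (c : ℝ) (k : ℕ) :
    Measurable[ℱ k] (expProd X c k) := by
  unfold expProd
  exact Finset.measurable_fun_prod _ fun j hj =>
    continuous_compExp.measurable.comp (h.measurable_stopped c (Finset.mem_range.1 hj))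

lemma integrable (h : IsMartingaleDiff μ ℱ X) (k : ℕ) : Integrable (X k) μ :=
  (h.memLp k).integrable (by norm_num)

lemma integrable_sq (h : IsMartingaleDiff μ ℱ X) (k : ℕ) : Integrable (fun ω => X k ω ^ 2) μ :=
  (h.memLp k).integrable_sq

/-- The stopping decision at time `k` involves only the terms before `k`, so its indicator can be
put into the bounded test function; real and imaginary parts are treated separately. -/
lemma integral_mul_stopped (h : IsMartingaleDiff μ ℱ X) {c : ℝ} {k : ℕ} {P : Ω → ℂ}
    (hP : Measurable[ℱ k] P) {K : ℝ} (hK : ∀ ω, ‖P ω‖ ≤ K) :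
    Integrable (fun ω => P ω * stopped X c k ω) μ ∧ ∫ ω, P ω * stopped X c k ω ∂μ = 0 := by
  have hint : Integrable (fun ω => P ω * stopped X c k ω) μ := by
    have hs : Integrable (stopped X c k) μ := by
      refine (h.integrable k).mono ?_ (Eventually.of_forall fun ω => ?_)
      · exact ((h.measurable_stopped c (Nat.lt_succ_self k)).mono (h.le _)
          le_rfl).aestronglyMeasurable
      · unfold stopped; split_ifs <;> simp
    exact hs.ofReal.bdd_mul (hP.mono (h.le _) le_rfl).aestronglyMeasurable
      (Eventually.of_forall hK)
  refine ⟨hint, ?_⟩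
  have hind : Measurable[ℱ k] fun ω => if sqSum X k ω ≤ c then (1 : ℝ) else 0 :=
    Measurable.ite (measurableSet_le (h.measurable_sqSum k) measurable_const) measurable_const
      measurable_const
  have key : ∀ g : Ω → ℝ, Measurable[ℱ k] g → (∀ ω, |g ω| ≤ K) →
      ∫ ω, g ω * stopped X c k ω ∂μ = 0 := by
    intro g hg hgK
    rw [← h.orth k (fun ω => g ω * if sqSum X k ω ≤ c then (1 : ℝ) else 0) (hg.mul hind) ⟨K, ?_⟩]
    · refine integral_congr_ae (Eventually.of_forall fun ω => ?_)
      simp only [stopped]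
      split_ifs <;> simp
    · intro ω
      split_ifs
      · simpa using hgK ω
      · simpa using (abs_nonneg _).trans (hgK ω)
  rw [← integral_re_add_im hint]
  have h1 : ∀ ω, RCLike.re (P ω * (stopped X c k ω : ℂ)) = (P ω).re * stopped X c k ω := by
    intro ω; simp
  have h2 : ∀ ω, RCLike.im (P ω * (stopped X c k ω : ℂ)) = (P ω).im * stopped X c k ω := by
    intro ω; simp
  simp only [h1, h2]
  rw [key (fun ω => (P ω).re) (Complex.measurable_re.comp hP)
      fun ω => (Complex.abs_re_le_norm _).trans (hK ω),
    key (fun ω => (P ω).im) (Complex.measurable_im.comp hP) fun ω => (Complex.abs_im_le_norm _).trans (hK ω)]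
  simp

/-- The quantity controlled by Lindeberg's condition. -/
noncomputable def _root_.RandomField.tailSq (ε x : ℝ) : ℝ := if ε < |x| then x ^ 2 else 0

lemma _root_.RandomField.tailSq_nonneg (ε x : ℝ) : 0 ≤ tailSq ε x := by
  unfold tailSq; split_ifs <;> positivity

lemma _root_.RandomField.tailSq_le (ε x : ℝ) : tailSq ε x ≤ x ^ 2 := by
  unfold tailSq; split_ifs <;> [rfl; positivity]

lemma _root_.RandomField.measurable_tailSq (ε : ℝ) : Measurable (tailSq ε) := by
  unfold tailSq
  exact Measurable.ite (measurableSet_lt measurable_const measurable_norm)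
    (measurable_id.pow_const 2) measurable_const

lemma integrable_tailSq (h : IsMartingaleDiff μ ℱ X) (ε : ℝ) (k : ℕ) :
    Integrable (fun ω => tailSq ε (X k ω)) μ :=
  (h.integrable_sq k).mono ((measurable_tailSq ε).comp (h.measurable k)).aestronglyMeasurable
    (Eventually.of_forall fun ω => by
      rw [Real.norm_of_nonneg (tailSq_nonneg _ _), Real.norm_of_nonneg (sq_nonneg _)]
      exact tailSq_le _ _)

lemma integrable_expProd (h : IsMartingaleDiff μ ℱ X) {c : ℝ} (hc : 0 ≤ c) (k : ℕ) :
    Integrable (expProd X c k) μ :=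
  Integrable.of_bound ((h.measurable_expProd c k).mono (h.le _) le_rfl).aestronglyMeasurable _
    (Eventually.of_forall (norm_expProd_le X hc k))

/-- The expectations of successive products telescope. In each increment the linear term `i x`
integrates to zero, leaving the remainder of `compExp` times a bounded factor. -/
lemma norm_integral_expProd_sub_one_le (h : IsMartingaleDiff μ ℱ X) {c : ℝ} (hc : 0 ≤ c) {ε : ℝ}
    (hε0 : 0 ≤ ε) (hε : ε ≤ 1) (m : ℕ) :
    ‖∫ ω, expProd X c m ω ∂μ - 1‖ ≤ 20 * Real.exp ((c + 1) / 2) *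
      ∑ k ∈ range m, (ε * ∫ ω, X k ω ^ 2 ∂μ + ∫ ω, tailSq ε (X k ω) ∂μ) := by
  induction m with
  | zero => simp [expProd]
  | succ k ih =>
    rw [Finset.sum_range_succ, mul_add]
    have hP := h.measurable_expProd c k
    obtain ⟨i1, i2⟩ := h.integral_mul_stopped (c := c) hP (norm_expProd_le X hc k)
    have i0 := h.integrable_expProd hc k
    have i3 := h.integrable_expProd hc (k + 1)
    have e : ∫ ω, expProd X c (k + 1) ω ∂μ - ∫ ω, expProd X c k ω ∂μ
        = ∫ ω, expProd X c k ω *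
          (compExp (stopped X c k ω) - 1 - stopped X c k ω * Complex.I) ∂μ := by
      have e1 : ∀ ω, expProd X c k ω *
          (compExp (stopped X c k ω) - 1 - stopped X c k ω * Complex.I) =
          expProd X c (k + 1) ω - expProd X c k ω
            - (expProd X c k ω * stopped X c k ω) * Complex.I := by
        intro ω; rw [expProd_succ]; ring
      simp only [e1]
      have i4 : Integrable (fun ω => expProd X c (k + 1) ω - expProd X c k ω) μ := i3.sub i0
      rw [integral_sub i4 (i1.mul_const _), integral_sub i3 i0, integral_mul_const, i2]
      simp
    have hb : ‖∫ ω, expProd X c (k + 1) ω ∂μ - ∫ ω, expProd X c k ω ∂μ‖ ≤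
        20 * Real.exp ((c + 1) / 2) * (ε * ∫ ω, X k ω ^ 2 ∂μ + ∫ ω, tailSq ε (X k ω) ∂μ) := by
      rw [e, ← integral_const_mul, ← integral_add ((h.integrable_sq k).const_mul ε)
        (h.integrable_tailSq ε k), ← integral_const_mul]
      refine norm_integral_le_of_norm_le ((((h.integrable_sq k).const_mul ε).add
        (h.integrable_tailSq ε k)).const_mul _) (Eventually.of_forall fun ω => ?_)
      rw [norm_mul, mul_comm 20, mul_assoc]
      refine mul_le_mul (norm_expProd_le X hc k ω) ?_ (norm_nonneg _) (Real.exp_pos _).le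
      refine (norm_compExp_sub_le hε0 hε _).trans ?_
      have h5 := tailSq_nonneg ε (X k ω)
      unfold stopped
      split_ifs with h1 h2 h2
      · rw [tailSq, if_pos h2]
      · rw [tailSq, if_neg h2]
      · simp only [abs_zero] at h2; linarith
      · have := mul_nonneg hε0 (sq_nonneg (X k ω)); simp; linarith
    calc ‖∫ ω, expProd X c (k + 1) ω ∂μ - 1‖ = ‖(∫ ω, expProd X c k ω ∂μ - 1) +
          (∫ ω, expProd X c (k + 1) ω ∂μ - ∫ ω, expProd X c k ω ∂μ)‖ := by congr 1; ring
      _ ≤ _ := (norm_add_le _ _).trans (add_le_add ih hb)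

end IsMartingaleDiff

/-- If the squares sum to at most `s + 1`, nothing is stopped and the product is the exponential of
the sum times `exp (w / 2)`, where `w` is the sum of the truncated squares and differs from `sqSum`
by tail terms only. Otherwise `|sqSum - s| ≥ 1` and both sides of the difference are simply bounded.
-/
lemma norm_exp_sub_expProd_le (X : ℕ → Ω → ℝ) {s ε : ℝ} (hs : 0 ≤ s) (hε : ε ≤ 1) (m : ℕ)
    (ω : Ω) :
    ‖Complex.exp ((∑ k ∈ range m, X k ω : ℝ) * Complex.I) * Real.exp (s / 2)
        - expProd X (s + 1) m ω‖ ≤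
      Real.exp ((s + 2) / 2) * (2 * |sqSum X m ω - s| + ∑ k ∈ range m, tailSq ε (X k ω)) := by
  have hK : 0 < Real.exp ((s + 2) / 2) := Real.exp_pos _
  have ht : 0 ≤ ∑ k ∈ range m, tailSq ε (X k ω) := Finset.sum_nonneg fun _ _ => tailSq_nonneg _ _
  rcases le_or_gt (sqSum X m ω) (s + 1) with hV | hV
  · have hst : ∀ k ∈ range m, stopped X (s + 1) k ω = X k ω := by
      intro k hk
      rw [stopped, if_pos]
      exact (sqSum_mono X ω (Finset.mem_range.1 hk).le).trans hV
    set w := ∑ k ∈ range m, min (X k ω ^ 2) 1 with hw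
    have e1 : expProd X (s + 1) m ω =
        Complex.exp ((∑ k ∈ range m, X k ω : ℝ) * Complex.I) * Real.exp (w / 2) := by
      rw [expProd, Finset.prod_congr rfl fun k hk => by rw [hst k hk]]
      simp only [compExp]
      rw [← Complex.exp_sum, Finset.sum_add_distrib, Complex.exp_add, ← Finset.sum_mul, hw,
        Finset.sum_div, Complex.ofReal_exp, Complex.ofReal_sum, Complex.ofReal_sum]
    rw [e1, ← mul_sub, norm_mul, Complex.norm_exp_ofReal_mul_I, one_mul, ← Complex.ofReal_sub,
      Complex.norm_real, Real.norm_eq_abs]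
    have hwV : w ≤ sqSum X m ω := Finset.sum_le_sum fun k _ => min_le_left _ _
    have hdiff : sqSum X m ω - w ≤ ∑ k ∈ range m, tailSq ε (X k ω) := by
      rw [hw, sqSum, ← Finset.sum_sub_distrib]
      refine Finset.sum_le_sum fun k _ => ?_
      unfold tailSq
      split_ifs with h
      · have : 0 ≤ min (X k ω ^ 2) 1 := le_min (sq_nonneg _) zero_le_one
        linarith
      · push Not at h
        rw [min_eq_left, sub_self]
        rw [← sq_abs]
        exact pow_le_one₀ (abs_nonneg _) (h.trans hε)
    refine (abs_exp_sub_exp_le (c := (s + 2) / 2) (by linarith) (by linarith)).trans ?_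
    gcongr
    rw [abs_le]
    constructor <;> cases abs_cases (sqSum X m ω - s) <;> linarith
  · have h1 : 1 ≤ |sqSum X m ω - s| := by
      rw [abs_of_nonneg] <;> linarith
    have h2 : ‖Complex.exp ((∑ k ∈ range m, X k ω : ℝ) * Complex.I) * Real.exp (s / 2)‖ ≤
        Real.exp ((s + 2) / 2) := by
      rw [norm_mul, Complex.norm_exp_ofReal_mul_I, one_mul, Complex.norm_real, Real.norm_eq_abs,
        abs_of_pos (Real.exp_pos _)]
      gcongr; linarith
    have h3 := norm_expProd_le X (c := s + 1) (by linarith) m ω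
    rw [show s + 1 + 1 = s + 2 by ring] at h3
    refine (norm_sub_le _ _).trans ((add_le_add h2 h3).trans ?_)
    nlinarith [mul_le_mul_of_nonneg_left h1 hK.le, mul_nonneg hK.le ht]

/-- Quantitative form of McLeish's central limit theorem for one row of martingale differences. -/
theorem IsMartingaleDiff.norm_integral_exp_le (h : IsMartingaleDiff μ ℱ X) {s ε : ℝ} (hs : 0 ≤ s)
    (hε0 : 0 ≤ ε) (hε : ε ≤ 1) (m : ℕ) :
    ‖(∫ ω, Complex.exp ((∑ k ∈ range m, X k ω : ℝ) * Complex.I) ∂μ) * Real.exp (s / 2) - 1‖ ≤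
      22 * Real.exp ((s + 2) / 2) * (ε * (s + ∫ ω, |sqSum X m ω - s| ∂μ)
        + ∫ ω, |sqSum X m ω - s| ∂μ + ∑ k ∈ range m, ∫ ω, tailSq ε (X k ω) ∂μ) := by
  have hc : 0 ≤ s + 1 := by linarith
  have isq : Integrable (sqSum X m) μ := by
    unfold sqSum
    exact integrable_finsetSum _ fun k _ => h.integrable_sq k
  have iabs : Integrable (fun ω => |sqSum X m ω - s|) μ := (isq.sub (integrable_const s)).abs
  have itail : Integrable (fun ω => ∑ k ∈ range m, tailSq ε (X k ω)) μ :=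
    integrable_finsetSum _ fun k _ => h.integrable_tailSq ε k
  set δ := ∫ ω, |sqSum X m ω - s| ∂μ with hδ
  set L := ∑ k ∈ range m, ∫ ω, tailSq ε (X k ω) ∂μ with hL
  have hδ0 : 0 ≤ δ := integral_nonneg fun _ => abs_nonneg _
  have hL0 : 0 ≤ L := Finset.sum_nonneg fun k _ => integral_nonneg fun _ => tailSq_nonneg _ _
  have hsum : ∑ k ∈ range m, ∫ ω, X k ω ^ 2 ∂μ ≤ s + δ := by
    rw [← integral_finsetSum _ fun k _ => h.integrable_sq k]
    change ∫ ω, sqSum X m ω ∂μ ≤ _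
    have : ∫ ω, (sqSum X m ω - s) ∂μ ≤ δ :=
      integral_mono (isq.sub (integrable_const s)) iabs fun _ => le_abs_self _
    rw [integral_sub isq (integrable_const s)] at this
    simp at this
    linarith
  have A := h.norm_integral_expProd_sub_one_le hc hε0 hε m
  rw [Finset.sum_add_distrib, ← Finset.mul_sum, ← hL, show s + 1 + 1 = s + 2 by ring] at A
  have iexp : Integrable (fun ω => Complex.exp ((∑ k ∈ range m, X k ω : ℝ) * Complex.I)) μ := by
    refine Integrable.of_bound (C := 1) ?_ (Eventually.of_forall fun ω => ?_)
    · have : Measurable fun ω => ∑ k ∈ range m, X k ω :=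
        Finset.measurable_fun_sum _ fun k _ => h.measurable k
      exact (Complex.measurable_exp.comp
        ((Complex.measurable_ofReal.comp this).mul_const _)).aestronglyMeasurable
    · rw [Complex.norm_exp_ofReal_mul_I]
  have Bd : ‖(∫ ω, Complex.exp ((∑ k ∈ range m, X k ω : ℝ) * Complex.I) ∂μ) * Real.exp (s / 2)
      - ∫ ω, expProd X (s + 1) m ω ∂μ‖ ≤ Real.exp ((s + 2) / 2) * (2 * δ + L) := by
    rw [← integral_mul_const, ← integral_sub (iexp.mul_const _) (h.integrable_expProd hc m), hδ, hL,
      ← integral_finsetSum _ fun k _ => h.integrable_tailSq ε k, ← integral_const_mul,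
      ← integral_add (iabs.const_mul 2) itail, ← integral_const_mul]
    exact norm_integral_le_of_norm_le (((iabs.const_mul 2).add itail).const_mul _)
      (Eventually.of_forall fun ω => norm_exp_sub_expProd_le X hs hε m ω)
  rw [← sub_add_sub_cancel _ (∫ ω, expProd X (s + 1) m ω ∂μ) 1]
  refine (norm_add_le _ _).trans ((add_le_add Bd A).trans ?_)
  have hK : 0 < Real.exp ((s + 2) / 2) := Real.exp_pos _
  have h1 : ε * ∑ k ∈ range m, ∫ ω, X k ω ^ 2 ∂μ ≤ ε * (s + δ) := by gcongr
  have h2 : 0 ≤ ε * (s + δ) := by positivity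
  calc Real.exp ((s + 2) / 2) * (2 * δ + L) +
        20 * Real.exp ((s + 2) / 2) * (ε * ∑ k ∈ range m, ∫ ω, X k ω ^ 2 ∂μ + L)
      = Real.exp ((s + 2) / 2) * (2 * δ + L +
        20 * (ε * ∑ k ∈ range m, ∫ ω, X k ω ^ 2 ∂μ + L)) := by ring
    _ ≤ Real.exp ((s + 2) / 2) * (22 * (ε * (s + δ) + δ + L)) := by
        gcongr; linarith
    _ = _ := by ring

end Row

/-- McLeish's central limit theorem for arrays of martingale differences. -/
theorem tendsto_integral_exp_of_isMartingaleDiff {Ω ι : Type*} [MeasurableSpace Ω] {μ : Measure Ω}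
    [IsProbabilityMeasure μ] {l : Filter ι} {ℱ : ι → ℕ → MeasurableSpace Ω}
    {X : ι → ℕ → Ω → ℝ} {m : ι → ℕ} (h : ∀ i, IsMartingaleDiff μ (ℱ i) (X i)) {s : ℝ} (hs : 0 ≤ s)
    (hsq : Tendsto (fun i => ∫ ω, |sqSum (X i) (m i) ω - s| ∂μ) l (𝓝 0))
    (hlind : ∀ ε : ℝ, 0 < ε →
      Tendsto (fun i => ∑ k ∈ range (m i), ∫ ω, tailSq ε (X i k ω) ∂μ) l (𝓝 0)) :
    Tendsto (fun i => ∫ ω, Complex.exp ((∑ k ∈ range (m i), X i k ω : ℝ) * Complex.I) ∂μ) l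
      (𝓝 (Real.exp (-s / 2) : ℝ)) := by
  set K := 22 * Real.exp ((s + 2) / 2) with hK
  have hK0 : 0 < K := by positivity
  have key : Tendsto (fun i => (∫ ω, Complex.exp ((∑ k ∈ range (m i), X i k ω : ℝ) *
      Complex.I) ∂μ) * Real.exp (s / 2) - 1) l (𝓝 0) := by
    rw [tendsto_zero_iff_norm_tendsto_zero]
    rw [Metric.tendsto_nhds]
    intro η hη
    -- In the limit the bound is `K ε s`, which this choice makes smaller than `η`.
    set ε := min 1 (η / (2 * K * (s + 1))) with hεd
    have hε : 0 < ε := lt_min one_pos (by positivity)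
    have hb : Tendsto (fun i => K * (ε * (s + ∫ ω, |sqSum (X i) (m i) ω - s| ∂μ)
        + ∫ ω, |sqSum (X i) (m i) ω - s| ∂μ + ∑ k ∈ range (m i), ∫ ω, tailSq ε (X i k ω) ∂μ)) l
        (𝓝 (K * (ε * (s + 0) + 0 + 0))) :=
      ((((hsq.const_add s).const_mul ε).add hsq).add (hlind ε hε)).const_mul K
    have hlt : K * (ε * (s + 0) + 0 + 0) < η := by
      have h1 : ε ≤ η / (2 * K * (s + 1)) := min_le_right _ _
      rw [le_div_iff₀ (by positivity)] at h1
      nlinarith [mul_pos hε hK0]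
    filter_upwards [hb.eventually_lt_const hlt] with i hi
    rw [Real.dist_eq, sub_zero, abs_of_nonneg (norm_nonneg _)]
    exact ((h i).norm_integral_exp_le hs hε.le (min_le_left _ _) (m i)).trans_lt hi
  have := (key.add_const 1).mul_const ((Real.exp (-s / 2) : ℝ) : ℂ)
  simp only [sub_add_cancel, zero_add, one_mul, mul_assoc, ← Complex.ofReal_mul, ← Real.exp_add]
    at this
  simpa [neg_div] using this

lemma integral_comp_of_measurePreserving {Ω Ω' : Type*} [MeasurableSpace Ω] [MeasurableSpace Ω']
    {μ : Measure Ω} {ν : Measure Ω'} {T : Ω → Ω'} (hT : MeasurePreserving T μ ν)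
    {G : Type*} [NormedAddCommGroup G] [NormedSpace ℝ G] {f : Ω' → G}
    (hf : AEStronglyMeasurable f ν) : ∫ ω, f (T ω) ∂μ = ∫ ω, f ω ∂ν := by
  rw [← integral_map hT.measurable.aemeasurable (by rwa [hT.map_eq]), hT.map_eq]

/-! ### Mean ergodic theorem and the central limit theorem for stationary ergodic differences -/

section Ergodic

variable {Ω : Type*} [m0 : MeasurableSpace Ω] {μ : Measure Ω} [IsProbabilityMeasure μ] {T : Ω → Ω}

lemma integral_abs_le_norm_Lp (y : Lp ℝ 2 μ) : ∫ ω, |y ω| ∂μ ≤ ‖y‖ := by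
  have h1 : ∫ ω, |y ω| ∂μ = (eLpNorm y 1 μ).toReal := by
    simp only [← Real.norm_eq_abs]
    rw [integral_norm_eq_lintegral_enorm (Lp.aestronglyMeasurable y), eLpNorm_one_eq_lintegral_enorm]
  rw [h1, Lp.norm_def]
  exact ENNReal.toReal_mono (Lp.eLpNorm_ne_top y)
    (eLpNorm_le_eLpNorm_of_exponent_le (by norm_num) (Lp.aestronglyMeasurable y))

/-- The Koopman operator on `L²`. -/
noncomputable def koopman (T : Ω → Ω) (hT : MeasurePreserving T μ μ) : Lp ℝ 2 μ →L[ℝ] Lp ℝ 2 μ :=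
  (Lp.compMeasurePreservingₗᵢ ℝ T hT).toContinuousLinearMap

lemma norm_koopman (hT : MeasurePreserving T μ μ) (x : Lp ℝ 2 μ) : ‖koopman T hT x‖ = ‖x‖ :=
  (Lp.compMeasurePreservingₗᵢ ℝ T hT).norm_map x

lemma koopman_toLp (hT : MeasurePreserving T μ μ) {g : Ω → ℝ} (hg : MemLp g 2 μ) :
    koopman T hT (hg.toLp g) = (hg.comp_measurePreserving hT).toLp (g ∘ T) := rfl

lemma coeFn_koopman (hT : MeasurePreserving T μ μ) (x : Lp ℝ 2 μ) :
    koopman T hT x =ᵐ[μ] x ∘ T := Lp.coeFn_compMeasurePreserving x hT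

lemma koopman_pow_toLp (hT : MeasurePreserving T μ μ) {g : Ω → ℝ} (hg : MemLp g 2 μ) (k : ℕ) :
    (koopman T hT ^ k) (hg.toLp g)
      = (hg.comp_measurePreserving (hT.iterate k)).toLp (g ∘ T^[k]) := by
  induction k with
  | zero => rfl
  | succ k ih =>
    rw [pow_succ', mul_apply_eq_comp, ih, koopman_toLp]
    rfl

/-- Mean ergodic theorem for an ergodic transformation in `L²`, with convergence in mean. -/
lemma tendsto_integral_abs_average_of_memLp (hT : Ergodic T μ) {g : Ω → ℝ} (hg : MemLp g 2 μ) :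
    Tendsto (fun n : ℕ => ∫ ω, |(n : ℝ)⁻¹ * ∑ k ∈ range n, g (T^[k] ω) - ∫ a, g a ∂μ| ∂μ) atTop
      (𝓝 0) := by
  set K := koopman T hT.toMeasurePreserving with hK
  set x := hg.toLp g with hx
  have hK1 : ‖K‖ ≤ 1 := ContinuousLinearMap.opNorm_le_bound _ zero_le_one fun y => by
    rw [norm_koopman, one_mul]
  have h := K.tendsto_birkhoffAverage_orthogonalProjection hK1 x
  set y : Lp ℝ 2 μ := ((K.eqLocus (1 : Lp ℝ 2 μ →L[ℝ] Lp ℝ 2 μ)).orthogonalProjectionOnto x : Lp ℝ 2 μ)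
    with hy
  have hyfix : K y = y :=
    ((K.eqLocus (1 : Lp ℝ 2 μ →L[ℝ] Lp ℝ 2 μ)).orthogonalProjectionOnto x).2
  -- The limit of the averages is the projection onto the invariant vectors; by ergodicity it is
  -- constant.
  obtain ⟨c, hc⟩ : ∃ c, y =ᵐ[μ] fun _ => c := by
    have := hT.ae_eq_const_of_ae_eq_comp_ae (Lp.aestronglyMeasurable y)
      ((coeFn_koopman hT.toMeasurePreserving y).symm.trans (by rw [← hK, hyfix]))
    obtain ⟨c, hc⟩ := this
    exact ⟨c, hc⟩
  have hav : ∀ n : ℕ, ((birkhoffAverage ℝ K _root_.id n x : Lp ℝ 2 μ) : Ω → ℝ) =ᵐ[μ]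
      fun ω => (n : ℝ)⁻¹ * ∑ k ∈ range n, g (T^[k] ω) := by
    intro n
    have h1 : birkhoffAverage ℝ K _root_.id n x = (n : ℝ)⁻¹ • ∑ k ∈ range n, (K ^ k) x := by
      simp [birkhoffAverage, birkhoffSum]
    rw [h1]
    filter_upwards [Lp.coeFn_smul ((n : ℝ)⁻¹) (∑ k ∈ range n, (K ^ k) x),
      Lp.coeFn_finsetSum (range n) (fun k => (K ^ k) x),
      (ae_all_iff.2 fun k : ℕ => by
        rw [koopman_pow_toLp]; exact MemLp.coeFn_toLp _ :
        ∀ᵐ ω ∂μ, ∀ k : ℕ, ((K ^ k) x) ω = (g ∘ T^[k]) ω)] with ω h2 h3 h4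
    rw [h2, Pi.smul_apply, h3, smul_eq_mul, Finset.sum_apply]
    simp only [h4, Function.comp_apply]
  have hL1 : Tendsto (fun n : ℕ => ∫ ω, |(n : ℝ)⁻¹ * ∑ k ∈ range n, g (T^[k] ω) - c| ∂μ) atTop
      (𝓝 0) := by
    refine squeeze_zero (fun n => integral_nonneg fun _ => abs_nonneg _) (fun n => ?_)
      (tendsto_iff_norm_sub_tendsto_zero.1 h)
    refine le_trans (le_of_eq ?_) (integral_abs_le_norm_Lp _)
    refine integral_congr_ae ?_
    filter_upwards [Lp.coeFn_sub (birkhoffAverage ℝ K _root_.id n x) y, hav n, hc] with ω h1 h2 h3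
    rw [h1, Pi.sub_apply, h2, h3]
  have hgi : Integrable g μ := hg.integrable (by norm_num)
  have hgk : ∀ k, Integrable (fun ω => g (T^[k] ω)) μ := fun k =>
    (hT.toMeasurePreserving.iterate k).integrable_comp_of_integrable hgi
  have hgi' : ∀ k, ∫ ω, g (T^[k] ω) ∂μ = ∫ a, g a ∂μ := fun k =>
    integral_comp_of_measurePreserving (hT.toMeasurePreserving.iterate k) hg.1
  have hcI : c = ∫ a, g a ∂μ := by
    have hb : ∀ᶠ n : ℕ in atTop, |∫ a, g a ∂μ - c| ≤
        ∫ ω, |(n : ℝ)⁻¹ * ∑ k ∈ range n, g (T^[k] ω) - c| ∂μ := by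
      filter_upwards [eventually_gt_atTop 0] with n hn
      have hn' : (n : ℝ) ≠ 0 := by positivity
      have is : Integrable (fun ω => (n : ℝ)⁻¹ * ∑ k ∈ range n, g (T^[k] ω)) μ :=
        (integrable_finsetSum _ fun k _ => hgk k).const_mul _
      have e : ∫ ω, ((n : ℝ)⁻¹ * ∑ k ∈ range n, g (T^[k] ω) - c) ∂μ = ∫ a, g a ∂μ - c := by
        rw [integral_sub is (integrable_const c), integral_const_mul,
          integral_finsetSum _ fun k _ => hgk k]
        simp only [hgi', Finset.sum_const, Finset.card_range, nsmul_eq_mul, integral_const,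
          probReal_univ, smul_eq_mul, one_mul]
        field_simp
      rw [← e]
      exact abs_integral_le_integral_abs
    have := le_of_tendsto_of_tendsto tendsto_const_nhds hL1 hb
    have := abs_eq_zero.1 (le_antisymm this (abs_nonneg _))
    linarith
  rw [← hcI]
  exact hL1

/-- Mean ergodic theorem for an ergodic transformation in `L¹`. -/
lemma tendsto_integral_abs_average (hT : Ergodic T μ) {f : Ω → ℝ} (hf : Integrable f μ) :
    Tendsto (fun n : ℕ => ∫ ω, |(n : ℝ)⁻¹ * ∑ k ∈ range n, f (T^[k] ω) - ∫ a, f a ∂μ| ∂μ) atTop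
      (𝓝 0) := by
  rw [Metric.tendsto_nhds]
  intro ε hε
  obtain ⟨g, hg1, hg2⟩ := (memLp_one_iff_integrable.2 hf).exists_simpleFunc_eLpNorm_sub_lt
    (by norm_num) (ε := ENNReal.ofReal (ε / 4)) (by simpa using hε)
  have hgL2 : MemLp g 2 μ := SimpleFunc.memLp_of_isFiniteMeasure g 2 μ
  have hgi : Integrable g μ := memLp_one_iff_integrable.1 hg2
  have hfg : Integrable (fun ω => |f ω - g ω|) μ := (hf.sub hgi).abs
  have hη : ∫ ω, |f ω - g ω| ∂μ ≤ ε / 4 := by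
    have h1 : ∫ ω, |f ω - g ω| ∂μ = (eLpNorm (f - ⇑g) 1 μ).toReal := by
      rw [eLpNorm_one_eq_lintegral_enorm, ← integral_norm_eq_lintegral_enorm (hf.sub hgi).1]
      rfl
    rw [h1]
    exact ENNReal.toReal_le_of_le_ofReal (by positivity) hg1.le
  have hcomp : ∀ {u : Ω → ℝ}, Integrable u μ → ∀ k, Integrable (fun ω => u (T^[k] ω)) μ ∧
      ∫ ω, u (T^[k] ω) ∂μ = ∫ a, u a ∂μ := fun {u} hu k => by
    have hm := hT.toMeasurePreserving.iterate k
    exact ⟨hm.integrable_comp_of_integrable hu, integral_comp_of_measurePreserving hm hu.1⟩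
  filter_upwards [(tendsto_integral_abs_average_of_memLp hT hgL2).eventually_lt_const
    (u := ε / 2) (by positivity)] with n hn
  rw [Real.dist_eq, sub_zero, abs_of_nonneg (integral_nonneg fun _ => abs_nonneg _)]
  have iA : ∀ {u : Ω → ℝ}, Integrable u μ →
      Integrable (fun ω => (n : ℝ)⁻¹ * ∑ k ∈ range n, u (T^[k] ω)) μ := fun hu =>
    (integrable_finsetSum _ fun k _ => (hcomp hu k).1).const_mul _
  have ig : Integrable (fun ω => |(n : ℝ)⁻¹ * ∑ k ∈ range n, g (T^[k] ω) - ∫ a, g a ∂μ|) μ :=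
    ((iA hgi).sub (integrable_const _)).abs
  have hle : ∫ ω, |(n : ℝ)⁻¹ * ∑ k ∈ range n, f (T^[k] ω) - ∫ a, f a ∂μ| ∂μ ≤
      ∫ ω, ((n : ℝ)⁻¹ * ∑ k ∈ range n, |f (T^[k] ω) - g (T^[k] ω)| +
        |(n : ℝ)⁻¹ * ∑ k ∈ range n, g (T^[k] ω) - ∫ a, g a ∂μ| + ε / 4) ∂μ := by
    refine integral_mono ((iA hf).sub (integrable_const _)).abs
      (((iA hfg).add ig).add (integrable_const _)) fun ω => ?_
    have h1 : |∫ a, g a ∂μ - ∫ a, f a ∂μ| ≤ ε / 4 := by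
      rw [← integral_sub hgi hf]
      refine abs_integral_le_integral_abs.trans (le_trans (le_of_eq ?_) hη)
      simp only [abs_sub_comm]
    have h2 : |(n : ℝ)⁻¹ * ∑ k ∈ range n, f (T^[k] ω) - (n : ℝ)⁻¹ * ∑ k ∈ range n, g (T^[k] ω)| ≤
        (n : ℝ)⁻¹ * ∑ k ∈ range n, |f (T^[k] ω) - g (T^[k] ω)| := by
      rw [← mul_sub, ← Finset.sum_sub_distrib, abs_mul, abs_of_nonneg (by positivity)]
      gcongr
      exact Finset.abs_sum_le_sum_abs _ _
    have h3 := abs_sub_le ((n : ℝ)⁻¹ * ∑ k ∈ range n, f (T^[k] ω))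
      ((n : ℝ)⁻¹ * ∑ k ∈ range n, g (T^[k] ω)) (∫ a, f a ∂μ)
    have h4 := abs_sub_le ((n : ℝ)⁻¹ * ∑ k ∈ range n, g (T^[k] ω)) (∫ a, g a ∂μ) (∫ a, f a ∂μ)
    dsimp only
    linarith
  refine hle.trans_lt ?_
  have i12 : Integrable (fun ω => (n : ℝ)⁻¹ * ∑ k ∈ range n, |f (T^[k] ω) - g (T^[k] ω)| +
        |(n : ℝ)⁻¹ * ∑ k ∈ range n, g (T^[k] ω) - ∫ a, g a ∂μ|) μ := (iA hfg).add ig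
  rw [integral_add i12 (integrable_const _), integral_add (iA hfg) ig, integral_const_mul,
    integral_finsetSum _ fun k _ => (hcomp hfg k).1]
  rw [Finset.sum_congr rfl fun k _ => (hcomp hfg k).2]
  simp only [Finset.sum_const, Finset.card_range, nsmul_eq_mul, integral_const, probReal_univ,
    smul_eq_mul, one_mul]
  have : (n : ℝ)⁻¹ * (n * ∫ a, |f a - g a| ∂μ) ≤ ∫ a, |f a - g a| ∂μ := by
    rcases Nat.eq_zero_or_pos n with rfl | h
    · simpa using integral_nonneg fun _ => abs_nonneg _
    · have : (n : ℝ) ≠ 0 := by positivity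
      rw [← mul_assoc, inv_mul_cancel₀ this, one_mul]
  linarith

lemma IsMartingaleDiff.const_mul {ℱ : ℕ → MeasurableSpace Ω} {X : ℕ → Ω → ℝ}
    (h : IsMartingaleDiff μ ℱ X) (c : ℝ) : IsMartingaleDiff μ ℱ fun k ω => c * X k ω where
  le := h.le
  mono := h.mono
  meas k := (h.meas k).const_mul c
  memLp k := (h.memLp k).const_mul c
  orth k φ hφ hb := by
    have := h.orth k φ hφ hb
    simp only [mul_left_comm _ c]
    rw [integral_const_mul, this, mul_zero]

/-- The Lindeberg condition for the multiples of one square integrable function. -/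
lemma tendsto_mul_integral_tailSq {d : Ω → ℝ} (hd : MemLp d 2 μ) {ε : ℝ} (hε : 0 < ε) (t : ℝ) :
    Tendsto (fun n : ℕ => (n : ℝ) * ∫ ω, tailSq ε (t * (√n)⁻¹ * d ω) ∂μ) atTop (𝓝 0) := by
  simp only [← integral_const_mul]
  rw [← integral_zero Ω ℝ (μ := μ)]
  have hsq : ∀ (n : ℕ) (x : ℝ), n * (t * (√n)⁻¹ * x) ^ 2 ≤ t ^ 2 * x ^ 2 := by
    intro n x
    rcases Nat.eq_zero_or_pos n with rfl | h
    · simp; positivity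
    · have : (0 : ℝ) < n := by exact_mod_cast h
      rw [mul_pow, mul_pow, inv_pow, Real.sq_sqrt this.le]
      field_simp
      rfl
  -- The integrand is dominated by `t² d²` and vanishes at each point for large `n`, since the
  -- argument of `tailSq` tends to zero.
  refine tendsto_integral_of_dominated_convergence (fun ω => t ^ 2 * d ω ^ 2) (fun n => ?_)
    (hd.integrable_sq.const_mul _) (fun n => Eventually.of_forall fun ω => ?_)
    (Eventually.of_forall fun ω => ?_)
  · exact (((measurable_tailSq ε).comp_aemeasurable
      (hd.1.aemeasurable.const_mul _)).const_mul _).aestronglyMeasurable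
  · rw [Real.norm_of_nonneg (mul_nonneg (Nat.cast_nonneg _) (tailSq_nonneg _ _))]
    exact (mul_le_mul_of_nonneg_left (tailSq_le _ _) (Nat.cast_nonneg _)).trans (hsq n _)
  · have h0 : Tendsto (fun n : ℕ => |t * (√n)⁻¹ * d ω|) atTop (𝓝 |t * 0 * d ω|) :=
      (((tendsto_inv_atTop_zero.comp (Real.tendsto_sqrt_atTop.comp
        tendsto_natCast_atTop_atTop)).const_mul t).mul_const _).abs
    refine tendsto_const_nhds.congr' ?_
    simp only [mul_zero, zero_mul, abs_zero] at h0
    filter_upwards [h0.eventually_lt_const hε] with n hn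
    rw [tailSq, if_neg (not_lt.2 hn.le), mul_zero]

/-- The central limit theorem for stationary ergodic martingale differences. -/
theorem tendsto_integral_exp_of_ergodic (hT : Ergodic T μ) {d : Ω → ℝ}
    {ℱ : ℕ → MeasurableSpace Ω} (h : IsMartingaleDiff μ ℱ fun k ω => d (T^[k] ω)) (t : ℝ) :
    Tendsto (fun n : ℕ => ∫ ω, Complex.exp
      ((t * ((√n)⁻¹ * ∑ k ∈ range n, d (T^[k] ω)) : ℝ) * Complex.I) ∂μ) atTop
      (𝓝 (Real.exp (-(t ^ 2 * ∫ ω, d ω ^ 2 ∂μ) / 2) : ℝ)) := by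
  have hd : MemLp d 2 μ := h.memLp 0
  have key := tendsto_integral_exp_of_isMartingaleDiff (l := (atTop : Filter ℕ)) (ι := ℕ)
    (ℱ := fun _ => ℱ) (X := fun n k ω => t * (√n)⁻¹ * d (T^[k] ω)) (m := fun n => n)
    (fun n => h.const_mul _) (s := t ^ 2 * ∫ ω, d ω ^ 2 ∂μ)
    (mul_nonneg (sq_nonneg _) (integral_nonneg fun _ => sq_nonneg _)) ?_ ?_
  · simpa only [← Finset.mul_sum, mul_assoc] using key
  · have h1 := (tendsto_integral_abs_average hT hd.integrable_sq).const_mul (t ^ 2)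
    rw [mul_zero] at h1
    refine h1.congr fun n => ?_
    rw [← integral_const_mul]
    congr 1 with ω
    rw [← abs_of_nonneg (sq_nonneg t), ← abs_mul, abs_of_nonneg (sq_nonneg t), mul_sub, sqSum]
    congr 2
    simp only [mul_pow, inv_pow, Real.sq_sqrt (Nat.cast_nonneg n), ← Finset.mul_sum]
    ring
  · intro ε hε
    refine (tendsto_mul_integral_tailSq hd hε t).congr fun n => ?_
    have : ∀ k ∈ range n, ∫ ω, tailSq ε (t * (√n)⁻¹ * d (T^[k] ω)) ∂μ =
        ∫ ω, tailSq ε (t * (√n)⁻¹ * d ω) ∂μ := by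
      intro k _
      have hm := hT.toMeasurePreserving.iterate k
      have hmeas : AEStronglyMeasurable (fun ω => tailSq ε (t * (√n)⁻¹ * d ω)) μ :=
        ((measurable_tailSq ε).comp_aemeasurable (hd.1.aemeasurable.const_mul _)).aestronglyMeasurable
      exact integral_comp_of_measurePreserving hm hmeas
    rw [Finset.sum_congr rfl this]
    simp

end Ergodic

/-! ### Averages of weakly dependent stationary variables -/

section Averages

variable {H : Type*} [NormedAddCommGroup H] [InnerProductSpace ℝ H] {U : H →L[ℝ] H}

/-- Each new translate adds `‖y‖²` and twice correlations at lags up to `N`, so finitely many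
correlations control the sum. -/
lemma norm_sq_geomSum_le (hU : ∀ x, ‖U x‖ = ‖x‖) (y : H) (n N : ℕ) (hn : n ≤ N) :
    ‖geomSum U n y‖ ^ 2 ≤
      n * (‖y‖ ^ 2 + 2 * ∑ k ∈ range N, |⟪y, (U ^ (k + 1)) y⟫_ℝ|) := by
  induction n with
  | zero => simp
  | succ n ih =>
    have e : geomSum U (n + 1) y = y + U (geomSum U n y) := by
      rw [add_comm n 1, geomSum_add]; simp
    have o : ⟪y, U (geomSum U n y)⟫_ℝ ≤ ∑ k ∈ range N, |⟪y, (U ^ (k + 1)) y⟫_ℝ| := by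
      rw [geomSum_apply, map_sum, inner_sum]
      refine (Finset.sum_le_sum fun k _ => le_abs_self _).trans ?_
      refine le_trans (le_of_eq (Finset.sum_congr rfl fun k _ => ?_))
        (Finset.sum_le_sum_of_subset_of_nonneg
          (Finset.range_mono (by omega : n ≤ N)) fun _ _ _ => abs_nonneg _)
      rw [pow_succ', mul_apply_eq_comp]
    rw [e, norm_add_sq_real, hU]
    have := ih (by omega)
    rw [Nat.cast_add_one]
    linarith

/-- Decompose `y = geomAvg U N y + (1 - U) z` with `‖z‖ ≤ N ‖y‖`; the coboundary telescopes.
Averages of every long length `m` are thus controlled by one fixed `N`, hence by finitely many lags,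
and no uniformity in the lag is needed. -/
lemma norm_geomAvg_le_add (hU : ∀ x, ‖U x‖ = ‖x‖) (y : H) (m : ℕ) {N : ℕ} (hN : N ≠ 0) :
    ‖geomAvg U m y‖ ≤ ‖geomAvg U N y‖ + 2 * N / m * ‖y‖ := by
  have hU' : ∀ x, ‖U x‖ ≤ ‖x‖ := fun x => (hU x).le
  set z := ((N : ℝ)⁻¹ • ∑ i ∈ range N, geomSum U i) y with hz
  have hzn : ‖z‖ ≤ N * ‖y‖ := by
    rw [hz, smul_apply, norm_smul, norm_inv, Real.norm_natCast, sum_apply,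
      inv_mul_le_iff₀ (by positivity)]
    refine (norm_sum_le _ _).trans ((Finset.sum_le_card_nsmul _ _ (N * ‖y‖) fun i hi => ?_).trans
      (by simp))
    refine (norm_geomSum_apply_le hU' i y).trans ?_
    gcongr
    exact (Finset.mem_range.1 hi).le
  have h1 : y = geomAvg U N y + (1 - U) z := by
    have := DFunLike.congr_fun (one_sub_geomAvg U hN) y
    rw [mul_apply_eq_comp, ← hz, sub_apply, one_apply_eq_self] at this
    rw [← this]; abel
  have h2 : ‖geomAvg U m ((1 - U) z)‖ ≤ 2 / m * ‖z‖ := by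
    have : geomSum U m ((1 - U) z) = z - (U ^ m) z := by
      rw [commute_apply (geomSum_commute ((Commute.one_right U).sub_right (Commute.refl U)) m)]
      exact DFunLike.congr_fun (one_sub_mul_geomSum U m) z
    rw [geomAvg, smul_apply, this, norm_smul, norm_inv, Real.norm_natCast, div_mul_eq_mul_div,
      inv_mul_eq_div]
    gcongr
    refine (norm_sub_le _ _).trans ?_
    rw [norm_pow_apply hU]; linarith
  calc ‖geomAvg U m y‖ = ‖geomAvg U m (geomAvg U N y) + geomAvg U m ((1 - U) z)‖ := by
        rw [← map_add, ← h1]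
    _ ≤ ‖geomAvg U N y‖ + 2 / m * (N * ‖y‖) :=
        (norm_add_le _ _).trans (add_le_add (norm_geomAvg_apply_le hU' _ _)
          (h2.trans (by gcongr)))
    _ = _ := by ring

end Averages

/-- The bounded substitute `2 (1 - cos (s x)) / s²` for `x²`. -/
noncomputable def cosSq (s x : ℝ) : ℝ := 2 / s ^ 2 * (1 - Real.cos (s * x))

lemma cosSq_le {s : ℝ} (hs : 0 < s) (x : ℝ) : cosSq s x ≤ x ^ 2 := by
  have := Real.one_sub_sq_div_two_le_cos (x := s * x)
  rw [cosSq, div_mul_eq_mul_div, div_le_iff₀ (by positivity)]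
  nlinarith

/-- Where `|x| > 3 / s`, the substitute is at most `4 / s² ≤ x² / 2`, so it misses at least half of
`x²`. A small defect of `cosSq` in mean therefore gives uniform integrability. -/
lemma tailSq_le_sub_cosSq {s : ℝ} (hs : 0 < s) (x : ℝ) :
    tailSq (3 / s) x ≤ 2 * (x ^ 2 - cosSq s x) := by
  unfold tailSq
  split_ifs with h
  · rw [div_lt_iff₀ hs] at h
    have h1 := Real.neg_one_le_cos (s * x)
    have h2 : cosSq s x ≤ 4 / s ^ 2 := by
      rw [cosSq, div_mul_eq_mul_div]
      gcongr; linarith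
    have h3 : 4 / s ^ 2 ≤ x ^ 2 / 2 := by
      rw [div_le_iff₀ (by positivity), ← sq_abs x]
      nlinarith [mul_self_lt_mul_self (by norm_num : (0 : ℝ) ≤ 3) h]
    linarith
  · have := cosSq_le hs x
    linarith

/-- This follows from `1 + x + x² / 2 ≤ exp x`, as `(1 - x + x² / 2) (1 + x + x² / 2) = 1 + x⁴ / 4`.
-/
lemma sub_sq_le_one_sub_exp_neg {x : ℝ} (hx : 0 ≤ x) :
    x - x ^ 2 / 2 ≤ 1 - Real.exp (-x) := by
  have h1 := Real.quadratic_le_exp_of_nonneg hx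
  have h2 : Real.exp (-x) * Real.exp x = 1 := by rw [← Real.exp_add]; simp
  have h3 := Real.exp_pos (-x)
  have h4 : Real.exp (-x) * (1 + x + x ^ 2 / 2) ≤ 1 :=
    (mul_le_mul_of_nonneg_left h1 h3.le).trans h2.le
  have h5 : 0 < 1 + x + x ^ 2 / 2 := by positivity
  by_contra! h
  have h6 : 1 - x + x ^ 2 / 2 < Real.exp (-x) := by linarith
  have h7 := mul_lt_mul_of_pos_right h6 h5
  nlinarith [sq_nonneg (x ^ 2)]

/-! ### Double sums built from asymptotically Gaussian, asymptotically pairwise independent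
variables -/

section Outer

variable {Ω : Type*} [m0 : MeasurableSpace Ω] {μ : Measure Ω} [IsProbabilityMeasure μ] {T : Ω → Ω}

lemma geomAvg_koopman_toLp_ae (hT : MeasurePreserving T μ μ) {g : Ω → ℝ} (hg : MemLp g 2 μ)
    (n : ℕ) : ((geomAvg (koopman T hT) n (hg.toLp g) : Lp ℝ 2 μ) : Ω → ℝ) =ᵐ[μ]
      fun ω => (n : ℝ)⁻¹ * ∑ k ∈ range n, g (T^[k] ω) := by
  rw [geomAvg, smul_apply, geomSum_apply]
  filter_upwards [Lp.coeFn_smul ((n : ℝ)⁻¹) (∑ k ∈ range n, (koopman T hT ^ k) (hg.toLp g)),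
    Lp.coeFn_finsetSum (range n) (fun k => (koopman T hT ^ k) (hg.toLp g)),
    (ae_all_iff.2 fun k : ℕ => by
      rw [koopman_pow_toLp]; exact MemLp.coeFn_toLp _ :
      ∀ᵐ ω ∂μ, ∀ k : ℕ, ((koopman T hT ^ k) (hg.toLp g)) ω = (g ∘ T^[k]) ω)] with ω h2 h3 h4
  rw [h2, Pi.smul_apply, h3, smul_eq_mul, Finset.sum_apply]
  simp only [h4, Function.comp_apply]

/-- Variables whose one- and two-point characteristic functions along `T` are asymptotically those
of independent centred Gaussian variables of variance `v`. -/
structure IsAsympGaussian (μ : Measure Ω) (T : Ω → Ω) (W : ℕ → Ω → ℝ) (v : ℝ) : Prop where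
  mp : MeasurePreserving T μ μ
  meas : ∀ n, Measurable (W n)
  memLp : ∀ n, MemLp (W n) 2 μ
  var_le : ∀ n, ∫ ω, W n ω ^ 2 ∂μ ≤ v
  cos_tendsto : ∀ s : ℝ, Tendsto (fun n => ∫ ω, Real.cos (s * W n ω) ∂μ) atTop
    (𝓝 (Real.exp (-(s ^ 2 * v) / 2)))
  cos_mul_tendsto : ∀ (s : ℝ) (k : ℕ), Tendsto
    (fun n => ∫ ω, Real.cos (s * W n ω) * Real.cos (s * W n (T^[k + 1] ω)) ∂μ) atTop
    (𝓝 (Real.exp (-(s ^ 2 * v) / 2) ^ 2))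

namespace IsAsympGaussian

variable {W : ℕ → Ω → ℝ} {v : ℝ}

lemma var_nonneg (h : IsAsympGaussian μ T W v) : 0 ≤ v :=
  (integral_nonneg fun _ => sq_nonneg _).trans (h.var_le 0)

lemma integrable_cos (h : IsAsympGaussian μ T W v) (s : ℝ) (n : ℕ) :
    Integrable (fun ω => Real.cos (s * W n ω)) μ :=
  Integrable.of_bound (C := 1) (Real.measurable_cos.comp ((h.meas n).const_mul s)).aestronglyMeasurable
    (Eventually.of_forall fun _ => Real.abs_cos_le_one _)

lemma integrable_cosSq (h : IsAsympGaussian μ T W v) (s : ℝ) (n : ℕ) :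
    Integrable (fun ω => cosSq s (W n ω)) μ :=
  ((integrable_const 1).sub (h.integrable_cos s n)).const_mul _

/-- For small `s` the substitute `cosSq s` captures almost all of the variance. -/
lemma eventually_integral_sub_cosSq_lt (h : IsAsympGaussian μ T W v) {ε : ℝ} (hε : 0 < ε) :
    ∃ s : ℝ, 0 < s ∧ ∀ᶠ n in atTop, v - ∫ ω, cosSq s (W n ω) ∂μ < ε := by
  have hv := h.var_nonneg
  -- The mean of `cosSq s (W n)` tends to `2 / s² * (1 - exp (-s² v / 2))`, which is at least `v -
  -- s² v² / 4`.
  obtain ⟨s, hs, hs2⟩ : ∃ s : ℝ, 0 < s ∧ s ^ 2 * (v ^ 2 / 4) < ε := by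
    refine ⟨√(ε / (v ^ 2 / 4 + 1)), by positivity, ?_⟩
    rw [Real.sq_sqrt (by positivity), div_mul_eq_mul_div, div_lt_iff₀ (by positivity)]
    nlinarith
  refine ⟨s, hs, ?_⟩
  have e : ∀ n, ∫ ω, cosSq s (W n ω) ∂μ = 2 / s ^ 2 * (1 - ∫ ω, Real.cos (s * W n ω) ∂μ) := by
    intro n
    simp only [cosSq]
    rw [integral_const_mul, integral_sub (integrable_const _) (h.integrable_cos s n)]
    simp
  have ht : Tendsto (fun n => v - ∫ ω, cosSq s (W n ω) ∂μ) atTop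
      (𝓝 (v - 2 / s ^ 2 * (1 - Real.exp (-(s ^ 2 * v) / 2)))) := by
    simp only [e]
    exact (((h.cos_tendsto s).const_sub 1).const_mul _).const_sub v
  refine ht.eventually_lt_const ?_
  have h1 := sub_sq_le_one_sub_exp_neg (x := s ^ 2 * v / 2) (by positivity)
  rw [← neg_div] at h1
  have h2 : 2 / s ^ 2 * (s ^ 2 * v / 2 - (s ^ 2 * v / 2) ^ 2 / 2) = v - s ^ 2 * (v ^ 2 / 4) := by
    field_simp
    ring
  have h3 := mul_le_mul_of_nonneg_left h1 (by positivity : 0 ≤ 2 / s ^ 2)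
  linarith

/-- Uniform integrability of the squares. -/
lemma exists_integral_tailSq_lt (h : IsAsympGaussian μ T W v) {ε : ℝ} (hε : 0 < ε) :
    ∃ R : ℝ, ∀ᶠ n in atTop, ∫ ω, tailSq R (W n ω) ∂μ < ε := by
  obtain ⟨s, hs, hn⟩ := h.eventually_integral_sub_cosSq_lt (ε := ε / 2) (by positivity)
  refine ⟨3 / s, hn.mono fun n hn => ?_⟩
  have i1 := (h.memLp n).integrable_sq
  have i2 := h.integrable_cosSq s n
  have := integral_mono_of_nonneg (Eventually.of_forall fun ω => tailSq_nonneg (3 / s) (W n ω))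
    ((i1.sub i2).const_mul 2) (Eventually.of_forall fun ω => tailSq_le_sub_cosSq hs (W n ω))
  refine this.trans_lt ?_
  rw [integral_const_mul]
  have e : ∫ ω, ((fun ω => W n ω ^ 2) - fun ω => cosSq s (W n ω)) ω ∂μ =
      ∫ ω, W n ω ^ 2 ∂μ - ∫ ω, cosSq s (W n ω) ∂μ := integral_sub i1 i2
  rw [e]
  linarith [h.var_le n]

/-- The averages of the cosines along `T` concentrate. -/
lemma exists_integral_abs_average_cos_lt (h : IsAsympGaussian μ T W v) (s : ℝ) {ε : ℝ}
    (hε : 0 < ε) : ∃ N₀ : ℕ, ∀ n m : ℕ, N₀ ≤ n → N₀ ≤ m →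
      ∫ ω, |(m : ℝ)⁻¹ * ∑ k ∈ range m, (Real.cos (s * W n (T^[k] ω))
        - ∫ a, Real.cos (s * W n a) ∂μ)| ∂μ < ε := by
  set c : ℕ → ℝ := fun n => ∫ a, Real.cos (s * W n a) ∂μ with hc
  set Y : ℕ → Ω → ℝ := fun n ω => Real.cos (s * W n ω) - c n with hY
  have hYm : ∀ n, Measurable (Y n) := fun n =>
    (Real.measurable_cos.comp ((h.meas n).const_mul s)).sub_const _
  have hc1 : ∀ n, |c n| ≤ 1 := fun n => by
    refine (norm_integral_le_of_norm_le_const (C := 1) (Eventually.of_forall fun ω =>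
      (Real.norm_eq_abs _).trans_le (Real.abs_cos_le_one _))).trans ?_
    simp
  have hYb : ∀ n ω, ‖Y n ω‖ ≤ 2 := fun n ω => by
    refine (norm_sub_le _ _).trans ?_
    have := Real.abs_cos_le_one (s * W n ω)
    have := hc1 n
    simp only [Real.norm_eq_abs]
    linarith
  have hYL : ∀ n, MemLp (Y n) 2 μ := fun n =>
    MemLp.of_bound (hYm n).aestronglyMeasurable 2 (Eventually.of_forall (hYb n))
  set K := koopman T h.mp
  have hK : ∀ x, ‖K x‖ = ‖x‖ := norm_koopman h.mp
  set y : ℕ → Lp ℝ 2 μ := fun n => (hYL n).toLp (Y n) with hy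
  have hyn : ∀ n, ‖y n‖ ≤ 2 := fun n => by
    have := Lp.norm_le_of_ae_bound (f := y n) (C := 2) (by norm_num) ?_
    · simpa [measureUnivNNReal] using this
    · filter_upwards [(hYL n).coeFn_toLp] with ω hω
      rw [hω]; exact hYb n ω
  -- At each fixed lag the covariance of the cosines tends to zero, by comparison of the one- and
  -- two-point limits.
  have hinner : ∀ k, Tendsto (fun n => ⟪y n, (K ^ (k + 1)) (y n)⟫_ℝ) atTop (𝓝 0) := by
    intro k
    have hTk := h.mp.iterate (k + 1)
    have e : ∀ n, ⟪y n, (K ^ (k + 1)) (y n)⟫_ℝ =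
        ∫ ω, Real.cos (s * W n ω) * Real.cos (s * W n (T^[k + 1] ω)) ∂μ - c n ^ 2 := by
      intro n
      rw [hy, koopman_pow_toLp, MeasureTheory.L2.inner_def]
      have i0 := h.integrable_cos s n
      have i1 : Integrable (fun ω => Real.cos (s * W n (T^[k + 1] ω))) μ :=
        hTk.integrable_comp_of_integrable i0
      have i2 : Integrable (fun ω => Real.cos (s * W n ω) * Real.cos (s * W n (T^[k + 1] ω))) μ :=
        i1.bdd_mul (c := 1) i0.1 (Eventually.of_forall fun ω =>
          (Real.norm_eq_abs _).trans_le (Real.abs_cos_le_one _))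
      have e2 : ∫ ω, Real.cos (s * W n (T^[k + 1] ω)) ∂μ = c n :=
        integral_comp_of_measurePreserving hTk i0.1
      have e1 : ∫ ω, ⟪((hYL n).toLp (Y n) : Ω → ℝ) ω,
          (((hYL n).comp_measurePreserving hTk).toLp (Y n ∘ T^[k + 1]) : Ω → ℝ) ω⟫_ℝ ∂μ =
          ∫ ω, (Real.cos (s * W n ω) * Real.cos (s * W n (T^[k + 1] ω))
            - c n * Real.cos (s * W n ω) - (c n * Real.cos (s * W n (T^[k + 1] ω)) - c n ^ 2)) ∂μ := by
        refine integral_congr_ae ?_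
        filter_upwards [(hYL n).coeFn_toLp,
          ((hYL n).comp_measurePreserving hTk).coeFn_toLp] with ω h1 h2
        rw [h1, h2]
        simp only [hY, Function.comp_apply, RCLike.inner_apply, conj_trivial]
        ring
      rw [e1]
      have j1 : Integrable (fun ω => Real.cos (s * W n ω) * Real.cos (s * W n (T^[k + 1] ω))
            - c n * Real.cos (s * W n ω)) μ := i2.sub (i0.const_mul _)
      have j2 : Integrable (fun ω => c n * Real.cos (s * W n (T^[k + 1] ω)) - c n ^ 2) μ :=
        (i1.const_mul _).sub (integrable_const _)
      rw [integral_sub j1 j2, integral_sub i2 (i0.const_mul _),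
        integral_sub (i1.const_mul _) (integrable_const _), integral_const_mul, integral_const_mul,
        e2]
      simp only [integral_const, probReal_univ, smul_eq_mul, one_mul]
      simp only [hc]
      ring
    simp only [e]
    have := (h.cos_mul_tendsto s k).sub ((h.cos_tendsto s).pow 2)
    simpa using this
  -- With `‖y n‖² ≤ 4` and correlations contributing at most 4, the average of length `N` has
  -- squared norm at most `8 / N < (ε / 2)²`. The threshold `8 N / ε` for `m` then makes the
  -- coboundary error at most `ε / 2`.
  obtain ⟨N, hN⟩ := exists_nat_gt (32 / ε ^ 2)
  have hN0 : N ≠ 0 := by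
    rintro rfl
    have : 0 < 32 / ε ^ 2 := by positivity
    simp at hN; linarith
  have hNpos : (0 : ℝ) < N := by positivity
  have hsum : Tendsto (fun n => 2 * ∑ k ∈ range N, |⟪y n, (K ^ (k + 1)) (y n)⟫_ℝ|) atTop
      (𝓝 (2 * ∑ k ∈ range N, |(0 : ℝ)|)) :=
    (tendsto_finsetSum _ fun k _ => (hinner k).abs).const_mul 2
  obtain ⟨n₀, hn₀⟩ := eventually_atTop.1
    (hsum.eventually_lt_const (u := 4) (by simp))
  obtain ⟨m₀, hm₀⟩ := exists_nat_gt (8 * N / ε)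
  refine ⟨max n₀ m₀, fun n m hn hm => ?_⟩
  have hn' := hn₀ n (le_trans (le_max_left _ _) hn)
  have hm' : 8 * N / ε < m := hm₀.trans_le (by exact_mod_cast le_trans (le_max_right _ _) hm)
  have hmpos : (0 : ℝ) < m := lt_of_le_of_lt (by positivity) hm'
  have hA : ‖geomAvg K N (y n)‖ < ε / 2 := by
    have h1 := norm_sq_geomSum_le hK (y n) N N le_rfl
    have h2 : ‖y n‖ ^ 2 ≤ 4 := by nlinarith [hyn n, norm_nonneg (y n)]
    have h3 : ‖geomSum K N (y n)‖ ^ 2 ≤ N * 8 := h1.trans (by gcongr; linarith)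
    have h4 : ‖geomAvg K N (y n)‖ ^ 2 ≤ 8 / N := by
      rw [geomAvg, smul_apply, norm_smul, norm_inv, Real.norm_natCast, mul_pow, inv_pow,
        inv_mul_le_iff₀ (by positivity)]
      refine h3.trans (le_of_eq ?_)
      field_simp
    have h5 : 8 / N < (ε / 2) ^ 2 := by
      rw [div_lt_iff₀ (by positivity)] at hN ⊢
      nlinarith
    exact lt_of_pow_lt_pow_left₀ 2 (by positivity) (h4.trans_lt h5)
  have hfin : ‖geomAvg K m (y n)‖ < ε := by
    refine (norm_geomAvg_le_add hK (y n) m hN0).trans_lt ?_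
    have : 2 * N / m * ‖y n‖ ≤ ε / 2 := by
      rw [div_lt_iff₀ hε] at hm'
      rw [div_mul_eq_mul_div, div_le_iff₀ hmpos]
      have := mul_le_mul_of_nonneg_left (hyn n) (by positivity : 0 ≤ 2 * (N : ℝ))
      linarith
    linarith
  refine lt_of_le_of_lt (le_trans (le_of_eq (integral_congr_ae ?_)) (integral_abs_le_norm_Lp _)) hfin
  filter_upwards [geomAvg_koopman_toLp_ae h.mp (hYL n) m] with ω hω
  rw [hω]

/-- The averages of the squares along `T` concentrate around `v`. -/
lemma exists_integral_abs_average_sq_lt (h : IsAsympGaussian μ T W v) {ε : ℝ} (hε : 0 < ε) :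
    ∃ N₀ : ℕ, ∀ n m : ℕ, N₀ ≤ n → N₀ ≤ m →
      ∫ ω, |(m : ℝ)⁻¹ * ∑ k ∈ range m, W n (T^[k] ω) ^ 2 - v| ∂μ < ε := by
  obtain ⟨s, hs, hsn⟩ := h.eventually_integral_sub_cosSq_lt (ε := ε / 4) (by positivity)
  obtain ⟨n₁, hn₁⟩ := eventually_atTop.1 hsn
  obtain ⟨N₂, hN₂⟩ := h.exists_integral_abs_average_cos_lt s (ε := s ^ 2 * ε / 4) (by positivity)
  refine ⟨max 1 (max n₁ N₂), fun n m hn hm => ?_⟩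
  have hm1 : m ≠ 0 := by have := le_trans (le_max_left _ _) hm; omega
  have hmpos : (0 : ℝ) < m := by positivity
  have a1 := hn₁ n (le_trans (le_trans (le_max_left _ _) (le_max_right _ _)) hn)
  have a2 := hN₂ n m (le_trans (le_trans (le_max_right _ _) (le_max_right _ _)) hn)
    (le_trans (le_trans (le_max_right _ _) (le_max_right _ _)) hm)
  have i1 := (h.memLp n).integrable_sq
  have i2 := h.integrable_cosSq s n
  have i3 := h.integrable_cos s n
  set c := ∫ a, Real.cos (s * W n a) ∂μ with hc
  set q := ∫ a, cosSq s (W n a) ∂μ with hq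
  have hqc : q = 2 / s ^ 2 * (1 - c) := by
    rw [hq]
    simp only [cosSq]
    rw [integral_const_mul, integral_sub (integrable_const _) i3]
    simp [hc]
  have hi : Integrable (fun ω => W n ω ^ 2 - cosSq s (W n ω)) μ := i1.sub i2
  have hTk := fun k => h.mp.iterate k
  have hik : ∀ k, Integrable (fun ω => W n (T^[k] ω) ^ 2 - cosSq s (W n (T^[k] ω))) μ := fun k =>
    (hTk k).integrable_comp_of_integrable hi
  have hek : ∀ k, ∫ ω, (W n (T^[k] ω) ^ 2 - cosSq s (W n (T^[k] ω))) ∂μ =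
      ∫ ω, W n ω ^ 2 ∂μ - q := fun k => by
    rw [hq, ← integral_sub i1 i2]
    exact integral_comp_of_measurePreserving (hTk k) hi.1
  have icos : Integrable (fun ω => |(m : ℝ)⁻¹ * ∑ k ∈ range m,
      (Real.cos (s * W n (T^[k] ω)) - c)|) μ :=
    ((integrable_finsetSum _ fun k _ => ((hTk k).integrable_comp_of_integrable i3).sub
      (integrable_const c)).const_mul _).abs
  have iav : Integrable (fun ω => (m : ℝ)⁻¹ * ∑ k ∈ range m,
      (W n (T^[k] ω) ^ 2 - cosSq s (W n (T^[k] ω)))) μ :=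
    (integrable_finsetSum _ fun k _ => hik k).const_mul _
  have hqv : q ≤ v := (integral_mono i2 i1 fun ω => cosSq_le hs _).trans (h.var_le n)
  -- Split `W² - v` into the nonnegative `W² - cosSq`, of mean at most `v - q`, the centred `cosSq -
  -- q`, which is a multiple of the centred cosine, and the constant `q - v`. Their contributions
  -- are below `ε / 4`, `ε / 2` and `ε / 4`.
  have hpt : ∀ ω, |(m : ℝ)⁻¹ * ∑ k ∈ range m, W n (T^[k] ω) ^ 2 - v| ≤
      (m : ℝ)⁻¹ * ∑ k ∈ range m, (W n (T^[k] ω) ^ 2 - cosSq s (W n (T^[k] ω))) +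
      2 / s ^ 2 * |(m : ℝ)⁻¹ * ∑ k ∈ range m, (Real.cos (s * W n (T^[k] ω)) - c)| + (v - q) := by
    intro ω
    have e : (m : ℝ)⁻¹ * ∑ k ∈ range m, W n (T^[k] ω) ^ 2 - v =
        (m : ℝ)⁻¹ * ∑ k ∈ range m, (W n (T^[k] ω) ^ 2 - cosSq s (W n (T^[k] ω))) +
        -(2 / s ^ 2 * ((m : ℝ)⁻¹ * ∑ k ∈ range m, (Real.cos (s * W n (T^[k] ω)) - c))) +
        -(v - q) := by
      simp only [cosSq, hqc, Finset.sum_sub_distrib, ← Finset.mul_sum, Finset.sum_const,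
        Finset.card_range, nsmul_eq_mul]
      field_simp
      ring
    rw [e]
    refine (abs_add_three _ _ _).trans ?_
    rw [abs_neg, abs_neg, abs_mul (2 / s ^ 2), abs_of_nonneg (by positivity : 0 ≤ 2 / s ^ 2),
      abs_of_nonneg (sub_nonneg.2 hqv), abs_of_nonneg (mul_nonneg (by positivity)
        (Finset.sum_nonneg fun k _ => sub_nonneg.2 (cosSq_le hs _)))]
  have i4 := icos.const_mul (2 / s ^ 2)
  have iall : Integrable (fun ω => (m : ℝ)⁻¹ * ∑ k ∈ range m,
      (W n (T^[k] ω) ^ 2 - cosSq s (W n (T^[k] ω))) +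
      2 / s ^ 2 * |(m : ℝ)⁻¹ * ∑ k ∈ range m, (Real.cos (s * W n (T^[k] ω)) - c)|) μ := iav.add i4
  refine (integral_mono_of_nonneg (Eventually.of_forall fun _ => abs_nonneg _)
    (iall.add (integrable_const (v - q))) (Eventually.of_forall hpt)).trans_lt ?_
  have e1 : ∫ ω, ((m : ℝ)⁻¹ * ∑ k ∈ range m, (W n (T^[k] ω) ^ 2 - cosSq s (W n (T^[k] ω))) +
      2 / s ^ 2 * |(m : ℝ)⁻¹ * ∑ k ∈ range m, (Real.cos (s * W n (T^[k] ω)) - c)| + (v - q)) ∂μ =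
      (∫ ω, W n ω ^ 2 ∂μ - q) +
      2 / s ^ 2 * ∫ ω, |(m : ℝ)⁻¹ * ∑ k ∈ range m, (Real.cos (s * W n (T^[k] ω)) - c)| ∂μ
      + (v - q) := by
    rw [integral_add iall (integrable_const _), integral_add iav i4,
      integral_const_mul, integral_const_mul, integral_finsetSum _ fun k _ => hik k]
    simp only [hek, Finset.sum_const, Finset.card_range, nsmul_eq_mul, integral_const,
      probReal_univ, smul_eq_mul, one_mul]
    rw [← mul_assoc, inv_mul_cancel₀ hmpos.ne', one_mul]
  refine e1.trans_lt ?_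
  have h1 := h.var_le n
  have h2 : 2 / s ^ 2 * ∫ ω, |(m : ℝ)⁻¹ * ∑ k ∈ range m, (Real.cos (s * W n (T^[k] ω)) - c)| ∂μ
      < ε / 2 := by
    refine (mul_lt_mul_of_pos_left a2 (by positivity)).trans_le (le_of_eq ?_)
    field_simp
    norm_num
  linarith

/-- The central limit theorem for the normalized double sums. -/
theorem tendsto_integral_exp (h : IsAsympGaussian μ T W v) {ℱ : ℕ → ℕ → MeasurableSpace Ω}
    (hM : ∀ n, IsMartingaleDiff μ (ℱ n) fun k ω => W n (T^[k] ω)) (t : ℝ) :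
    Tendsto (fun p : ℕ × ℕ => ∫ ω, Complex.exp
      ((t * ((√p.2)⁻¹ * ∑ k ∈ range p.2, W p.1 (T^[k] ω)) : ℝ) * Complex.I) ∂μ)
      (comap (fun p : ℕ × ℕ => min p.1 p.2) atTop) (𝓝 (Real.exp (-(t ^ 2 * v) / 2) : ℝ)) := by
  have hev : ∀ {P : ℕ × ℕ → Prop}, (∃ N : ℕ, ∀ n m : ℕ, N ≤ n → N ≤ m → P (n, m)) →
      ∀ᶠ p in comap (fun p : ℕ × ℕ => min p.1 p.2) atTop, P p := by
    rintro P ⟨N, hN⟩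
    refine Eventually.mono (tendsto_comap.eventually (eventually_ge_atTop N)) fun p hp => ?_
    exact hN p.1 p.2 (hp.trans (min_le_left _ _)) (hp.trans (min_le_right _ _))
  have key := tendsto_integral_exp_of_isMartingaleDiff
    (l := comap (fun p : ℕ × ℕ => min p.1 p.2) atTop)
    (ℱ := fun p => ℱ p.1) (X := fun p k ω => t * (√p.2)⁻¹ * W p.1 (T^[k] ω)) (m := fun p => p.2)
    (fun p => (hM p.1).const_mul _) (s := t ^ 2 * v)
    (mul_nonneg (sq_nonneg _) h.var_nonneg) ?_ ?_
  · simpa only [← Finset.mul_sum, mul_assoc] using key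
  · have h1 : Tendsto (fun p : ℕ × ℕ =>
        ∫ ω, |(p.2 : ℝ)⁻¹ * ∑ k ∈ range p.2, W p.1 (T^[k] ω) ^ 2 - v| ∂μ)
        (comap (fun p : ℕ × ℕ => min p.1 p.2) atTop) (𝓝 0) := by
      rw [Metric.tendsto_nhds]
      intro ε hε
      refine hev ?_
      obtain ⟨N, hN⟩ := h.exists_integral_abs_average_sq_lt hε
      refine ⟨N, fun n m hn hm => ?_⟩
      rw [Real.dist_eq, sub_zero, abs_of_nonneg (integral_nonneg fun _ => abs_nonneg _)]
      exact hN n m hn hm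
    replace h1 := h1.const_mul (t ^ 2)
    rw [mul_zero] at h1
    refine h1.congr fun p => ?_
    rw [← integral_const_mul]
    congr 1 with ω
    rw [← abs_of_nonneg (sq_nonneg t), ← abs_mul, abs_of_nonneg (sq_nonneg t), mul_sub, sqSum]
    congr 2
    simp only [mul_pow, inv_pow, Real.sq_sqrt (Nat.cast_nonneg p.2), ← Finset.mul_sum]
    ring
  · intro ε hε
    rw [Metric.tendsto_nhds]
    intro η hη
    refine hev ?_
    obtain ⟨R, hR⟩ := h.exists_integral_tailSq_lt (ε := η / (t ^ 2 + 1)) (by positivity)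
    obtain ⟨n₀, hn₀⟩ := eventually_atTop.1 hR
    obtain ⟨m₀, hm₀⟩ := exists_nat_gt ((R * |t| / ε) ^ 2)
    refine ⟨max n₀ m₀, fun n m hn hm => ?_⟩
    have hn' := hn₀ n (le_trans (le_max_left _ _) hn)
    have hm' : (R * |t| / ε) ^ 2 < m :=
      hm₀.trans_le (by exact_mod_cast le_trans (le_max_right _ _) hm)
    have hmpos : (0 : ℝ) < m := lt_of_le_of_lt (sq_nonneg _) hm'
    have hRm : R * |t| ≤ ε * √m := by
      have := Real.lt_sqrt_of_sq_lt hm'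
      rw [div_lt_iff₀ hε] at this
      linarith
    -- Once `R |t| ≤ ε √m`, exceeding `ε` after normalization forces `|x| > R`, so uniform
    -- integrability of the squares yields Lindeberg's condition for all large `n` at once.
    have hpt : ∀ x : ℝ, (m : ℝ) * tailSq ε (t * (√m)⁻¹ * x) ≤ t ^ 2 * tailSq R x := by
      intro x
      have hs : 0 < √(m : ℝ) := by positivity
      unfold tailSq
      split_ifs with h1 h2 h2
      · rw [mul_pow, mul_pow, inv_pow, Real.sq_sqrt hmpos.le]
        field_simp
        rfl
      · exfalso
        push Not at h2
        rw [abs_mul, abs_mul, abs_inv, abs_of_pos hs, ← div_eq_mul_inv, div_mul_eq_mul_div,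
          lt_div_iff₀ hs] at h1
        have := mul_le_mul_of_nonneg_left h2 (abs_nonneg t)
        linarith
      · simp; positivity
      · simp
    have he : ∀ k ∈ range m, ∫ ω, tailSq ε (t * (√m)⁻¹ * W n (T^[k] ω)) ∂μ =
        ∫ ω, tailSq ε (t * (√m)⁻¹ * W n ω) ∂μ := by
      intro k _
      have hmeas : AEStronglyMeasurable (fun ω => tailSq ε (t * (√m)⁻¹ * W n ω)) μ :=
        ((measurable_tailSq ε).comp ((h.meas n).const_mul _)).aestronglyMeasurable
      exact integral_comp_of_measurePreserving (h.mp.iterate k) hmeas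
    rw [Real.dist_eq, sub_zero, abs_of_nonneg (Finset.sum_nonneg fun _ _ =>
      integral_nonneg fun _ => tailSq_nonneg _ _)]
    dsimp only
    rw [Finset.sum_congr rfl he, Finset.sum_const, Finset.card_range, nsmul_eq_mul,
      ← integral_const_mul]
    have hint : Integrable (fun ω => tailSq R (W n ω)) μ := (hM n).integrable_tailSq R 0
    refine (integral_mono_of_nonneg (Eventually.of_forall fun ω =>
      mul_nonneg hmpos.le (tailSq_nonneg _ _)) (hint.const_mul (t ^ 2))
      (Eventually.of_forall fun ω => hpt _)).trans_lt ?_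
    rw [integral_const_mul]
    rw [lt_div_iff₀ (by positivity)] at hn'
    have : 0 ≤ ∫ ω, tailSq R (W n ω) ∂μ := integral_nonneg fun _ => tailSq_nonneg _ _
    linarith

end IsAsympGaussian

end Outer

/-! ### Conditional expectations and measure preserving maps -/

/-- Conditional expectations commute with measure preserving maps. -/
lemma condExp_comp_of_measurePreserving {Ω Ω' : Type*} {m : MeasurableSpace Ω'}
    [mΩ : MeasurableSpace Ω] [mΩ' : MeasurableSpace Ω'] {μ : Measure Ω} {ν : Measure Ω'} [IsProbabilityMeasure μ]
    [IsProbabilityMeasure ν] {T : Ω → Ω'} (hT : MeasurePreserving T μ ν)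
    (hm : m ≤ mΩ') {h : Ω' → ℝ} (hh : Integrable h ν) :
    μ[h ∘ T | m.comap T] =ᵐ[μ] ν[h | m] ∘ T := by
  have hm' : m.comap T ≤ mΩ :=
    (MeasurableSpace.comap_mono hm).trans hT.measurable.comap_le
  refine (ae_eq_condExp_of_forall_setIntegral_eq hm' (hT.integrable_comp_of_integrable hh)
    (fun s _ _ => (hT.integrable_comp_of_integrable integrable_condExp).integrableOn) ?_ ?_).symm
  · rintro s ⟨s', hs', rfl⟩ -
    have key : ∀ {g : Ω' → ℝ}, Integrable g ν →
        ∫ x in T ⁻¹' s', g (T x) ∂μ = ∫ y in s', g y ∂ν := by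
      intro g hg
      rw [← hT.map_eq] at hg ⊢
      exact (setIntegral_map (hm _ hs') hg.1 hT.measurable.aemeasurable).symm
    simp only [Function.comp_apply]
    rw [key integrable_condExp, key hh, setIntegral_condExp hm hh hs']
  · have h1 : @Measurable _ _ (m.comap T) m T := comap_measurable T
    have h2 : StronglyMeasurable[m] (ν[h | m]) := stronglyMeasurable_condExp
    exact (h2.comp_measurable h1).aestronglyMeasurable

section CondE

variable {Ω : Type*} {m m' : MeasurableSpace Ω} [m0 : MeasurableSpace Ω] {μ : Measure Ω} [IsProbabilityMeasure μ]

/-- Conditional expectation as an operator of `L²`. -/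
noncomputable def condE (μ : Measure Ω) [IsProbabilityMeasure μ] (hm : m ≤ m0) :
    Lp ℝ 2 μ →L[ℝ] Lp ℝ 2 μ :=
  (lpMeas ℝ ℝ m 2 μ).subtypeL ∘L condExpL2 ℝ ℝ hm

lemma coeFn_condE (hm : m ≤ m0) (x : Lp ℝ 2 μ) :
    condE μ hm x =ᵐ[μ] μ[x | m] := by
  have h := (Lp.memLp x).condExpL2_ae_eq_condExp (𝕜 := ℝ) hm
  rwa [Lp.toLp_coeFn] at h

lemma inner_condE (hm : m ≤ m0) (x y : Lp ℝ 2 μ) :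
    ⟪condE μ hm x, y⟫_ℝ = ⟪x, condE μ hm y⟫_ℝ := inner_condExpL2_left_eq_right hm

lemma koopman_condE {T : Ω → Ω} (hT : MeasurePreserving T μ μ)
    (hm : m ≤ m0) (hm' : m' ≤ m0) (h : m.comap T = m') (x : Lp ℝ 2 μ) :
    koopman T hT (condE μ hm x) = condE μ hm' (koopman T hT x) := by
  subst h
  refine Lp.ext ?_
  refine (coeFn_koopman hT _).trans ?_
  refine (hT.quasiMeasurePreserving.ae_eq_comp (coeFn_condE hm x)).trans ?_
  refine (condExp_comp_of_measurePreserving hT hm ((Lp.memLp x).integrable (by norm_num))).symm.trans ?_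
  exact (condExp_congr_ae (coeFn_koopman hT x).symm).trans (coeFn_condE hm' _).symm

lemma integral_mul_eq_zero_of_condE (hm : m ≤ m0) {g : Ω → ℝ}
    (hg : MemLp g 2 μ) (h : condE μ hm (hg.toLp g) = 0) {φ : Ω → ℝ} (hφ : Measurable[m] φ)
    (hb : ∃ C, ∀ ω, |φ ω| ≤ C) : ∫ ω, φ ω * g ω ∂μ = 0 := by
  obtain ⟨C, hC⟩ := hb
  have h1 : μ[g | m] =ᵐ[μ] 0 := by
    refine (condExp_congr_ae hg.coeFn_toLp.symm).trans ((coeFn_condE hm _).symm.trans ?_)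
    rw [h]
    exact Lp.coeFn_zero _ _ _
  have h2 := condExp_stronglyMeasurable_mul_of_bound hm hφ.stronglyMeasurable
    (hg.integrable (by norm_num)) C (Eventually.of_forall hC)
  have h3 : ∫ ω, (φ * g) ω ∂μ = 0 := by
    rw [← integral_condExp hm]
    refine integral_eq_zero_of_ae (h2.trans ?_)
    filter_upwards [h1] with ω hω
    simp [hω]
  exact h3

end CondE

/-! ### Commuting filtrations on a probability space -/

/-- Two commuting measure preserving maps together with a commuting two-parameter filtration which
they translate. -/
structure CommutingField {Ω : Type*} [m0 : MeasurableSpace Ω] (μ : Measure Ω) where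
  T₁ : Ω → Ω
  T₂ : Ω → Ω
  mp₁ : MeasurePreserving T₁ μ μ
  mp₂ : MeasurePreserving T₂ μ μ
  comm : Function.Commute T₁ T₂
  F : ℤ → ℤ → MeasurableSpace Ω
  F_le : ∀ a b, F a b ≤ m0
  F_mono : ∀ {a a' b b'}, a ≤ a' → b ≤ b' → F a b ≤ F a' b'
  comap₁ : ∀ a b, (F a b).comap T₁ = F (a + 1) b
  comap₂ : ∀ a b, (F a b).comap T₂ = F a (b + 1)
  commuting : IsCommuting μ F

namespace CommutingField

variable {Ω : Type*} [m0 : MeasurableSpace Ω] {μ : Measure Ω} [IsProbabilityMeasure μ]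
  (S : CommutingField μ)

lemma condE_condE {a b u v : ℤ} (h : u ≤ a) (x : Lp ℝ 2 μ) :
    condE μ (S.F_le u v) (condE μ (S.F_le a b) x)
      = condE μ (S.F_le u (min b v)) x := by
  refine Lp.ext ((coeFn_condE _ _).trans ((condExp_congr_ae (coeFn_condE _ _)).trans ?_))
  exact (S.commuting a b u v h x ((Lp.memLp x).integrable (by norm_num))).trans
    (coeFn_condE _ _).symm

/-- The associated system in the Hilbert space `L²`. -/
noncomputable def biShift : BiShift (Lp ℝ 2 μ) where
  U₁ := koopman S.T₁ S.mp₁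
  U₂ := koopman S.T₂ S.mp₂
  E a b := condE μ (S.F_le a b)
  norm_U₁ := norm_koopman S.mp₁
  norm_U₂ := norm_koopman S.mp₂
  U_comm := by
    ext1 x
    obtain ⟨g, hg, rfl⟩ : ∃ (g : Ω → ℝ) (hg : MemLp g 2 μ), x = hg.toLp g :=
      ⟨x, Lp.memLp x, (Lp.toLp_coeFn x _).symm⟩
    simp only [mul_apply_eq_comp, koopman_toLp]
    congr 1
    ext ω
    exact congrArg g (S.comm ω).symm
  E_symm a b x y := inner_condE _ x y
  E_E a b u v x := by
    rcases le_total a u with h | h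
    · rw [S.condE_condE h, min_eq_left h]
      exact congrArg (fun c => condE μ (S.F_le a c) x) (min_comm v b)
    -- The commuting hypothesis covers one order of the first indices only; the other order follows
    -- by taking adjoints.
    · refine ext_inner_right ℝ fun y => ?_
      rw [inner_condE, inner_condE, S.condE_condE h, ← inner_condE, min_eq_right h]
  U₁_E a b x := koopman_condE _ _ _ (S.comap₁ a b) x
  U₂_E a b x := koopman_condE _ _ _ (S.comap₂ a b) x

lemma comap_iterate₁ (a b : ℤ) (u : ℕ) : (S.F a b).comap S.T₁^[u] = S.F (a + u) b := by
  induction u with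
  | zero => simp
  | succ u ih =>
    rw [Function.iterate_succ, ← MeasurableSpace.comap_comp, ih, S.comap₁]
    push_cast; rw [add_assoc]

lemma comap_iterate₂ (a b : ℤ) (v : ℕ) : (S.F a b).comap S.T₂^[v] = S.F a (b + v) := by
  induction v with
  | zero => simp
  | succ u ih =>
    rw [Function.iterate_succ, ← MeasurableSpace.comap_comp, ih, S.comap₂]
    push_cast; rw [add_assoc]

/-- The translation by `(u, v)`. -/
def shift (u v : ℕ) (ω : Ω) : Ω := S.T₁^[u] (S.T₂^[v] ω)

lemma shift_comm (u v : ℕ) (ω : Ω) : S.T₂^[v] (S.T₁^[u] ω) = S.shift u v ω :=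
  (S.comm.iterate_iterate u v ω).symm

lemma mp_shift (u v : ℕ) : MeasurePreserving (S.shift u v) μ μ :=
  (S.mp₁.iterate u).comp (S.mp₂.iterate v)

lemma measurable_comp_shift {a b : ℤ} {g : Ω → ℝ} (hg : Measurable[S.F a b] g) {u v : ℕ}
    {a' b' : ℤ} (ha : a + u ≤ a') (hb : b + v ≤ b') :
    Measurable[S.F a' b'] fun ω => g (S.shift u v ω) := by
  have h1 : Measurable[S.F (a + u) b] (g ∘ S.T₁^[u]) := by
    rw [← S.comap_iterate₁]
    exact hg.comp fun s hs => ⟨s, hs, rfl⟩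
  have h2 : Measurable[S.F (a + u) (b + v)] ((g ∘ S.T₁^[u]) ∘ S.T₂^[v]) := by
    rw [← S.comap_iterate₂]
    exact h1.comp fun s hs => ⟨s, hs, rfl⟩
  exact h2.mono (S.F_mono ha hb) le_rfl

lemma toLp_comp_shift {g : Ω → ℝ} (hg : MemLp g 2 μ) (u v : ℕ) :
    (hg.comp_measurePreserving (S.mp_shift u v)).toLp (g ∘ S.shift u v)
      = (S.biShift.U₂ ^ v) ((S.biShift.U₁ ^ u) (hg.toLp g)) := by
  change _ = (koopman S.T₂ S.mp₂ ^ v) ((koopman S.T₁ S.mp₁ ^ u) (hg.toLp g))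
  rw [koopman_pow_toLp, koopman_pow_toLp]
  rfl

lemma rectSum_toLp_ae {g : Ω → ℝ} (hg : MemLp g 2 μ) (n m : ℕ) :
    ((S.biShift.rectSum n m (hg.toLp g) : Lp ℝ 2 μ) : Ω → ℝ) =ᵐ[μ]
      fun ω => ∑ v ∈ range m, ∑ u ∈ range n, g (S.shift u v ω) := by
  have e : S.biShift.rectSum n m (hg.toLp g) = ∑ v ∈ range m, ∑ u ∈ range n,
      (hg.comp_measurePreserving (S.mp_shift u v)).toLp (g ∘ S.shift u v) := by
    rw [BiShift.rectSum_apply', geomSum_apply]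
    refine Finset.sum_congr rfl fun v _ => ?_
    rw [geomSum_apply, map_sum]
    exact Finset.sum_congr rfl fun u _ => (S.toLp_comp_shift hg u v).symm
  rw [e]
  have h0 : ∀ᵐ ω ∂μ, ∀ v u : ℕ,
      ((hg.comp_measurePreserving (S.mp_shift u v)).toLp (g ∘ S.shift u v) : Ω → ℝ) ω
        = g (S.shift u v ω) :=
    ae_all_iff.2 fun v => ae_all_iff.2 fun u => MemLp.coeFn_toLp _
  have h1 : ∀ᵐ ω ∂μ, ∀ v : ℕ, ((∑ u ∈ range n,
      (hg.comp_measurePreserving (S.mp_shift u v)).toLp (g ∘ S.shift u v) : Lp ℝ 2 μ) : Ω → ℝ) ω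
        = ∑ u ∈ range n, g (S.shift u v ω) := by
    refine ae_all_iff.2 fun v => ?_
    filter_upwards [h0, Lp.coeFn_finsetSum (range n) fun u =>
      (hg.comp_measurePreserving (S.mp_shift u v)).toLp (g ∘ S.shift u v)] with ω h2 h3
    rw [h3, Finset.sum_apply]
    exact Finset.sum_congr rfl fun u _ => h2 v u
  filter_upwards [h1, Lp.coeFn_finsetSum (range m) fun v => ∑ u ∈ range n,
      (hg.comp_measurePreserving (S.mp_shift u v)).toLp (g ∘ S.shift u v)] with ω h2 h3
  rw [h3, Finset.sum_apply]
  exact Finset.sum_congr rfl fun v _ => h2 v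

/-! ### The central limit theorem for orthomartingale differences -/

section Ortho

variable {S} {D : Ω → ℝ} (hD : MemLp D 2 μ)

lemma norm_sq_toLp {g : Ω → ℝ} (hg : MemLp g 2 μ) : ‖hg.toLp g‖ ^ 2 = ∫ ω, g ω ^ 2 ∂μ := by
  rw [← real_inner_self_eq_norm_sq, MeasureTheory.L2.inner_def]
  refine integral_congr_ae ?_
  filter_upwards [hg.coeFn_toLp] with ω h
  rw [h]
  simp [sq]

/-- The second index `b` is arbitrary: the orthogonality in the first direction persists given
everything in the second. This lets two different columns share one filtration. -/
lemma integral_mul_shift_left (ho : S.biShift.IsOrthoDiff (hD.toLp D)) (u v : ℕ) (b : ℤ)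
    {φ : Ω → ℝ} (hφ : Measurable[S.F u b] φ) (hb : ∃ C, ∀ ω, |φ ω| ≤ C) :
    ∫ ω, φ ω * D (S.shift u v ω) ∂μ = 0 := by
  refine integral_mul_eq_zero_of_condE (S.F_le u b)
    (hD.comp_measurePreserving (S.mp_shift u v)) ?_ hφ hb
  rw [S.toLp_comp_shift hD]
  change S.biShift.E u b _ = 0
  have h1 := S.biShift.pow_U₁_E u 0 (b - v) (hD.toLp D)
  rw [ho.E_zero_left, map_zero, zero_add] at h1
  have h2 := S.biShift.pow_U₂_E v u (b - v) ((S.biShift.U₁ ^ u) (hD.toLp D))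
  rw [← h1, map_zero, sub_add_cancel] at h2
  exact h2.symm

lemma integral_mul_shift_right (ho : S.biShift.IsOrthoDiff (hD.toLp D)) (u v : ℕ) (a : ℤ)
    {φ : Ω → ℝ} (hφ : Measurable[S.F a v] φ) (hb : ∃ C, ∀ ω, |φ ω| ≤ C) :
    ∫ ω, φ ω * D (S.shift u v ω) ∂μ = 0 := by
  refine integral_mul_eq_zero_of_condE (S.F_le a v)
    (hD.comp_measurePreserving (S.mp_shift u v)) ?_ hφ hb
  rw [S.toLp_comp_shift hD]
  change S.biShift.E a v _ = 0
  have h1 := S.biShift.pow_U₁_E u (a - u) 0 (hD.toLp D)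
  rw [ho.E_zero_right, map_zero, sub_add_cancel] at h1
  have h2 := S.biShift.pow_U₂_E v a 0 ((S.biShift.U₁ ^ u) (hD.toLp D))
  rw [← h1, map_zero, zero_add] at h2
  exact h2.symm

lemma integrable_bdd_mul {g φ : Ω → ℝ} (hg : MemLp g 2 μ) (hφ : Measurable φ)
    (hb : ∃ C, ∀ ω, |φ ω| ≤ C) : Integrable (fun ω => φ ω * g ω) μ := by
  obtain ⟨C, hC⟩ := hb
  exact (hg.integrable (by norm_num)).bdd_mul (c := C) hφ.aestronglyMeasurable
    (Eventually.of_forall hC)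

/-- The combination `D + e D ∘ T₂ᵏ⁺¹` of two columns. -/
def twoCol (S : CommutingField μ) (D : Ω → ℝ) (e : ℝ) (k : ℕ) (ω : Ω) : ℝ :=
  D ω + e * D (S.T₂^[k + 1] ω)

lemma twoCol_iterate (e : ℝ) (k u : ℕ) (ω : Ω) : twoCol S D e k (S.T₁^[u] ω) =
    D (S.shift u 0 ω) + e * D (S.shift u (k + 1) ω) := by
  rw [twoCol, S.shift_comm]; rfl

/-- A Cramér–Wold device: for each `e` the combination is again a martingale difference sequence
along `T₁`. The index `k + 2` is the least making both columns measurable, the translate by `k + 1`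
of an `F 1 1`-measurable function. -/
lemma isMartingaleDiff_twoCol (hm : Measurable[S.F 1 1] D)
    (ho : S.biShift.IsOrthoDiff (hD.toLp D)) (e : ℝ) (k : ℕ) :
    IsMartingaleDiff μ (fun u : ℕ => S.F u (k + 2)) fun u ω => twoCol S D e k (S.T₁^[u] ω) where
  le u := S.F_le _ _
  mono u u' h := S.F_mono (by exact_mod_cast h) le_rfl
  meas u := by
    simp only [twoCol_iterate]
    exact (S.measurable_comp_shift hm (by push_cast; omega) (by push_cast; omega)).add
      ((S.measurable_comp_shift hm (by push_cast; omega) (by push_cast; omega)).const_mul e)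
  memLp u := by
    simp only [twoCol_iterate]
    exact (hD.comp_measurePreserving (S.mp_shift u 0)).add
      ((hD.comp_measurePreserving (S.mp_shift u (k + 1))).const_mul e)
  orth u φ hφ hb := by
    have hφ' : Measurable φ := hφ.mono (S.F_le _ _) le_rfl
    simp only [twoCol_iterate, mul_add, mul_left_comm _ e]
    rw [integral_add (integrable_bdd_mul (g := fun ω => D (S.shift u 0 ω))
      (hD.comp_measurePreserving (S.mp_shift u 0)) hφ' hb)
      ((integrable_bdd_mul (g := fun ω => D (S.shift u (k + 1) ω))
      (hD.comp_measurePreserving (S.mp_shift u (k + 1))) hφ' hb).const_mul e),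
      integral_const_mul, integral_mul_shift_left hD ho u 0 _ hφ hb,
      integral_mul_shift_left hD ho u (k + 1) _ hφ hb, mul_zero, add_zero]

lemma integral_twoCol_sq (ho : S.biShift.IsOrthoDiff (hD.toLp D)) (e : ℝ) (k : ℕ) :
    ∫ ω, twoCol S D e k ω ^ 2 ∂μ = (1 + e ^ 2) * ∫ ω, D ω ^ 2 ∂μ := by
  have hDk : MemLp (D ∘ S.shift 0 (k + 1)) 2 μ := hD.comp_measurePreserving (S.mp_shift 0 (k + 1))
  have h2 : MemLp (D + e • (D ∘ S.shift 0 (k + 1))) 2 μ := hD.add (hDk.const_smul e)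
  have h3 : ∫ ω, twoCol S D e k ω ^ 2 ∂μ = ‖h2.toLp _‖ ^ 2 := (norm_sq_toLp h2).symm
  have h4 : h2.toLp _ = hD.toLp D + e • (S.biShift.U₂ ^ (k + 1)) (hD.toLp D) := by
    have := S.toLp_comp_shift hD 0 (k + 1)
    rw [pow_zero, one_apply_eq_self] at this
    rw [← this]
    rfl
  have h5 : ⟪hD.toLp D, (S.biShift.U₂ ^ (k + 1)) (hD.toLp D)⟫_ℝ = 0 := by
    have h6 := S.biShift.pow_U₂_E (k + 1) 1 0 (hD.toLp D)
    rw [ho.right, map_zero, zero_add] at h6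
    have h7 := S.biShift.E_of_le (u := 1) (v := (k + 1 : ℕ)) ho.adapted le_rfl
      (by push_cast; omega)
    rw [← h7, S.biShift.E_symm, h7, ← h6, inner_zero_right]
  rw [h3, h4, norm_add_sq_real, inner_smul_right, h5, norm_smul, norm_pow_apply S.biShift.norm_U₂,
    mul_pow, Real.norm_eq_abs, sq_abs, norm_sq_toLp]
  ring

lemma tendsto_integral_exp_twoCol (hT : Ergodic S.T₁ μ) (hm : Measurable[S.F 1 1] D)
    (ho : S.biShift.IsOrthoDiff (hD.toLp D)) (e : ℝ) (k : ℕ) (s : ℝ) :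
    Tendsto (fun n : ℕ => ∫ ω, Real.cos
      (s * ((√n)⁻¹ * ∑ u ∈ range n, twoCol S D e k (S.T₁^[u] ω))) ∂μ) atTop
      (𝓝 (Real.exp (-(s ^ 2 * ((1 + e ^ 2) * ∫ ω, D ω ^ 2 ∂μ)) / 2))) := by
  have hM := isMartingaleDiff_twoCol hD hm ho e k
  have h := tendsto_integral_exp_of_ergodic hT hM s
  rw [integral_twoCol_sq hD ho] at h
  have h2 := (Complex.continuous_re.tendsto _).comp h
  rw [Complex.ofReal_re] at h2
  refine h2.congr fun n => ?_
  have hmeas : Measurable fun ω => s * ((√n)⁻¹ * ∑ u ∈ range n, twoCol S D e k (S.T₁^[u] ω)) :=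
    ((Finset.measurable_fun_sum _ fun u _ => hM.measurable u).const_mul _).const_mul s
  have hint : Integrable (fun ω => Complex.exp
      ((s * ((√n)⁻¹ * ∑ u ∈ range n, twoCol S D e k (S.T₁^[u] ω)) : ℝ) * Complex.I)) μ := by
    refine Integrable.of_bound (C := 1) ?_ (Eventually.of_forall fun ω => ?_)
    · exact (Complex.measurable_exp.comp
        ((Complex.measurable_ofReal.comp hmeas).mul_const _)).aestronglyMeasurable
    · rw [Complex.norm_exp_ofReal_mul_I]
  have := integral_re hint
  simp only [RCLike.re_eq_complex_re, Complex.exp_ofReal_mul_I_re] at this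
  exact this.symm

/-- The normalized row sums. -/
noncomputable def rowSum (S : CommutingField μ) (D : Ω → ℝ) (n : ℕ) (ω : Ω) : ℝ :=
  (√n)⁻¹ * ∑ u ∈ range n, D (S.T₁^[u] ω)

lemma rowSum_iterate (n v : ℕ) (ω : Ω) : rowSum S D n (S.T₂^[v] ω) =
    (√n)⁻¹ * ∑ u ∈ range n, D (S.shift u v ω) := rfl

lemma memLp_rowSum_iterate (hD : MemLp D 2 μ) (n v : ℕ) : MemLp (fun ω => rowSum S D n (S.T₂^[v] ω)) 2 μ := by
  simp only [rowSum_iterate]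
  exact (memLp_finsetSum (range n) (f := fun u ω => D (S.shift u v ω)) fun u _ => hD.comp_measurePreserving (S.mp_shift u v)).const_mul _

lemma isMartingaleDiff_rowSum (hm : Measurable[S.F 1 1] D)
    (ho : S.biShift.IsOrthoDiff (hD.toLp D)) (n : ℕ) :
    IsMartingaleDiff μ (fun v : ℕ => S.F n v) fun v ω => rowSum S D n (S.T₂^[v] ω) where
  le v := S.F_le _ _
  mono v v' h := S.F_mono le_rfl (by exact_mod_cast h)
  meas v := by
    simp only [rowSum_iterate]
    refine (Finset.measurable_fun_sum _ fun u hu => ?_).const_mul _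
    have := Finset.mem_range.1 hu
    exact S.measurable_comp_shift hm (by omega) (by push_cast; omega)
  memLp v := memLp_rowSum_iterate hD n v
  orth v φ hφ hb := by
    have hφ' : Measurable φ := hφ.mono (S.F_le _ _) le_rfl
    simp only [rowSum_iterate, mul_left_comm _ (√(n : ℝ))⁻¹]
    rw [integral_const_mul]
    simp only [Finset.mul_sum]
    rw [integral_finsetSum _ fun u _ =>
      integrable_bdd_mul (g := fun ω => D (S.shift u v ω)) (hD.comp_measurePreserving (S.mp_shift u v)) hφ' hb]
    rw [Finset.sum_eq_zero fun u _ => integral_mul_shift_right hD ho u v n hφ hb, mul_zero]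

lemma isAsympGaussian_rowSum (hT : Ergodic S.T₁ μ) (hm : Measurable[S.F 1 1] D)
    (ho : S.biShift.IsOrthoDiff (hD.toLp D)) :
    IsAsympGaussian μ S.T₂ (rowSum S D) (∫ ω, D ω ^ 2 ∂μ) where
  mp := S.mp₂
  meas n := (isMartingaleDiff_rowSum hD hm ho n).measurable 0
  memLp n := memLp_rowSum_iterate hD n 0
  var_le n := by
    have h1 : MemLp (rowSum S D n) 2 μ := memLp_rowSum_iterate hD n 0
    have h2 : h1.toLp _ = (√n)⁻¹ • geomSum S.biShift.U₁ n (hD.toLp D) := by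
      have h3 := S.rectSum_toLp_ae hD n 1
      rw [BiShift.rectSum_apply, geomSum_one, one_apply_eq_self] at h3
      refine Lp.ext ?_
      filter_upwards [h1.coeFn_toLp, h3, Lp.coeFn_smul (√(n : ℝ))⁻¹
        (geomSum S.biShift.U₁ n (hD.toLp D))] with ω h4 h5 h6
      rw [h4, h6, Pi.smul_apply, h5]
      simp [rowSum, shift]
    rw [← norm_sq_toLp h1, h2, norm_smul, S.biShift.norm_geomSum_U₁_of_diff ho.adapted ho.left,
      ← norm_sq_toLp hD]
    rcases Nat.eq_zero_or_pos n with rfl | hn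
    · simp
    · have : 0 < √(n : ℝ) := by positivity
      rw [norm_inv, Real.norm_of_nonneg this.le, inv_mul_cancel_left₀ this.ne']
  cos_tendsto s := by
    have := tendsto_integral_exp_twoCol hD hT hm ho 0 0 s
    simpa [twoCol, rowSum] using this
  cos_mul_tendsto s k := by
    -- The product of cosines is half the sum of the cosines of `a + b` and `a - b`, that is `e = 1`
    -- and `e = -1`. By orthogonality of the columns both limits have variance `2 ∫ D²`, which gives
    -- the square of the one-point limit.
    have h1 := tendsto_integral_exp_twoCol hD hT hm ho 1 k s
    have h2 := tendsto_integral_exp_twoCol hD hT hm ho (-1) k s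
    have h3 := (h1.add h2).const_mul (1 / 2)
    have e0 : ∀ (e : ℝ) (n : ℕ) ω,
        s * ((√n)⁻¹ * ∑ u ∈ range n, twoCol S D e k (S.T₁^[u] ω)) =
          s * rowSum S D n ω + e * (s * rowSum S D n (S.T₂^[k + 1] ω)) := by
      intro e n ω
      simp only [twoCol_iterate, Finset.sum_add_distrib, ← Finset.mul_sum, rowSum]
      simp only [shift, Function.iterate_zero, id_eq]
      ring
    have hme := fun n v => (isMartingaleDiff_rowSum hD hm ho n).measurable v
    have hmc : ∀ (e : ℝ) n, Integrable (fun ω => Real.cos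
        (s * rowSum S D n ω + e * (s * rowSum S D n (S.T₂^[k + 1] ω)))) μ := fun e n =>
      Integrable.of_bound (C := 1) (Real.measurable_cos.comp (((hme n 0).const_mul s).add
        (((hme n (k + 1)).const_mul s).const_mul e))).aestronglyMeasurable
        (Eventually.of_forall fun ω => Real.abs_cos_le_one _)
    have e1 : 1 / 2 * (Real.exp (-(s ^ 2 * ((1 + 1 ^ 2) * ∫ ω, D ω ^ 2 ∂μ)) / 2) +
        Real.exp (-(s ^ 2 * ((1 + (-1) ^ 2) * ∫ ω, D ω ^ 2 ∂μ)) / 2)) =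
        Real.exp (-(s ^ 2 * ∫ ω, D ω ^ 2 ∂μ) / 2) ^ 2 := by
      rw [← Real.exp_nat_mul]
      ring_nf
    rw [e1] at h3
    refine h3.congr fun n => ?_
    simp only [e0]
    rw [← integral_add (hmc 1 n) (hmc (-1) n), ← integral_const_mul]
    congr 1 with ω
    rw [one_mul, neg_one_mul, Real.cos_add, ← sub_eq_add_neg, Real.cos_sub]
    ring

/-- The central limit theorem for orthomartingales. -/
theorem tendsto_integral_exp_of_isOrthoDiff (hT : Ergodic S.T₁ μ) (hm : Measurable[S.F 1 1] D)
    (ho : S.biShift.IsOrthoDiff (hD.toLp D)) (t : ℝ) :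
    Tendsto (fun p : ℕ × ℕ => ∫ ω, Complex.exp
      ((t * ((√p.1 * √p.2)⁻¹ * (S.biShift.rectSum p.1 p.2 (hD.toLp D) : Lp ℝ 2 μ) ω) : ℝ)
        * Complex.I) ∂μ)
      (comap (fun p : ℕ × ℕ => min p.1 p.2) atTop)
      (𝓝 (Real.exp (-(t ^ 2 * ∫ ω, D ω ^ 2 ∂μ) / 2) : ℝ)) := by
  refine ((isAsympGaussian_rowSum hD hT hm ho).tendsto_integral_exp
    (fun n => isMartingaleDiff_rowSum hD hm ho n) t).congr fun p => ?_
  refine integral_congr_ae ?_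
  filter_upwards [S.rectSum_toLp_ae hD p.1 p.2] with ω h
  rw [h]
  simp only [rowSum_iterate, ← Finset.mul_sum]
  rw [mul_inv, mul_assoc, mul_left_comm (√(p.2 : ℝ))⁻¹]

end Ortho

end CommutingField

/-! ### From the Maxwell–Woodroofe condition to dyadic summability -/

/-- The weight `n^{-3/2}`. -/
noncomputable def mwWeight (n : ℕ) : ℝ≥0∞ := ENNReal.ofReal (1 / (n : ℝ) ^ (3 / 2 : ℝ))

lemma mwWeight_zero : mwWeight 0 = 0 := by
  rw [mwWeight, Nat.cast_zero, Real.zero_rpow (by norm_num), div_zero, ENNReal.ofReal_zero]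

lemma rpow_three_halves {y : ℝ} (hy : 0 ≤ y) : y ^ (3 / 2 : ℝ) = y * √y := by
  rcases hy.eq_or_lt with rfl | hy
  · rw [Real.zero_rpow (by norm_num), zero_mul]
  · rw [show (3 / 2 : ℝ) = 1 + 1 / 2 by norm_num, Real.rpow_add hy, Real.rpow_one,
      Real.sqrt_eq_rpow]

lemma inv_sqrt_two_pow_le_mwWeight {k n : ℕ} (h1 : 2 ^ k ≤ n) (h2 : n ≤ 2 ^ (k + 2)) :
    ENNReal.ofReal (1 / √2 ^ k) ≤ 8 * 2 ^ k * mwWeight n := by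
  have hn : (0 : ℝ) < n := by exact_mod_cast lt_of_lt_of_le (by positivity) h1
  rw [mwWeight, show (8 * 2 ^ k : ℝ≥0∞) = ENNReal.ofReal (8 * 2 ^ k) by
    rw [ENNReal.ofReal_mul (by norm_num), ENNReal.ofReal_pow (by norm_num)]; norm_num,
    ← ENNReal.ofReal_mul (by positivity)]
  refine ENNReal.ofReal_le_ofReal ?_
  rw [mul_one_div, div_le_div_iff₀ (by positivity) (by positivity), one_mul,
    rpow_three_halves hn.le]
  have h3 : (n : ℝ) ≤ 4 * 2 ^ k := by
    have : (n : ℝ) ≤ 2 ^ (k + 2) := by exact_mod_cast h2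
    rw [pow_add] at this; linarith
  have h4 : √(n : ℝ) ≤ 2 * √2 ^ k := by
    rw [Real.sqrt_le_left (by positivity), mul_pow, ← pow_mul, mul_comm k, pow_mul,
      Real.sq_sqrt (by norm_num)]
    linarith
  calc (n : ℝ) * √n ≤ (4 * 2 ^ k) * (2 * √2 ^ k) := by gcongr
    _ = _ := by ring

lemma tsum_dyadic_indicator_le (n : ℕ) :
    ∑' k : ℕ, (if n ∈ Finset.Ico (2 ^ k) (2 ^ (k + 2)) then (1 : ℝ≥0∞) else 0) ≤ 2 := by
  rw [tsum_eq_sum (s := {Nat.log 2 n, Nat.log 2 n - 1})]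
  · refine (Finset.sum_le_card_nsmul _ _ 1 fun k _ => by split_ifs <;> simp).trans ?_
    rw [nsmul_one]
    exact_mod_cast Finset.card_le_two
  · intro k hk
    refine if_neg fun h => hk ?_
    rw [Finset.mem_Ico] at h
    have hn : n ≠ 0 := (lt_of_lt_of_le (by positivity) h.1).ne'
    have h1 := Nat.le_log_of_pow_le one_lt_two h.1
    have h2 := Nat.log_lt_of_lt_pow hn h.2
    rw [Finset.mem_insert, Finset.mem_singleton]
    omega

/-- `V` need not be monotone, but `V (2 ^ k) ≤ V (n + 2 ^ k) + V n`. Summing over `n` in `[2 ^ k, 2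
^ (k + 1))` spreads `V (2 ^ k)` over `[2 ^ k, 3 * 2 ^ k)`, where the weights are comparable. The
constant is 8 from the weights times 2, as each integer lies in at most two of the blocks. -/
lemma tsum_dyadic_le {V : ℕ → ℝ≥0∞} (hV : ∀ m n, V m ≤ V (m + n) + V n) :
    ∑' k : ℕ, ENNReal.ofReal (1 / √2 ^ k) * V (2 ^ k) ≤
      16 * ∑' n : ℕ, mwWeight (n + 1) * V (n + 1) := by
  have h1 (k : ℕ) : ENNReal.ofReal (1 / √2 ^ k) * V (2 ^ k) ≤
      8 * ∑ n ∈ Finset.Ico (2 ^ k) (2 ^ (k + 2)), mwWeight n * V n := by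
    have e : 2 ^ k * V (2 ^ k) ≤ ∑ n ∈ Finset.Ico (2 ^ k) (2 ^ (k + 2)), V n := by
      calc 2 ^ k * V (2 ^ k) = ∑ n ∈ Finset.Ico (2 ^ k) (2 ^ k + 2 ^ k), V (2 ^ k) := by
            rw [Finset.sum_const, Nat.card_Ico, Nat.add_sub_cancel, nsmul_eq_mul]; push_cast; rfl
        _ ≤ ∑ n ∈ Finset.Ico (2 ^ k) (2 ^ k + 2 ^ k), (V (n + 2 ^ k) + V n) := by
            refine Finset.sum_le_sum fun n _ => ?_
            rw [add_comm n]; exact hV _ _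
        _ = ∑ n ∈ Finset.Ico (2 ^ k) (2 ^ k + 2 ^ k + 2 ^ k), V n := by
            rw [Finset.sum_add_distrib, Finset.sum_Ico_add', add_comm,
              Finset.sum_Ico_consecutive _ (Nat.le_add_right _ _) (Nat.le_add_right _ _)]
        _ ≤ _ := by
            refine Finset.sum_le_sum_of_subset (Finset.Ico_subset_Ico_right ?_)
            rw [pow_add]; omega
    have h2k : (2 ^ k : ℝ≥0∞) ≠ 0 := by positivity
    have h2k' : (2 ^ k : ℝ≥0∞) ≠ ∞ := by simp
    rw [← ENNReal.mul_le_mul_iff_right h2k h2k', ← mul_assoc, mul_comm (2 ^ k), mul_assoc]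
    refine (mul_le_mul_right e _).trans ?_
    rw [Finset.mul_sum, ← mul_assoc, Finset.mul_sum]
    refine Finset.sum_le_sum fun n hn => ?_
    rw [Finset.mem_Ico] at hn
    rw [← mul_assoc, mul_comm (2 ^ k) (8 : ℝ≥0∞)]
    exact mul_le_mul_left (inv_sqrt_two_pow_le_mwWeight hn.1 hn.2.le) _
  calc _ ≤ ∑' k : ℕ, 8 * ∑ n ∈ Finset.Ico (2 ^ k) (2 ^ (k + 2)), mwWeight n * V n :=
        ENNReal.tsum_le_tsum h1
    _ = 8 * ∑' k : ℕ, ∑' n : ℕ, mwWeight n * V n *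
          (if n ∈ Finset.Ico (2 ^ k) (2 ^ (k + 2)) then (1 : ℝ≥0∞) else 0) := by
        rw [ENNReal.tsum_mul_left]
        congr 1
        refine tsum_congr fun k => ?_
        rw [tsum_eq_sum (s := Finset.Ico (2 ^ k) (2 ^ (k + 2)))]
        · exact Finset.sum_congr rfl fun n hn => by rw [if_pos hn, mul_one]
        · intro n hn; rw [if_neg hn, mul_zero]
    _ = 8 * ∑' n : ℕ, mwWeight n * V n * ∑' k : ℕ,
          (if n ∈ Finset.Ico (2 ^ k) (2 ^ (k + 2)) then (1 : ℝ≥0∞) else 0) := by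
        rw [ENNReal.tsum_comm]
        simp_rw [ENNReal.tsum_mul_left]
    _ ≤ 8 * ∑' n : ℕ, mwWeight n * V n * 2 := by
        gcongr with n; exact tsum_dyadic_indicator_le n
    _ = 16 * ∑' n : ℕ, mwWeight (n + 1) * V (n + 1) := by
        rw [ENNReal.tsum_mul_right, tsum_eq_zero_add' ENNReal.summable, mwWeight_zero, zero_mul,
          zero_add, mul_comm _ (2 : ℝ≥0∞), ← mul_assoc]
        norm_num

variable {H : Type*} [NormedAddCommGroup H] [InnerProductSpace ℝ H]

lemma enorm_geomSum_apply_le_add {P : H →L[ℝ] H} (hP : ∀ x, ‖P x‖ ≤ ‖x‖) (m n : ℕ) (x : H) :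
    ‖geomSum P m x‖ₑ ≤ ‖geomSum P (m + n) x‖ₑ + ‖geomSum P n x‖ₑ := by
  simp only [← ofReal_norm]
  rw [← ENNReal.ofReal_add (norm_nonneg _) (norm_nonneg _)]
  exact ENNReal.ofReal_le_ofReal (norm_geomSum_apply_le_add hP m n x)

/-- The one-parameter comparison is applied in each direction in turn, the other index being frozen;
commutation allows either sum to be taken outermost. -/
lemma summable_dyadicTerm {P Q : H →L[ℝ] H} (hPQ : Commute P Q) (hP : ∀ x, ‖P x‖ ≤ ‖x‖)
    (hQ : ∀ x, ‖Q x‖ ≤ ‖x‖) {x : H}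
    (h : ∑' (j : ℕ) (k : ℕ), mwWeight (j + 1) * mwWeight (k + 1) *
      ‖geomSum P (j + 1) (geomSum Q (k + 1) x)‖ₑ < ∞) :
    Summable (dyadicTerm P Q x) := by
  have hc (j k : ℕ) : geomSum P j (geomSum Q k x) = geomSum Q k (geomSum P j x) :=
    commute_apply (geomSum_commute (geomSum_commute hPQ j).symm k).symm x
  have e1 (p : ℕ × ℕ) : dyadicTerm P Q x p = (ENNReal.ofReal (1 / √2 ^ p.1) *
      (ENNReal.ofReal (1 / √2 ^ p.2) *
        ‖geomSum P (2 ^ p.1) (geomSum Q (2 ^ p.2) x)‖ₑ)).toReal := by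
    rw [ENNReal.toReal_mul, ENNReal.toReal_mul, ENNReal.toReal_ofReal (by positivity),
      ENNReal.toReal_ofReal (by positivity), toReal_enorm, dyadicTerm]
    field_simp
  rw [show dyadicTerm P Q x = _ from funext e1]
  refine ENNReal.summable_toReal (ne_of_lt ?_)
  rw [ENNReal.tsum_prod (f := fun p q : ℕ => ENNReal.ofReal (1 / √2 ^ p) *
      (ENNReal.ofReal (1 / √2 ^ q) * ‖geomSum P (2 ^ p) (geomSum Q (2 ^ q) x)‖ₑ))]
  calc _ = ∑' p : ℕ, ENNReal.ofReal (1 / √2 ^ p) * ∑' q : ℕ,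
        ENNReal.ofReal (1 / √2 ^ q) * ‖geomSum P (2 ^ p) (geomSum Q (2 ^ q) x)‖ₑ := by
        simp_rw [ENNReal.tsum_mul_left]
    _ ≤ ∑' p : ℕ, ENNReal.ofReal (1 / √2 ^ p) * (16 * ∑' k : ℕ,
        mwWeight (k + 1) * ‖geomSum P (2 ^ p) (geomSum Q (k + 1) x)‖ₑ) := by
        gcongr with p
        refine tsum_dyadic_le (V := fun k => ‖geomSum P (2 ^ p) (geomSum Q k x)‖ₑ) fun m n => ?_
        simp only [hc]
        exact enorm_geomSum_apply_le_add hQ m n _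
    _ = 16 * ∑' k : ℕ, mwWeight (k + 1) * ∑' p : ℕ,
        ENNReal.ofReal (1 / √2 ^ p) * ‖geomSum P (2 ^ p) (geomSum Q (k + 1) x)‖ₑ := by
        simp_rw [← ENNReal.tsum_mul_left]
        rw [ENNReal.tsum_comm]
        exact tsum_congr fun k => tsum_congr fun p => by ring
    _ ≤ 16 * ∑' k : ℕ, mwWeight (k + 1) * (16 * ∑' j : ℕ,
        mwWeight (j + 1) * ‖geomSum P (j + 1) (geomSum Q (k + 1) x)‖ₑ) := by
        gcongr with k
        exact tsum_dyadic_le fun m n => enorm_geomSum_apply_le_add hP m n _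
    _ = 16 * (16 * ∑' (j : ℕ) (k : ℕ), mwWeight (j + 1) * mwWeight (k + 1) *
      ‖geomSum P (j + 1) (geomSum Q (k + 1) x)‖ₑ) := by
        simp_rw [← ENNReal.tsum_mul_left]
        rw [ENNReal.tsum_comm]
        exact tsum_congr fun k => tsum_congr fun p => by ring
    _ < ∞ := ENNReal.mul_lt_top (by norm_num) (ENNReal.mul_lt_top (by norm_num) h)

/-! ### Stability of characteristic functions in `L²` -/

section CharLp

variable {Ω : Type*} [m0 : MeasurableSpace Ω] {μ : Measure Ω} [IsProbabilityMeasure μ]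

lemma integrable_exp_ofReal_mul_I {y : Ω → ℝ} (hy : AEStronglyMeasurable y μ) (t : ℝ) :
    Integrable (fun ω => Complex.exp ((t * y ω : ℝ) * Complex.I)) μ := by
  refine Integrable.of_bound (C := 1) ?_ (Eventually.of_forall fun ω =>
    (Complex.norm_exp_ofReal_mul_I _).le)
  exact (by fun_prop : Continuous fun z : ℝ => Complex.exp
    ((t * z : ℝ) * Complex.I)).comp_aestronglyMeasurable hy

lemma norm_exp_ofReal_mul_I_sub_le (a b : ℝ) :
    ‖Complex.exp (a * Complex.I) - Complex.exp (b * Complex.I)‖ ≤ |a - b| := by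
  have h : Complex.exp (a * Complex.I) - Complex.exp (b * Complex.I) =
      Complex.exp (b * Complex.I) * (Complex.exp (Complex.I * (a - b : ℝ)) - 1) := by
    rw [mul_sub, mul_one, ← Complex.exp_add]
    congr 2
    push_cast; ring
  rw [h, norm_mul, Complex.norm_exp_ofReal_mul_I, one_mul]
  exact Real.norm_exp_I_mul_ofReal_sub_one_le

lemma norm_integral_exp_sub_le (y z : Lp ℝ 2 μ) (t : ℝ) :
    ‖∫ ω, Complex.exp ((t * y ω : ℝ) * Complex.I) ∂μ -
      ∫ ω, Complex.exp ((t * z ω : ℝ) * Complex.I) ∂μ‖ ≤ |t| * ‖y - z‖ := by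
  rw [← integral_sub (integrable_exp_ofReal_mul_I (Lp.aestronglyMeasurable y) t)
    (integrable_exp_ofReal_mul_I (Lp.aestronglyMeasurable z) t)]
  refine (norm_integral_le_integral_norm _).trans ?_
  refine le_trans ?_ (mul_le_mul_of_nonneg_left (integral_abs_le_norm_Lp (y - z)) (abs_nonneg t))
  rw [← integral_const_mul]
  refine integral_mono_of_nonneg (Eventually.of_forall fun ω => norm_nonneg _)
    (((Lp.memLp (y - z)).integrable (by norm_num)).abs.const_mul _) ?_
  filter_upwards [Lp.coeFn_sub y z] with ω h
  rw [h, Pi.sub_apply, ← abs_mul, mul_sub]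
  exact norm_exp_ofReal_mul_I_sub_le _ _

end CharLp

/-! ### The central limit theorem in `L²` -/

/-- The filter of pairs both of whose entries tend to infinity. -/
def minAtTop : Filter (ℕ × ℕ) := comap (fun p : ℕ × ℕ => min p.1 p.2) atTop

lemma eventually_minAtTop {P : ℕ × ℕ → Prop} (N : ℕ)
    (h : ∀ n m : ℕ, N ≤ n → N ≤ m → P (n, m)) : ∀ᶠ p in minAtTop, P p := by
  refine Eventually.mono (tendsto_comap.eventually (eventually_ge_atTop N)) fun p hp => ?_
  exact h p.1 p.2 (hp.trans (min_le_left _ _)) (hp.trans (min_le_right _ _))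

instance neBot_minAtTop : NeBot minAtTop := by
  refine comap_neBot fun s hs => ?_
  obtain ⟨n, hn⟩ := (atTop.nonempty_of_mem hs)
  exact ⟨(n, n), by simpa using hn⟩

namespace BiShift

variable {H : Type*} [NormedAddCommGroup H] [InnerProductSpace ℝ H] (B : BiShift H)

/-- The normalized rectangular sums. -/
noncomputable def normSum (p : ℕ × ℕ) (x : H) : H := (√p.1 * √p.2)⁻¹ • B.rectSum p.1 p.2 x

lemma exists_eventually_norm_normSum_sub_le {x : H} (hx : B.E 0 0 x = x)
    (hs : Summable (dyadicTerm B.Q₁ B.Q₂ x)) {ε : ℝ} (hε : 0 < ε) :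
    ∃ D, B.IsOrthoDiff D ∧ ∀ᶠ p in minAtTop, ‖B.normSum p D‖ = ‖D‖ ∧
      ‖B.normSum p x - B.normSum p D‖ ≤ ε := by
  obtain ⟨D, hD, C, hC⟩ := B.exists_isOrthoDiff hx hs (half_pos hε)
  -- Beyond this threshold each of `|C|`, `|C| √n`, `|C| √m` is at most `(ε / 6) √n √m`; the
  -- remaining `ε / 2` comes from the approximation.
  obtain ⟨N, hN⟩ := exists_nat_gt ((6 * |C| / ε) ^ 2)
  refine ⟨D, hD, eventually_minAtTop (max N 1) fun n m hn hm => ?_⟩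
  have key {k : ℕ} (hk : max N 1 ≤ k) : 1 ≤ √(k : ℝ) ∧ 6 * |C| ≤ ε * √k := by
    constructor
    · rw [Real.one_le_sqrt]; exact_mod_cast (le_max_right _ _).trans hk
    · rw [mul_comm ε, ← div_le_iff₀ hε]
      refine Real.le_sqrt_of_sq_le (hN.le.trans ?_)
      exact_mod_cast (le_max_left _ _).trans hk
  obtain ⟨n1, n2⟩ := key hn
  obtain ⟨m1, m2⟩ := key hm
  have hpos : 0 < √(n : ℝ) * √(m : ℝ) := by positivity
  constructor
  · rw [normSum, norm_smul, hD.norm_rectSum, norm_inv, Real.norm_of_nonneg hpos.le,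
      inv_mul_cancel_left₀ hpos.ne']
  · rw [normSum, normSum, ← smul_sub, ← map_sub, norm_smul, norm_inv, Real.norm_of_nonneg hpos.le,
      inv_mul_le_iff₀ hpos]
    refine (hC n m).trans ?_
    have h1 : C * (1 + √n + √m) ≤ |C| * (1 + √n + √m) :=
      mul_le_mul_of_nonneg_right (le_abs_self C) (by positivity)
    have h2 : 6 * |C| * √n ≤ ε * (√n * √m) := by nlinarith
    have h3 : 6 * |C| * √m ≤ ε * (√n * √m) := by nlinarith
    have h4 : 6 * |C| ≤ 6 * |C| * √n := le_mul_of_one_le_right (by positivity) n1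
    linarith

/-- The normalized sums of `D` have norm exactly `‖D‖` as soon as both lengths are positive, so the
norms for `x` are eventually within `ε / 3` of a constant. The Cauchy criterion gives a limit
without any limiting `D`. -/
lemma exists_tendsto_norm_normSum {x : H} (hx : B.E 0 0 x = x)
    (hs : Summable (dyadicTerm B.Q₁ B.Q₂ x)) :
    ∃ c : ℝ, Tendsto (fun p => ‖B.normSum p x‖) minAtTop (𝓝 c) := by
  rw [← cauchy_map_iff_exists_tendsto, Metric.cauchy_iff]
  refine ⟨inferInstance, fun ε hε => ?_⟩
  obtain ⟨D, -, h⟩ := B.exists_eventually_norm_normSum_sub_le hx hs (ε := ε / 3) (by positivity)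
  refine ⟨Metric.closedBall ‖D‖ (ε / 3), ?_, fun a ha b hb => ?_⟩
  · rw [mem_map]
    filter_upwards [h] with p hp
    rw [Set.mem_preimage, Metric.mem_closedBall, Real.dist_eq, ← hp.1]
    exact (abs_norm_sub_norm_le _ _).trans hp.2
  · rw [Metric.mem_closedBall] at ha hb
    linarith [dist_triangle_right a b ‖D‖]

end BiShift

namespace CommutingField

variable {Ω : Type*} [m0 : MeasurableSpace Ω] {μ : Measure Ω} [IsProbabilityMeasure μ]
  (S : CommutingField μ)

lemma tendsto_integral_exp_normSum_of_isOrthoDiff (hT : Ergodic S.T₁ μ) {D : Lp ℝ 2 μ}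
    (ho : S.biShift.IsOrthoDiff D) (t : ℝ) :
    Tendsto (fun p : ℕ × ℕ => ∫ ω, Complex.exp
      ((t * (S.biShift.normSum p D : Lp ℝ 2 μ) ω : ℝ) * Complex.I) ∂μ) minAtTop
      (𝓝 (Real.exp (-(t ^ 2 * ‖D‖ ^ 2) / 2) : ℝ)) := by
  -- The martingale arguments need a function that is `F 1 1`-measurable, not merely almost
  -- everywhere equal to one; the conditional expectation provides it.
  obtain ⟨g, hg, hgm, rfl⟩ : ∃ (g : Ω → ℝ) (hg : MemLp g 2 μ), Measurable[S.F 1 1] g ∧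
      D = hg.toLp g := by
    have h1 : μ[D | S.F 1 1] =ᵐ[μ] D := by
      have := coeFn_condE (S.F_le 1 1) D
      rw [show condE μ (S.F_le 1 1) D = D from ho.adapted] at this
      exact this.symm
    refine ⟨μ[D | S.F 1 1], (memLp_congr_ae h1).2 (Lp.memLp D),
      stronglyMeasurable_condExp.measurable, Lp.ext ?_⟩
    exact h1.symm.trans (MemLp.coeFn_toLp _).symm
  have h := tendsto_integral_exp_of_isOrthoDiff hg hT hgm ho t
  rw [← norm_sq_toLp hg] at h
  refine h.congr fun p => integral_congr_ae ?_
  filter_upwards [Lp.coeFn_smul (√p.1 * √p.2)⁻¹ (S.biShift.rectSum p.1 p.2 (hg.toLp g))]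
    with ω h
  rw [BiShift.normSum, h]
  rfl

/-- The central limit theorem for adapted elements of `L²` satisfying the dyadic form of the
Maxwell–Woodroofe condition. -/
theorem exists_tendsto_integral_exp_normSum (hT : Ergodic S.T₁ μ) {x : Lp ℝ 2 μ}
    (hx : S.biShift.E 0 0 x = x) (hs : Summable (dyadicTerm S.biShift.Q₁ S.biShift.Q₂ x)) :
    ∃ c : ℝ, Tendsto (fun p => ‖S.biShift.normSum p x‖) minAtTop (𝓝 c) ∧
      ∀ t : ℝ, Tendsto (fun p : ℕ × ℕ => ∫ ω, Complex.exp
        ((t * (S.biShift.normSum p x : Lp ℝ 2 μ) ω : ℝ) * Complex.I) ∂μ) minAtTop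
        (𝓝 (Real.exp (-(t ^ 2 * c ^ 2) / 2) : ℝ)) := by
  obtain ⟨c, hc⟩ := S.biShift.exists_tendsto_norm_normSum hx hs
  refine ⟨c, hc, fun t => ?_⟩
  rw [Metric.tendsto_nhds]
  intro δ hδ
  have hcont : ContinuousAt (fun s : ℝ => ((Real.exp (-(t ^ 2 * s ^ 2) / 2) : ℝ) : ℂ)) c := by
    fun_prop
  obtain ⟨η, hη, hη'⟩ := Metric.continuousAt_iff.1 hcont (δ / 3) (by positivity)
  have hε : 0 < min (η / 2) (δ / (3 * (|t| + 1))) := by positivity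
  obtain ⟨D, hD, h⟩ := S.biShift.exists_eventually_norm_normSum_sub_le hx hs hε
  -- Here `D` depends on the accuracy, so its variance only approximates `c²`; continuity of the
  -- Gaussian characteristic function absorbs the difference.
  have hDc : dist ‖D‖ c < η := by
    refine lt_of_le_of_lt (b := η / 2) ?_ (by linarith)
    rw [dist_comm]
    refine le_of_tendsto (hc.dist tendsto_const_nhds) ?_
    filter_upwards [h] with p hp
    rw [Real.dist_eq, ← hp.1]
    exact ((abs_norm_sub_norm_le _ _).trans hp.2).trans (min_le_left _ _)
  filter_upwards [h, Metric.tendsto_nhds.1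
    (S.tendsto_integral_exp_normSum_of_isOrthoDiff hT hD t) (δ / 3) (by positivity)] with p hp1 hp2
  have h1 := norm_integral_exp_sub_le (S.biShift.normSum p x) (S.biShift.normSum p D) t
  rw [← dist_eq_norm] at h1
  have h2 : |t| * ‖S.biShift.normSum p x - S.biShift.normSum p D‖ ≤ δ / 3 := by
    calc _ ≤ |t| * (δ / (3 * (|t| + 1))) := by
          gcongr; exact hp1.2.trans (min_le_right _ _)
      _ ≤ δ / 3 := by
          rw [← mul_div_assoc, div_le_div_iff₀ (by positivity) (by positivity)]
          nlinarith [abs_nonneg t]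
  have h3 := hη' hDc
  have h4 := dist_triangle4 (∫ ω, Complex.exp
        ((t * (S.biShift.normSum p x : Lp ℝ 2 μ) ω : ℝ) * Complex.I) ∂μ) _ _
        ((Real.exp (-(t ^ 2 * c ^ 2) / 2) : ℝ) : ℂ) |>.trans_lt
        (add_lt_add (add_lt_add_of_le_of_lt (h1.trans h2) hp2) h3)
  linarith

end CommutingField

namespace CommutingField

/-! ### Sums over rectangles with corner `(1, 1)` -/

variable {Ω : Type*} [m0 : MeasurableSpace Ω] {μ : Measure Ω} [IsProbabilityMeasure μ]
  (S : CommutingField μ)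

/-- The sum of the translates of `g` over `{1, …, k} × {1, …, j}`. -/
def boxSum (g : Ω → ℝ) (k j : ℕ) (ω : Ω) : ℝ :=
  ∑ u ∈ Finset.Icc 1 k, ∑ v ∈ Finset.Icc 1 j, g (S.shift u v ω)

/-- The sum of the translates of `g` over `{0, …, k - 1} × {0, …, j - 1}`. -/
def cornerSum (g : Ω → ℝ) (k j : ℕ) (ω : Ω) : ℝ :=
  ∑ v ∈ range j, ∑ u ∈ range k, g (S.shift u v ω)

lemma shift_shift (a b u v : ℕ) (ω : Ω) :
    S.shift u v (S.shift a b ω) = S.shift (u + a) (v + b) ω := by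
  simp only [shift]
  rw [← S.comm.iterate_iterate a v, ← Function.iterate_add_apply, ← Function.iterate_add_apply]

lemma boxSum_eq_comp_shift (g : Ω → ℝ) (k j : ℕ) :
    S.boxSum g k j = S.cornerSum g k j ∘ S.shift 1 1 := by
  ext ω
  simp only [boxSum, cornerSum, Function.comp_apply, shift_shift]
  rw [Finset.sum_comm, ← Finset.Ico_add_one_right_eq_Icc, ← Finset.Ico_add_one_right_eq_Icc,
    Finset.sum_Ico_eq_sum_range]
  refine Finset.sum_congr rfl fun v _ => ?_
  rw [Finset.sum_Ico_eq_sum_range]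
  exact Finset.sum_congr rfl fun u _ => by rw [add_comm 1, add_comm 1]

lemma measurable_cornerSum {g : Ω → ℝ} (hg : Measurable g) (k j : ℕ) :
    Measurable (S.cornerSum g k j) :=
  Finset.measurable_fun_sum _ fun _ _ => Finset.measurable_fun_sum _ fun _ _ =>
    hg.comp (S.mp_shift _ _).measurable

lemma measurable_boxSum {g : Ω → ℝ} (hg : Measurable g) (k j : ℕ) :
    Measurable (S.boxSum g k j) := by
  rw [boxSum_eq_comp_shift]
  exact (S.measurable_cornerSum hg k j).comp (S.mp_shift 1 1).measurable

lemma integrable_boxSum {g : Ω → ℝ} (hg : Integrable g μ) (k j : ℕ) :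
    Integrable (S.boxSum g k j) μ :=
  integrable_finsetSum _ fun u _ => integrable_finsetSum _ fun v _ =>
    (S.mp_shift u v).integrable_comp_of_integrable hg

variable {g : Ω → ℝ}

lemma memLp_boxSum (hg : MemLp g 2 μ) (k j : ℕ) : MemLp (S.boxSum g k j) 2 μ :=
  memLp_finsetSum (Finset.Icc 1 k) (f := fun u ω => ∑ v ∈ Finset.Icc 1 j, g (S.shift u v ω))
    fun u _ => memLp_finsetSum (Finset.Icc 1 j) (f := fun v ω => g (S.shift u v ω))
    fun v _ => hg.comp_measurePreserving (S.mp_shift u v)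

lemma cornerSum_ae (hg : MemLp g 2 μ) (k j : ℕ) :
    ((S.biShift.rectSum k j (hg.toLp g) : Lp ℝ 2 μ) : Ω → ℝ) =ᵐ[μ] S.cornerSum g k j :=
  S.rectSum_toLp_ae hg k j

lemma E_zero_toLp (hgm : Measurable[S.F 0 0] g) (hg : MemLp g 2 μ) :
    S.biShift.E 0 0 (hg.toLp g) = hg.toLp g := by
  refine Lp.ext ((coeFn_condE (S.F_le 0 0) _).trans ?_)
  refine (condExp_congr_ae hg.coeFn_toLp).trans ?_
  rw [condExp_of_stronglyMeasurable (S.F_le 0 0) hgm.stronglyMeasurable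
    (hg.integrable (by norm_num))]
  exact hg.coeFn_toLp.symm

/-- Translating by `(1, 1)` turns sums starting at 1 conditioned on `F 1 1` into sums starting at 0
conditioned on `F 0 0`, where `E_zero_rectSum` applies. -/
lemma eLpNorm_condExp_boxSum (hgm : Measurable[S.F 0 0] g) (hg : MemLp g 2 μ) (k j : ℕ) :
    eLpNorm (μ[S.boxSum g k j | S.F 1 1]) 2 μ =
      ‖geomSum S.biShift.Q₁ k (geomSum S.biShift.Q₂ j (hg.toLp g))‖ₑ := by
  have h1 : μ[S.boxSum g k j | S.F 1 1] =ᵐ[μ] μ[S.cornerSum g k j | S.F 0 0] ∘ S.shift 1 1 := by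
    have e : (S.F 0 0).comap (S.shift 1 1) = S.F 1 1 := by
      change (S.F 0 0).comap (S.T₁^[1] ∘ S.T₂^[1]) = _
      rw [← MeasurableSpace.comap_comp, S.comap_iterate₁, S.comap_iterate₂]
      norm_num
    rw [boxSum_eq_comp_shift, ← e]
    refine condExp_comp_of_measurePreserving (S.mp_shift 1 1) (S.F_le 0 0) ?_
    exact ((Lp.memLp _).integrable (by norm_num)).congr (S.cornerSum_ae hg k j)
  rw [eLpNorm_congr_ae h1, eLpNorm_comp_measurePreserving
    (stronglyMeasurable_condExp.mono (S.F_le 0 0)).aestronglyMeasurable (S.mp_shift 1 1),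
    ← S.biShift.E_zero_rectSum (S.E_zero_toLp hgm hg), Lp.enorm_def]
  refine eLpNorm_congr_ae ?_
  exact (condExp_congr_ae (S.cornerSum_ae hg k j).symm).trans (coeFn_condE (S.F_le 0 0) _).symm

/-- The first term of the series suffices: its sum is a single translate of `g`, already `F 1
1`-measurable, so the conditional expectation leaves it unchanged. -/
lemma memLp_of_tsum_lt_top (hgm : Measurable[S.F 0 0] g) (hg : Integrable g μ)
    (h : ∑' (j : ℕ) (k : ℕ), mwWeight (j + 1) * mwWeight (k + 1) *
      eLpNorm (μ[S.boxSum g (j + 1) (k + 1) | S.F 1 1]) 2 μ < ∞) : MemLp g 2 μ := by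
  have h1 := ENNReal.ne_top_of_tsum_ne_top (ENNReal.ne_top_of_tsum_ne_top h.ne 0) 0
  have e : S.boxSum g (0 + 1) (0 + 1) = fun ω => g (S.shift 1 1 ω) := by
    ext ω; simp [boxSum]
  have hm : Measurable[S.F 1 1] fun ω => g (S.shift 1 1 ω) :=
    S.measurable_comp_shift hgm (by norm_num) (by norm_num)
  rw [e, condExp_of_stronglyMeasurable (S.F_le 1 1) hm.stronglyMeasurable
    ((S.mp_shift 1 1).integrable_comp_of_integrable hg)] at h1
  have h2 : eLpNorm (fun ω => g (S.shift 1 1 ω)) 2 μ = eLpNorm g 2 μ :=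
    eLpNorm_comp_measurePreserving hg.1 (S.mp_shift 1 1)
  rw [h2] at h1
  refine ⟨hg.1, lt_top_iff_ne_top.2 fun ht => h1 ?_⟩
  rw [ht]
  simp [mwWeight]

/-- The central limit theorem under the two-parameter Maxwell–Woodroofe condition, on a space
carrying the translations. -/
theorem exists_tendsto_of_tsum_lt_top (hT : Ergodic S.T₁ μ) (hgm : Measurable[S.F 0 0] g)
    (hg : Integrable g μ) (h : ∑' (j : ℕ) (k : ℕ), mwWeight (j + 1) * mwWeight (k + 1) *
      eLpNorm (μ[S.boxSum g (j + 1) (k + 1) | S.F 1 1]) 2 μ < ∞) :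
    ∃ c : ℝ, (∀ k j, MemLp (S.boxSum g k j) 2 μ) ∧
      Tendsto (fun p : ℕ × ℕ => 1 / ((p.1 : ℝ) * p.2) * ∫ ω, S.boxSum g p.1 p.2 ω ^ 2 ∂μ)
        minAtTop (𝓝 (c ^ 2)) ∧
      ∀ t : ℝ, Tendsto (fun p : ℕ × ℕ => ∫ ω, Complex.exp
        ((t * (1 / √((p.1 : ℝ) * p.2) * S.boxSum g p.1 p.2 ω) : ℝ) * Complex.I) ∂μ) minAtTop
        (𝓝 (Real.exp (-(t ^ 2 * c ^ 2) / 2) : ℝ)) := by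
  have hg2 := S.memLp_of_tsum_lt_top hgm hg h
  simp only [S.eLpNorm_condExp_boxSum hgm hg2] at h
  have hgm' : Measurable g := hgm.mono (S.F_le 0 0) le_rfl
  obtain ⟨c, hc, hc'⟩ := S.exists_tendsto_integral_exp_normSum hT (S.E_zero_toLp hgm hg2)
    (summable_dyadicTerm S.biShift.Q_comm S.biShift.norm_Q₁_le S.biShift.norm_Q₂_le h)
  refine ⟨c, S.memLp_boxSum hg2, (hc.pow 2).congr fun p => ?_, fun t => (hc' t).congr fun p => ?_⟩
  · rw [BiShift.normSum, norm_smul, mul_pow, norm_inv, inv_pow, ← one_div, Real.norm_eq_abs, sq_abs,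
      mul_pow, Real.sq_sqrt (Nat.cast_nonneg _), Real.sq_sqrt (Nat.cast_nonneg _)]
    congr 1
    have e := integral_comp_of_measurePreserving (S.mp_shift 1 1)
      (f := fun ω => S.cornerSum g p.1 p.2 ω ^ 2)
      ((S.measurable_cornerSum hgm' _ _).pow_const 2).aestronglyMeasurable
    simp only [S.boxSum_eq_comp_shift, Function.comp_apply]
    rw [e, ← real_inner_self_eq_norm_sq, MeasureTheory.L2.inner_def]
    refine integral_congr_ae ?_
    filter_upwards [S.cornerSum_ae hg2 p.1 p.2] with ω h
    rw [h]
    simp [sq]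
  · have e := integral_comp_of_measurePreserving (S.mp_shift 1 1)
      (f := fun ω => Complex.exp
        ((t * (1 / √((p.1 : ℝ) * p.2) * S.cornerSum g p.1 p.2 ω) : ℝ) * Complex.I))
      (integrable_exp_ofReal_mul_I
        ((S.measurable_cornerSum hgm' _ _).const_mul _).aestronglyMeasurable t).1
    simp only [S.boxSum_eq_comp_shift, Function.comp_apply]
    rw [e]
    refine integral_congr_ae ?_
    filter_upwards [S.cornerSum_ae hg2 p.1 p.2, Lp.coeFn_smul (√p.1 * √p.2)⁻¹
      (S.biShift.rectSum p.1 p.2 (hg2.toLp g))] with ω h1 h2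
    rw [BiShift.normSum, h2, Pi.smul_apply, h1, smul_eq_mul, Real.sqrt_mul (Nat.cast_nonneg _),
      one_div]

end CommutingField

/-! ### The path space -/

section Sigma

variable {Ω Ω' E : Type*} [MeasurableSpace E]

lemma pastSigma_le [m0 : MeasurableSpace Ω] {ξ : ℤ × ℤ → Ω → E} (hξ : ∀ p, Measurable (ξ p))
    (n m : ℤ) : pastSigma ξ n m ≤ m0 :=
  iSup₂_le fun _ _ => iSup₂_le fun _ _ => (hξ _).comap_le

lemma comap_le_pastSigma (ξ : ℤ × ℤ → Ω → E) {n m i j : ℤ} (hi : i ≤ n) (hj : j ≤ m) :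
    MeasurableSpace.comap (ξ (i, j)) inferInstance ≤ pastSigma ξ n m :=
  le_iSup₂_of_le i hi (le_iSup₂_of_le j hj le_rfl)

lemma pastSigma_mono (ξ : ℤ × ℤ → Ω → E) {n n' m m' : ℤ} (hn : n ≤ n') (hm : m ≤ m') :
    pastSigma ξ n m ≤ pastSigma ξ n' m' :=
  iSup₂_le fun _ hi => iSup₂_le fun _ hj =>
    comap_le_pastSigma ξ (hi.trans hn) (hj.trans hm)

lemma comap_pastSigma (ξ : ℤ × ℤ → Ω → E) (T : Ω' → Ω) (n m : ℤ) :
    (pastSigma ξ n m).comap T = pastSigma (fun p => ξ p ∘ T) n m := by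
  simp only [pastSigma, MeasurableSpace.comap_iSup, MeasurableSpace.comap_comp]

lemma pastSigma_translate (ξ : ℤ × ℤ → Ω → E) (a : ℤ × ℤ) (n m : ℤ) :
    pastSigma (fun p => ξ (p + a)) n m = pastSigma ξ (n + a.1) (m + a.2) := by
  refine le_antisymm (iSup₂_le fun i hi => iSup₂_le fun j hj => ?_)
    (iSup₂_le fun i hi => iSup₂_le fun j hj => ?_)
  · exact comap_le_pastSigma ξ (i := i + a.1) (j := j + a.2) (by omega) (by omega)
  · have := comap_le_pastSigma (fun p => ξ (p + a)) (n := n) (m := m) (i := i - a.1)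
      (j := j - a.2) (by omega) (by omega)
    simpa only [Prod.mk_add_mk, sub_add_cancel, show ((i - a.1, j - a.2) + a : ℤ × ℤ) = (i, j) by
      ext <;> simp] using this

lemma measurable_field {f : (ℕ × ℕ → E) → ℝ} (hf : Measurable f) (ξ : ℤ × ℤ → Ω → E) (n m : ℤ) :
    Measurable[pastSigma ξ n m] (field f ξ n m) := by
  refine hf.comp (@measurable_pi_lambda _ _ _ (pastSigma ξ n m) _ _ fun q => ?_)
  exact Measurable.of_comap_le (comap_le_pastSigma ξ (by omega) (by omega))

end Sigma

/-- The translation of the path space by `a`. -/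
def pathShift {E : Type*} (a : ℤ × ℤ) (x : ℤ × ℤ → E) : ℤ × ℤ → E := fun p => x (p + a)

lemma vshift_eq_pathShift {E : Type*} : (vshift : (ℤ × ℤ → E) → ℤ × ℤ → E) = pathShift (1, 0) := by
  ext x p
  simp only [vshift, pathShift]
  congr 1
  ext <;> simp

lemma pathShift_iterate {E : Type*} (a : ℤ × ℤ) (n : ℕ) :
    (pathShift a : (ℤ × ℤ → E) → _)^[n] = pathShift (n • a) := by
  induction n with
  | zero => ext x p; simp [pathShift]
  | succ n ih =>
    rw [Function.iterate_succ', ih]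
    ext x p
    simp only [Function.comp_apply, pathShift, succ_nsmul, add_assoc]
    rw [add_comm a]

/-! ### Transfer of the hypotheses to the path space -/

section Path

variable {Ω E : Type*} [m0 : MeasurableSpace Ω] [MeasurableSpace E]
  {μ : Measure Ω} {ξ : ℤ × ℤ → Ω → E}

lemma measurePreserving_path (hξ : ∀ p, Measurable (ξ p)) :
    MeasurePreserving (fun ω p => ξ p ω) μ (pathLaw μ ξ) :=
  ⟨measurable_pi_lambda _ hξ, rfl⟩

lemma measurePreserving_pathShift (hξ : ∀ p, Measurable (ξ p)) (hs : IsStationary μ ξ)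
    (a : ℤ × ℤ) : MeasurePreserving (pathShift a) (pathLaw μ ξ) (pathLaw μ ξ) := by
  have hm : Measurable (pathShift a : (ℤ × ℤ → E) → _) :=
    measurable_pi_lambda _ fun p => measurable_pi_apply _
  refine ⟨hm, ?_⟩
  conv_rhs => rw [← hs a]
  rw [pathLaw, Measure.map_map hm (measurable_pi_lambda _ hξ)]
  rfl

variable [IsProbabilityMeasure μ]

lemma isProbabilityMeasure_pathLaw (hξ : ∀ p, Measurable (ξ p)) :
    IsProbabilityMeasure (pathLaw μ ξ) :=
  Measure.isProbabilityMeasure_map (measurable_pi_lambda _ hξ).aemeasurable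

lemma condExp_path (hξ : ∀ p, Measurable (ξ p)) {Y : (ℤ × ℤ → E) → ℝ}
    (hY : Integrable Y (pathLaw μ ξ)) (n m : ℤ) :
    μ[Y ∘ (fun ω p => ξ p ω) | pastSigma ξ n m] =ᵐ[μ]
      (pathLaw μ ξ)[Y | pastSigma Function.eval n m] ∘ (fun ω p => ξ p ω) := by
  have := isProbabilityMeasure_pathLaw (μ := μ) hξ
  have h := condExp_comp_of_measurePreserving (measurePreserving_path (μ := μ) hξ)
    (pastSigma_le (fun p => measurable_pi_apply p) n m) hY
  rwa [comap_pastSigma] at h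

/-- Both sides are measurable functions of the path, so it suffices to compare them after
composition with the field, where conditional expectations on the path space become those given
`pastSigma ξ`. -/
lemma isCommuting_path (hξ : ∀ p, Measurable (ξ p)) (hc : IsCommuting μ (pastSigma ξ)) :
    IsCommuting (pathLaw μ ξ) (pastSigma Function.eval) := by
  intro a b u v hu Y hY
  have hle := fun n m => pastSigma_le (E := E) (fun p => measurable_pi_apply p) n m
  have hΞ := measurePreserving_path (μ := μ) hξ
  have hmeas : ∀ (Z : (ℤ × ℤ → E) → ℝ) (n m : ℤ),
      Measurable ((pathLaw μ ξ)[Z | pastSigma Function.eval n m]) := fun Z n m =>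
    (stronglyMeasurable_condExp.mono (hle n m)).measurable
  refine (ae_map_iff hΞ.measurable.aemeasurable
    (measurableSet_eq_fun (hmeas _ _ _) (hmeas _ _ _))).2 ?_
  have h1 := condExp_path (μ := μ) hξ (integrable_condExp (m := pastSigma Function.eval a b) (f := Y)) u v
  have h2 := condExp_congr_ae (m := pastSigma ξ u v) (condExp_path (μ := μ) hξ hY a b)
  have h3 := hc a b u v hu _ (hΞ.integrable_comp_of_integrable hY)
  exact h1.symm.trans (h2.symm.trans (h3.trans (condExp_path hξ hY u (min b v))))

/-- The path space of a stationary random field with a commuting filtration. -/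
def pathField (hξ : ∀ p, Measurable (ξ p)) (hs : IsStationary μ ξ)
    (hc : IsCommuting μ (pastSigma ξ)) : CommutingField (pathLaw μ ξ) where
  T₁ := pathShift (1, 0)
  T₂ := pathShift (0, 1)
  mp₁ := measurePreserving_pathShift hξ hs _
  mp₂ := measurePreserving_pathShift hξ hs _
  comm x := by
    ext p
    simp only [pathShift, add_right_comm]
  F := pastSigma Function.eval
  F_le := pastSigma_le fun p => measurable_pi_apply p
  F_mono := pastSigma_mono _
  comap₁ a b := by
    rw [comap_pastSigma]
    exact (pastSigma_translate Function.eval (1, 0) a b).trans (by simp)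
  comap₂ a b := by
    rw [comap_pastSigma]
    exact (pastSigma_translate Function.eval (0, 1) a b).trans (by simp)
  commuting := isCommuting_path hξ hc

lemma boxSum_pathField (hξ : ∀ p, Measurable (ξ p)) (hs : IsStationary μ ξ)
    (hc : IsCommuting μ (pastSigma ξ)) (f : (ℕ × ℕ → E) → ℝ) (k j : ℕ) :
    (pathField hξ hs hc).boxSum (field f Function.eval 0 0) k j ∘ (fun ω p => ξ p ω) =
      partialSum (field f ξ) k j := by
  ext ω
  simp only [CommutingField.boxSum, partialSum, Function.comp_apply]
  refine Finset.sum_congr rfl fun u _ => Finset.sum_congr rfl fun v _ => ?_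
  change field f Function.eval 0 0 ((pathShift (1, 0))^[u] ((pathShift (0, 1))^[v] _)) = _
  rw [pathShift_iterate, pathShift_iterate]
  refine congrArg f (funext fun q => congrArg (fun p => ξ p ω) ?_)
  ext <;> simp <;> ring

end Path

/-- Convergence in distribution to a centered Gaussian law from the convergence of the
characteristic functions. -/
lemma tendstoInDistribution_gaussian {Ω : Type*} [MeasurableSpace Ω] {μ : Measure Ω}
    [IsProbabilityMeasure μ] {ι : Type*} {l : Filter ι} [l.IsCountablyGenerated]
    {X : ι → Ω → ℝ} (hX : ∀ i, AEMeasurable (X i) μ) {c : ℝ}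
    (h : ∀ t : ℝ, Tendsto (fun i => ∫ ω, Complex.exp ((t * X i ω : ℝ) * Complex.I) ∂μ) l
      (𝓝 (Real.exp (-(t ^ 2 * c ^ 2) / 2) : ℝ))) :
    TendstoInDistribution X l (id : ℝ → ℝ) (fun _ => μ)
      (gaussianReal 0 (Real.toNNReal (c ^ 2))) where
  forall_aemeasurable := hX
  aemeasurable_limit := aemeasurable_id
  tendsto := by
    -- Lévy's continuity theorem is applied along sequences, which determine convergence along a
    -- countably generated filter.
    refine tendsto_of_seq_tendsto fun s hs => ?_
    refine ProbabilityMeasure.tendsto_of_tendsto_charFun fun t => ?_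
    have e1 : charFun ((gaussianReal 0 (Real.toNNReal (c ^ 2))).map id) t =
        (Real.exp (-(t ^ 2 * c ^ 2) / 2) : ℝ) := by
      rw [Measure.map_id, charFun_gaussianReal, Complex.ofReal_exp]
      congr 1
      have : ((Real.toNNReal (c ^ 2) : ℝ≥0) : ℝ) = c ^ 2 := Real.coe_toNNReal _ (sq_nonneg c)
      rw [this]
      push_cast
      ring
    have e2 (i : ι) : charFun (μ.map (X i)) t =
        ∫ ω, Complex.exp ((t * X i ω : ℝ) * Complex.I) ∂μ := by
      rw [charFun_apply_real, integral_map (hX i) (by fun_prop)]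
      simp only [Complex.ofReal_mul]
    change Tendsto (fun n => charFun (μ.map (X (s n))) t) atTop (𝓝 (charFun (Measure.map id _) t))
    rw [e1]
    simp only [e2]
    exact (h t).comp hs

end RandomField

open RandomField in
theorem mainTheorem1 {Ω E : Type*} [MeasurableSpace Ω] [MeasurableSpace E]
    (μ : Measure Ω) [IsProbabilityMeasure μ]
    (ξ : ℤ × ℤ → Ω → E) (hξ : ∀ p, Measurable (ξ p))
    (hstat : RandomField.IsStationary μ ξ)
    (f : (ℕ × ℕ → E) → ℝ) (hf : Measurable f)
    (hint : Integrable (RandomField.field f ξ 0 0) μ)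
    (hcomm : RandomField.IsCommuting μ (RandomField.pastSigma ξ))
    (hMW : RandomField.MaxwellWoodroofe μ (RandomField.pastSigma ξ) (RandomField.field f ξ))
    (herg : Ergodic RandomField.vshift (RandomField.pathLaw μ ξ)) :
    ∃ c : ℝ,
      (∀ n₁ n₂ : ℕ, MemLp (RandomField.partialSum (RandomField.field f ξ) n₁ n₂) 2 μ) ∧
      Tendsto
        (fun n : ℕ × ℕ =>
          1 / ((n.1 : ℝ) * (n.2 : ℝ)) *
            ∫ ω, (RandomField.partialSum (RandomField.field f ξ) n.1 n.2 ω) ^ 2 ∂μ)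
        (comap (fun n : ℕ × ℕ => min n.1 n.2) atTop) (𝓝 (c ^ 2)) ∧
      TendstoInDistribution
        (fun (n : ℕ × ℕ) (ω : Ω) =>
          1 / √((n.1 : ℝ) * (n.2 : ℝ)) *
            RandomField.partialSum (RandomField.field f ξ) n.1 n.2 ω)
        (comap (fun n : ℕ × ℕ => min n.1 n.2) atTop)
        (id : ℝ → ℝ) (fun _ => μ) (gaussianReal 0 (Real.toNNReal (c ^ 2))) := by
  have := isProbabilityMeasure_pathLaw (μ := μ) hξ
  have hΞ := measurePreserving_path (μ := μ) hξ
  set S := pathField hξ hstat hcomm with hS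
  set g := field f (Function.eval : ℤ × ℤ → (ℤ × ℤ → E) → E) 0 0 with hg
  have hgm : Measurable[S.F 0 0] g := measurable_field hf _ 0 0
  have hgm' : Measurable g := hgm.mono (S.F_le 0 0) le_rfl
  have hgi : Integrable g (pathLaw μ ξ) := (hΞ.integrable_comp hgm'.aestronglyMeasurable).1 hint
  have hbox (k j : ℕ) : S.boxSum g k j ∘ (fun ω p => ξ p ω) = partialSum (field f ξ) k j :=
    boxSum_pathField hξ hstat hcomm f k j
  have hsum : ∑' (j : ℕ) (k : ℕ), mwWeight (j + 1) * mwWeight (k + 1) *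
      eLpNorm ((pathLaw μ ξ)[S.boxSum g (j + 1) (k + 1) | S.F 1 1]) 2 (pathLaw μ ξ) < ∞ := by
    -- The two series agree term by term, as the map to the path space preserves `L²` norms and
    -- conditional expectations.
    refine lt_of_eq_of_lt (tsum_congr fun j => tsum_congr fun k => ?_) hMW
    rw [← eLpNorm_comp_measurePreserving
      (stronglyMeasurable_condExp.mono (S.F_le 1 1)).aestronglyMeasurable hΞ,
      ← hbox, eLpNorm_congr_ae (condExp_path hξ (S.integrable_boxSum hgi _ _) 1 1),
      mwWeight, mwWeight, ← ENNReal.ofReal_mul (by positivity), one_div_mul_one_div]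
    rfl
  obtain ⟨c, h1, h2, h3⟩ := S.exists_tendsto_of_tsum_lt_top
    (by rw [vshift_eq_pathShift] at herg; exact herg) hgm hgi hsum
  have hmem (k j : ℕ) : MemLp (partialSum (field f ξ) k j) 2 μ := by
    rw [← hbox]
    exact (h1 k j).comp_measurePreserving hΞ
  refine ⟨c, hmem, h2.congr fun p => ?_, ?_⟩
  · have e := integral_comp_of_measurePreserving hΞ (f := fun x => S.boxSum g p.1 p.2 x ^ 2)
      ((S.measurable_boxSum hgm' _ _).pow_const 2).aestronglyMeasurable
    rw [← e, ← hbox]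
    rfl
  · have hX (p : ℕ × ℕ) : AEMeasurable (fun ω => 1 / √((p.1 : ℝ) * p.2) *
        partialSum (field f ξ) p.1 p.2 ω) μ := (hmem p.1 p.2).1.aemeasurable.const_mul _
    refine tendstoInDistribution_gaussian hX (c := c) fun t => ?_
    refine Tendsto.congr (fun p => ?_) (h3 t)
    have e := integral_comp_of_measurePreserving hΞ (f := fun x => Complex.exp
        ((t * (1 / √((p.1 : ℝ) * p.2) * S.boxSum g p.1 p.2 x) : ℝ) * Complex.I))
      (integrable_exp_ofReal_mul_I
        ((S.measurable_boxSum hgm' _ _).const_mul _).aestronglyMeasurable t).1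
    rw [← e, ← hbox]
    rfl
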